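/- **Setting.** Let $\mathcal S$ be a measurable space, $\mathcal A$ a finite nonempty set, $d,H,K\in\mathbb N$ and $T=KH$. A nonstationary episodic linear MDP consists of a known measurable feature map $\phi:\mathcal S\times\mathcal A\to\mathbb R^d$ with $\|\phi(s,a)\|_2\le 1$ and, for every episode $k\in[K]$ and step $h\in[H]$, a vector $\theta_{h,k}\in\mathbb R^d$ and a vector $\mu_{h,k}=(\mu^1_{h,k},\dots,\mu^d_{h,k})$ of (signed) measures on $\mathcal S$ such that $\mathbb P^k_h(\cdot\mid s,a)=\langle\phi(s,a),\mu_{h,k}(\cdot)\rangle$ is a Markov kernel, the deterministic reward $r^k_h(s,a)=\langle\phi(s,a),\theta_{h,k}\rangle$ lies in $[0,1]$, and $\|\theta_{h,k}\|_2\le\sqrt d$, $\|\mu_{h,k}\|\le\sqrt d$. Here $\|\nu\|:=\big\|(|\nu^1|(\mathcal S),\dots,|\nu^d|(\mathcal S))\big\|_2$ for a vector $\nu$ of signed measures, $|\nu^i|$ being the total variation of $\nu^i$. In each episode $k$ the learner fixes a policy $\pi^k=(\pi^k_h)_{h\in[H]}$, $\pi^k_h:\mathcal S\to\mathcal A$,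 on the basis of the past; the initial state $s^k_1$ is chosen arbitrarily (possibly depending on the past); for $h\in[H]$ the learner plays $a^k_h=\pi^k_h(s^k_h)$ and receives $r^k_h(s^k_h,a^k_h)$, and for $h<H$ the state $s^k_{h+1}$ is drawn from $\mathbb P^k_h(\cdot\mid s^k_h,a^k_h)$. With $V^\pi_{h,k}(s)$ the expected cumulative reward of policy $\pi$ in episode $k$ from step $h$ on, started at $s$, and $V^*_{h,k}=\sup_\pi V^\pi_{h,k}$, the dynamic regret is $$\text{Dyn-Reg}(T)=\sum_{k=1}^K\big[V^*_{1,k}(s^k_1)-V^{\pi^k}_{1,k}(s^k_1)\big].$$ For a set $\mathcal E$ of consecutive episodes let $B_{\theta,\mathcal E}=\sum_{k:\,k-1,k\in\mathcal E}\sum_{h=1}^H\|\theta_{h,k}-\theta_{h,k-1}\|_2$ and $B_{\mu,\mathcal E}=\sum_{k:\,k-1,k\in\mathcal E}\sum_{h=1}^H\|\mu_{h,k}-\mu_{h,k-1}\|$, and write $B_\theta,B_\mu$ for $\mathcal E=[K]$. **Algorithm** (LSVI-UCB-Restart, epoch size $W$, bonus coefficients $\beta_k$). Let $1\le W\le T$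 be a multiple of $H$. The episodes are divided into consecutive epochs of $W/H$ episodes (the last one may be shorter). In episode $k$ of an epoch $\mathcal E$ with first episode $\tau$, starting from $Q^k_{H+1}=0$, the learner computes for $h=H,\dots,1$, with $\phi^l_h=\phi(s^l_h,a^l_h)$, $$\Lambda^k_h=I+\sum_{l=\tau}^{k-1}\phi^l_h(\phi^l_h)^\top,\qquad w^k_h=(\Lambda^k_h)^{-1}\sum_{l=\tau}^{k-1}\phi^l_h\Big[r^l_h(s^l_h,a^l_h)+\max_a Q^k_{h+1}(s^l_{h+1},a)\Big],$$ $$Q^k_h(s,a)=\min\Big\{\langle w^k_h,\phi(s,a)\rangle+\beta_k\sqrt{\phi(s,a)^\top(\Lambda^k_h)^{-1}\phi(s,a)},\;H\Big\},$$ and plays $\pi^k_h(s)\in\arg\max_aQ^k_h(s,a)$, with arbitrary tie-breaking. **Theorem** (known local variation). There are absolute constants $c,C>0$ and $q\in\mathbb N$ such that for every such MDP, every epoch size $W$ as above and every $p\in(0,1)$, if for each episode $k$, lying in the epoch $\mathcal E$ with first episode $\tau$, $$\beta_k=c\,dH\sqrt{\log(2dT/p)}+B_{\theta,\mathcal E}\sqrt{d(k-\tau)}+B_{\mu,\mathcal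 E}H\sqrt{d(k-\tau)},$$ then with probability at least $1-p$ the dynamic regret of LSVI-UCB-Restart satisfies $$\text{Dyn-Reg}(T)\le C\,\big(\log(2dT/p)\big)^q\Big(H^{3/2}d^{3/2}TW^{-1/2}+B_\theta\,dW+B_\mu\,dHW\Big),$$ that is, it is $\tilde O(H^{3/2}d^{3/2}TW^{-1/2}+B_\theta dW+B_\mu dHW)$. -/

import Mathlib

open MeasureTheory ProbabilityTheory Finset
open scoped BigOperators Matrix

noncomputable section

namespace NonstatRL

/-- Size of a family `ν = (ν₁, …, ν_d)` of signed measures on `S`: the Euclidean norm of the vector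
of total variations `(|ν₁|(S), …, |ν_d|(S))`. For nonnegative measures it is `‖ν(S)‖₂`. -/
def tvNorm {S : Type*} [MeasurableSpace S] {d : ℕ} (ν : Fin d → SignedMeasure S) : ℝ :=
  ‖(WithLp.toLp 2 (fun i => (ν i).totalVariation.real Set.univ) : EuclideanSpace ℝ (Fin d))‖

/-- A nonstationary episodic linear MDP with `K` episodes of `H` steps each, and a `d`-dimensional
feature map `φ`. Episodes are numbered `0, …, K - 1` and steps `0, …, H - 1`: entries with an index
outside these ranges are unconstrained and never used. -/
structure LinearMDP (S A : Type*) [MeasurableSpace S] [MeasurableSpace A] (d H K : ℕ) where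
  /-- the feature map -/
  φ : S → A → EuclideanSpace ℝ (Fin d)
  /-- `trans k h (s, a)` is the law of the next state, at step `h` of episode `k` -/
  trans : ℕ → ℕ → Kernel (S × A) S
  /-- the reward parameters -/
  θ : ℕ → ℕ → EuclideanSpace ℝ (Fin d)
  /-- the transition parameters: `d` (signed) measures for each episode and step -/
  μ : ℕ → ℕ → Fin d → SignedMeasure S
  measurable_φ : Measurable (fun z : S × A => φ z.1 z.2)
  markov : ∀ k < K, ∀ h < H, IsMarkovKernel (trans k h)
  trans_eq : ∀ k < K, ∀ h < H, ∀ s a, ∀ B : Set S, MeasurableSet B →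
    (trans k h (s, a)).real B = ∑ i, φ s a i * μ k h i B
  reward_mem : ∀ k < K, ∀ h < H, ∀ s a, inner ℝ (φ s a) (θ k h) ∈ Set.Icc (0 : ℝ) 1
  norm_φ_le : ∀ s a, ‖φ s a‖ ≤ 1
  norm_θ_le : ∀ k < K, ∀ h < H, ‖θ k h‖ ≤ √d
  norm_μ_le : ∀ k < K, ∀ h < H, tvNorm (μ k h) ≤ √d

/-- A (deterministic Markov) policy: a measurable map from states to actions for every step. -/
structure Policy (S A : Type*) [MeasurableSpace S] [MeasurableSpace A] where
  act : ℕ → S → A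
  measurable_act : ∀ h, Measurable (act h)

namespace LinearMDP

variable {S A : Type*} [MeasurableSpace S] [MeasurableSpace A] {d H K : ℕ}

/-- The reward function at step `h` of episode `k`. -/
def reward (M : LinearMDP S A d H K) (k h : ℕ) (s : S) (a : A) : ℝ :=
  inner ℝ (M.φ s a) (M.θ k h)

/-- The law of the state at step `h + j` of episode `k`, when the state at step `h` is `s` and the
actions are those of `f`. -/
def stateLaw (M : LinearMDP S A d H K) (k : ℕ) (f : ℕ → S → A) (h : ℕ) (s : S) : ℕ → Measure S
  | 0 => Measure.dirac s
  | j + 1 => (M.stateLaw k f h s j).bind (fun x => M.trans k (h + j) (x, f (h + j) x))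

/-- The value function of the episode-`k` MDP: the expected cumulative reward from step `h` to the
end of the episode, started in state `s` at step `h` and following `f`. -/
def value (M : LinearMDP S A d H K) (k : ℕ) (f : ℕ → S → A) (h : ℕ) (s : S) : ℝ :=
  ∑ j ∈ range (H - h), ∫ x, M.reward k (h + j) x (f (h + j) x) ∂(M.stateLaw k f h s j)

/-- The optimal value function of the episode-`k` MDP. -/
def optValue (M : LinearMDP S A d H K) (k h : ℕ) (s : S) : ℝ :=
  ⨆ π : Policy S A, M.value k π.act h s

/-- Variation of the reward parameters over the episodes `a, a + 1, …, b - 1`. -/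
def varθ (M : LinearMDP S A d H K) (a b : ℕ) : ℝ :=
  ∑ k ∈ Ico (a + 1) b, ∑ h ∈ range H, ‖M.θ k h - M.θ (k - 1) h‖

/-- Variation of the transition parameters over the episodes `a, a + 1, …, b - 1`. -/
def varμ (M : LinearMDP S A d H K) (a b : ℕ) : ℝ :=
  ∑ k ∈ Ico (a + 1) b, ∑ h ∈ range H, tvNorm (fun i => M.μ k h i - M.μ (k - 1) h i)

/-- The first episode `τ` of the epoch that contains episode `k`, for epochs of `n` episodes. -/
def epochStart (n k : ℕ) : ℕ := k / n * n

/-- The bonus coefficient `β_k` with known local variation, for epochs of `W` time steps (that is,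
`W / H` episodes); the epoch of `k` consists of the episodes `τ, …, min (τ + W / H) K - 1`. -/
def bonus (M : LinearMDP S A d H K) (c p : ℝ) (W k : ℕ) : ℝ :=
  let τ := epochStart (W / H) k
  let e := min (τ + W / H) K
  c * d * H * √(Real.log (2 * d * (K * H) / p))
    + M.varθ τ e * √(d * ((k : ℝ) - τ))
    + M.varμ τ e * H * √(d * ((k : ℝ) - τ))

/-- The regularized Gram matrix `Λ_h^k` of the features of the pairs `(x l h, a l h)` visited at
step `h` in the earlier episodes `l` of the current epoch. -/
def gram (M : LinearMDP S A d H K) (W : ℕ) (x : ℕ → ℕ → S) (a : ℕ → ℕ → A) (k h : ℕ) :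
    Matrix (Fin d) (Fin d) ℝ :=
  1 + ∑ l ∈ Ico (epochStart (W / H) k) k,
    Matrix.vecMulVec (M.φ (x l h) (a l h)).ofLp (M.φ (x l h) (a l h)).ofLp

/-- The least-squares weights at step `h` of episode `k`, for the estimate `Q` of the action values
at step `h + 1`. -/
def weight (M : LinearMDP S A d H K) (W : ℕ) (x : ℕ → ℕ → S) (a : ℕ → ℕ → A) (k h : ℕ)
    (Q : S → A → ℝ) : Fin d → ℝ :=
  (M.gram W x a k h)⁻¹ *ᵥ ∑ l ∈ Ico (epochStart (W / H) k) k,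
    (M.reward l h (x l h) (a l h) + ⨆ b, Q (x l (h + 1)) b) • (M.φ (x l h) (a l h)).ofLp

/-- The estimated action values of LSVI-UCB-Restart in episode `k` when `n` steps remain, that is,
at step `H - n`, computed backwards from `0` after the last step. -/
def estimateAux (M : LinearMDP S A d H K) (W : ℕ) (β : ℕ → ℝ) (x : ℕ → ℕ → S) (a : ℕ → ℕ → A)
    (k : ℕ) : ℕ → S → A → ℝ
  | 0 => fun _ _ => 0
  | n + 1 => fun s b =>
      min ((M.φ s b).ofLp ⬝ᵥ
            M.weight W x a k (H - (n + 1)) (M.estimateAux W β x a k n)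
          + β k * √((M.φ s b).ofLp ⬝ᵥ ((M.gram W x a k (H - (n + 1)))⁻¹ *ᵥ (M.φ s b).ofLp)))
        H

/-- The estimate `Q_h^k` of the action values that LSVI-UCB-Restart, with epochs of `W` time steps
and bonus coefficients `β`, computes at step `h` of episode `k`. It uses the states `x l h` and
actions `a l h` of the earlier episodes `l` of the current epoch only. -/
def estimate (M : LinearMDP S A d H K) (W : ℕ) (β : ℕ → ℝ) (x : ℕ → ℕ → S) (a : ℕ → ℕ → A)
    (k h : ℕ) : S → A → ℝ :=
  M.estimateAux W β x a k (H - h)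

variable {Ω : Type*} [mΩ : MeasurableSpace Ω]

/-- The states `x k h` and the policies `π k` (chosen at the start of episode `k`) form an
interaction with the MDP, over a filtration indexed by the time `k * H + h`: the initial state of
every episode is arbitrary (it may depend on the past), and the other states follow the
transition kernels. -/
structure IsInteraction (M : LinearMDP S A d H K) (P : Measure Ω) (ℱ : Filtration ℕ mΩ)
    (x : ℕ → ℕ → Ω → S) (π : ℕ → ℕ → Ω → S → A) : Prop where
  measurable_state : ∀ k < K, ∀ h < H, Measurable[ℱ (k * H + h)] (x k h)
  measurable_policy : ∀ k < K, ∀ h < H,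
    Measurable[(ℱ (k * H)).prod inferInstance] (fun z : Ω × S => π k h z.1 z.2)
  transition : ∀ k < K, ∀ h, h + 1 < H → ∀ B : Set S, MeasurableSet B →
    P[(x k (h + 1) ⁻¹' B).indicator (fun _ => (1 : ℝ)) | ℱ (k * H + h)]
      =ᵐ[P] fun ω => (M.trans k h (x k h ω, π k h ω (x k h ω))).real B

/-- The policies `π` are those of LSVI-UCB-Restart with epochs of `W` time steps and bonus
coefficients `β`: they are greedy for its estimates (with arbitrary tie-breaking). -/
def IsLSVIUCBRestart (M : LinearMDP S A d H K) (W : ℕ) (β : ℕ → ℝ)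
    (x : ℕ → ℕ → Ω → S) (π : ℕ → ℕ → Ω → S → A) : Prop :=
  ∀ k < K, ∀ h < H, ∀ ω s b,
    M.estimate W β (fun l j => x l j ω) (fun l j => π l j ω (x l j ω)) k h s b ≤
      M.estimate W β (fun l j => x l j ω) (fun l j => π l j ω (x l j ω)) k h s (π k h ω s)

/-- The dynamic regret, on the outcome `ω`. -/
def dynReg (M : LinearMDP S A d H K) (x : ℕ → ℕ → Ω → S) (π : ℕ → ℕ → Ω → S → A) (ω : Ω) : ℝ :=
  ∑ k ∈ range K, (M.optValue k 0 (x k 0 ω) - M.value k (fun h => π k h ω) 0 (x k 0 ω))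

end LinearMDP

end NonstatRL

end

/-! For a fixed function `V`, the backup `r + P V` of an episode is linear in the features, with
parameter `backupVec`. Each regression target is therefore a linear response plus the centred noise
of `V` at a transition. The ridge estimate misses the current backup by three amounts, each a
multiple of `√(φᵀ Λ⁻¹ φ)`: the self-normalized noise, the regularization bias of order `H√d`, and
the drift of the parameter since the start of the epoch. By Cauchy–Schwarz on the leverages
(`sum_abs_inv_dotProduct_le`), the drift costs at most `(B_θ + H B_μ)√(k - τ)`. The bonus `β_k`
dominates the sum of the three (`radius_le_bonus`).

The function regressed on is itself computed from the data, so the noise must be controlled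
uniformly. For a deterministic `V`, Sherman–Morrison and Hoeffding's lemma make the exponential of
the self-normalized noise, compensated by the elliptical potential, a supermartingale
(`lintegral_exp_noiseExponent_le_one`). All value estimates lie in a class indexed by a bounded
weight vector and a bounded matrix. A union bound over a polynomially fine grid of these parameters
(`noiseBound_of_net`) costs only a factor `d²` in the exponent, which is why the noise has size
`dH√log`.

On the resulting event, backward induction gives accuracy of every regression (`goodEstimates`),
hence optimism (`value_le`). The regret of an episode is then at most twice the bonuses along its
trajectory plus martingale differences (`estValue_sub_value_le`). The differences are handled by an
Azuma bound over the episodes for each step. The bonuses are summed epoch by epoch with the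
elliptical potential lemma (`sum_sqrt_quad_le`), the variations of disjoint epochs adding up to at
most the total (`sum_bonus_le`). The constants are `c = 20`, `C = 200`, `q = 1`. -/

noncomputable section

namespace NonstatRL

/-! ### Quadratic forms of inverse Gram matrices -/

section Gram

variable {d : ℕ}

/-- The quadratic form `vᵀ Λ⁻¹ v`. -/
def quad (Λ : Matrix (Fin d) (Fin d) ℝ) (v : Fin d → ℝ) : ℝ := v ⬝ᵥ (Λ⁻¹ *ᵥ v)

/-- `Λ` is symmetric and at least the identity matrix in the Loewner order. -/
structure GeOne (Λ : Matrix (Fin d) (Fin d) ℝ) : Prop where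
  symm : Λᵀ = Λ
  le : ∀ v, v ⬝ᵥ v ≤ v ⬝ᵥ (Λ *ᵥ v)

theorem dotProduct_self_nonneg' (v : Fin d → ℝ) : 0 ≤ v ⬝ᵥ v :=
  Finset.sum_nonneg fun i _ => mul_self_nonneg (v i)

theorem dotProduct_sq_le (a b : Fin d → ℝ) : (a ⬝ᵥ b) ^ 2 ≤ (a ⬝ᵥ a) * (b ⬝ᵥ b) := by
  have := Finset.sum_mul_sq_le_sq_mul_sq Finset.univ a b
  simpa [dotProduct, sq] using this

theorem dotProduct_le_one_of_sq {v : Fin d → ℝ} (h : v ⬝ᵥ v ≤ 1) (i : Fin d) : |v i| ≤ 1 := by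
  have : v i * v i ≤ v ⬝ᵥ v :=
    Finset.single_le_sum (f := fun j => v j * v j) (fun j _ => mul_self_nonneg _)
      (Finset.mem_univ i)
  exact abs_le_one_iff_mul_self_le_one.mpr (this.trans h)

namespace GeOne

variable {Λ : Matrix (Fin d) (Fin d) ℝ}

theorem one : GeOne (1 : Matrix (Fin d) (Fin d) ℝ) := ⟨by simp, fun v => by simp⟩

theorem posDef (h : GeOne Λ) : Λ.PosDef := by
  refine Matrix.PosDef.of_dotProduct_mulVec_pos ?_ fun {x} hx => ?_
  · rw [Matrix.IsHermitian, Matrix.conjTranspose_eq_transpose_of_trivial, h.symm]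
  · have h1 : 0 < x ⬝ᵥ x :=
      (dotProduct_self_nonneg' x).lt_of_ne fun h0 => hx (dotProduct_self_eq_zero.mp h0.symm)
    simpa using h1.trans_le (h.le x)

theorem isUnit_det (h : GeOne Λ) : IsUnit Λ.det := (Matrix.isUnit_iff_isUnit_det _).mp h.posDef.isUnit

theorem mulVec_inv (h : GeOne Λ) (v : Fin d → ℝ) : Λ *ᵥ (Λ⁻¹ *ᵥ v) = v := by
  rw [Matrix.mulVec_mulVec, Matrix.mul_nonsing_inv _ h.isUnit_det, Matrix.one_mulVec]

theorem inv_mulVec (h : GeOne Λ) (v : Fin d → ℝ) : Λ⁻¹ *ᵥ (Λ *ᵥ v) = v := by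
  rw [Matrix.mulVec_mulVec, Matrix.nonsing_inv_mul _ h.isUnit_det, Matrix.one_mulVec]

theorem inv_comm (h : GeOne Λ) (a b : Fin d → ℝ) : a ⬝ᵥ (Λ⁻¹ *ᵥ b) = b ⬝ᵥ (Λ⁻¹ *ᵥ a) := by
  have : (Λ⁻¹)ᵀ = Λ⁻¹ := by rw [Matrix.transpose_nonsing_inv, h.symm]
  rw [Matrix.dotProduct_mulVec, ← Matrix.mulVec_transpose, this, dotProduct_comm]

theorem inv_sq_le_quad (h : GeOne Λ) (v : Fin d → ℝ) :
    (Λ⁻¹ *ᵥ v) ⬝ᵥ (Λ⁻¹ *ᵥ v) ≤ quad Λ v := by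
  have := h.le (Λ⁻¹ *ᵥ v)
  rwa [h.mulVec_inv, dotProduct_comm _ v] at this

theorem quad_nonneg (h : GeOne Λ) (v : Fin d → ℝ) : 0 ≤ quad Λ v :=
  (dotProduct_self_nonneg' _).trans (h.inv_sq_le_quad v)

/-- Cauchy–Schwarz bounds the square of the form by `|v|² |Λ⁻¹ v|²`, and the second factor is again
at most the form; one copy of the form cancels. -/
theorem quad_le (h : GeOne Λ) (v : Fin d → ℝ) : quad Λ v ≤ v ⬝ᵥ v := by
  have h1 := h.inv_sq_le_quad v
  have h2 := dotProduct_sq_le v (Λ⁻¹ *ᵥ v)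
  have h3 := h.quad_nonneg v
  have h4 := dotProduct_self_nonneg' v
  have h5 : quad Λ v ^ 2 ≤ (v ⬝ᵥ v) * quad Λ v := h2.trans (by gcongr)
  rcases h3.eq_or_lt with h0 | h0
  · rw [← h0]; exact h4
  · exact le_of_mul_le_mul_right (by rw [← sq]; exact h5) h0

theorem inv_sq_le (h : GeOne Λ) (v : Fin d → ℝ) : (Λ⁻¹ *ᵥ v) ⬝ᵥ (Λ⁻¹ *ᵥ v) ≤ v ⬝ᵥ v :=
  (h.inv_sq_le_quad v).trans (h.quad_le v)

theorem quad_add (h : GeOne Λ) (a b : Fin d → ℝ) :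
    quad Λ (a + b) = quad Λ a + 2 * (a ⬝ᵥ (Λ⁻¹ *ᵥ b)) + quad Λ b := by
  simp only [quad, Matrix.mulVec_add, add_dotProduct, dotProduct_add]
  rw [h.inv_comm b a]; ring

theorem quad_smul (c : ℝ) (a : Fin d → ℝ) : quad Λ (c • a) = c ^ 2 * quad Λ a := by
  simp only [quad, Matrix.mulVec_smul, smul_dotProduct, dotProduct_smul, smul_eq_mul]; ring

/-- Cauchy–Schwarz for the form `Λ⁻¹`: the polynomial `t ↦ quad Λ (a + t • b)` is nonnegative, so
its discriminant is not positive. -/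
theorem inv_dotProduct_sq_le (h : GeOne Λ) (a b : Fin d → ℝ) :
    (a ⬝ᵥ (Λ⁻¹ *ᵥ b)) ^ 2 ≤ quad Λ a * quad Λ b := by
  have key : ∀ t : ℝ, 0 ≤ quad Λ b * (t * t) + 2 * (a ⬝ᵥ (Λ⁻¹ *ᵥ b)) * t + quad Λ a := by
    intro t
    have := h.quad_nonneg (a + t • b)
    rw [h.quad_add, quad_smul, Matrix.mulVec_smul, dotProduct_smul, smul_eq_mul] at this
    linarith
  have := discrim_le_zero key
  rw [discrim] at this
  linarith

theorem abs_inv_dotProduct_le (h : GeOne Λ) (a b : Fin d → ℝ) :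
    |a ⬝ᵥ (Λ⁻¹ *ᵥ b)| ≤ √(quad Λ a) * √(quad Λ b) := by
  rw [← Real.sqrt_mul (h.quad_nonneg a)]
  exact Real.abs_le_sqrt (h.inv_dotProduct_sq_le a b)

theorem sqrt_quad_add_le (h : GeOne Λ) (a b : Fin d → ℝ) :
    √(quad Λ (a + b)) ≤ √(quad Λ a) + √(quad Λ b) := by
  apply Real.sqrt_le_iff.mpr ⟨by positivity, ?_⟩
  rw [h.quad_add, add_sq, Real.sq_sqrt (h.quad_nonneg a), Real.sq_sqrt (h.quad_nonneg b)]
  have := (le_abs_self _).trans (h.abs_inv_dotProduct_le a b)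
  linarith

theorem sqrt_quad_sum_le (h : GeOne Λ) {ι : Type*} (s : Finset ι) (a : ι → Fin d → ℝ) :
    √(quad Λ (∑ l ∈ s, a l)) ≤ ∑ l ∈ s, √(quad Λ (a l)) := by
  classical
  induction s using Finset.induction_on with
  | empty => simp [quad]
  | insert i s hi ih =>
    rw [Finset.sum_insert hi, Finset.sum_insert hi]
    exact (h.sqrt_quad_add_le _ _).trans (by gcongr)

theorem vecMulVec_mulVec' (f v : Fin d → ℝ) : Matrix.vecMulVec f f *ᵥ v = (f ⬝ᵥ v) • f := by
  rw [Matrix.vecMulVec_mulVec]; ext i; simp [mul_comm]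

theorem add_vecMulVec (h : GeOne Λ) (f : Fin d → ℝ) : GeOne (Λ + Matrix.vecMulVec f f) := by
  refine ⟨?_, fun v => ?_⟩
  · rw [Matrix.transpose_add, h.symm, Matrix.transpose_vecMulVec]
  · rw [Matrix.add_mulVec, dotProduct_add, vecMulVec_mulVec', dotProduct_smul, smul_eq_mul,
      dotProduct_comm v f]
    linarith [h.le v, mul_self_nonneg (f ⬝ᵥ v)]

/-- Sherman–Morrison for the quadratic form, after a rank-one update of the matrix and a shift of
the argument in the same direction. -/
theorem quad_update (h : GeOne Λ) (f s : Fin d → ℝ) (e : ℝ) :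
    quad (Λ + Matrix.vecMulVec f f) (s + e • f) = quad Λ s +
      (-(f ⬝ᵥ (Λ⁻¹ *ᵥ s)) ^ 2 + 2 * e * (f ⬝ᵥ (Λ⁻¹ *ᵥ s)) + e ^ 2 * quad Λ f) / (1 + quad Λ f) := by
  have h' := h.add_vecMulVec f
  have hw : 0 < 1 + quad Λ f := by linarith [h.quad_nonneg f]
  set w := quad Λ f with hwd
  set x := f ⬝ᵥ (Λ⁻¹ *ᵥ s) with hx
  -- The vector on the right is what Sherman–Morrison predicts; applying the updated matrix to it
  -- returns `s + e • f`.
  have key : (Λ + Matrix.vecMulVec f f)⁻¹ *ᵥ (s + e • f)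
      = Λ⁻¹ *ᵥ s + ((e - x) / (1 + w)) • (Λ⁻¹ *ᵥ f) := by
    rw [← h'.inv_mulVec (Λ⁻¹ *ᵥ s + ((e - x) / (1 + w)) • (Λ⁻¹ *ᵥ f))]
    congr 1
    rw [Matrix.mulVec_add, Matrix.add_mulVec, Matrix.add_mulVec, Matrix.mulVec_smul,
      Matrix.mulVec_smul, h.mulVec_inv, h.mulVec_inv, vecMulVec_mulVec', vecMulVec_mulVec']
    have hw' : f ⬝ᵥ (Λ⁻¹ *ᵥ f) = w := rfl
    rw [← hx, hw']
    ext i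
    simp only [Pi.add_apply, Pi.smul_apply, smul_eq_mul]
    field_simp
    ring
  rw [quad, key]
  simp only [add_dotProduct, dotProduct_add, smul_dotProduct, dotProduct_smul, smul_eq_mul]
  rw [h.inv_comm s f, ← hx, show f ⬝ᵥ (Λ⁻¹ *ᵥ f) = w from rfl, show s ⬝ᵥ (Λ⁻¹ *ᵥ s) = quad Λ s from rfl]
  field_simp
  ring

theorem det_update (h : GeOne Λ) (f : Fin d → ℝ) :
    (Λ + Matrix.vecMulVec f f).det = Λ.det * (1 + quad Λ f) := by
  rw [Matrix.vecMulVec_eq Unit, Matrix.det_add_replicateCol_mul_replicateRow h.isUnit_det,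
    Matrix.det_unique (n := Unit), Matrix.mul_assoc, ← Matrix.replicateCol_mulVec, Matrix.add_apply,
    Matrix.one_apply_eq, Matrix.replicateRow_mul_replicateCol_apply, quad]

theorem det_pos (h : GeOne Λ) : 0 < Λ.det := h.posDef.det_pos

/-- Positive eigenvalues are each at most their sum. This is cruder than the AM–GM bound, but only a
logarithm of it is used. -/
theorem det_le_trace_pow (h : GeOne Λ) : Λ.det ≤ Λ.trace ^ d := by
  have hp := h.posDef
  have h1 := hp.1.det_eq_prod_eigenvalues
  have h2 := hp.1.trace_eq_sum_eigenvalues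
  simp only [RCLike.ofReal_real_eq_id, id_eq] at h1 h2
  rw [h1, h2]
  calc ∏ i, hp.1.eigenvalues i ≤ ∏ _i : Fin d, ∑ j, hp.1.eigenvalues j := by
        refine Finset.prod_le_prod (fun i _ => (hp.eigenvalues_pos i).le) fun i _ => ?_
        exact Finset.single_le_sum (f := fun j => hp.1.eigenvalues j)
          (fun j _ => (hp.eigenvalues_pos j).le) (Finset.mem_univ i)
    _ = _ := by simp

end GeOne

/-- The regularized Gram matrix of the vectors `f l`, `a ≤ l < t`. -/
def gramSum (f : ℕ → Fin d → ℝ) (a t : ℕ) : Matrix (Fin d) (Fin d) ℝ :=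
  1 + ∑ l ∈ Ico a t, Matrix.vecMulVec (f l) (f l)

theorem gramSum_self (f : ℕ → Fin d → ℝ) (a : ℕ) : gramSum f a a = 1 := by simp [gramSum]

theorem gramSum_succ (f : ℕ → Fin d → ℝ) {a t : ℕ} (h : a ≤ t) :
    gramSum f a (t + 1) = gramSum f a t + Matrix.vecMulVec (f t) (f t) := by
  rw [gramSum, Finset.sum_Ico_succ_top h, gramSum, add_assoc]

theorem geOne_one_add_sum {ι : Type*} (s : Finset ι) (f : ι → Fin d → ℝ) :
    GeOne (1 + ∑ l ∈ s, Matrix.vecMulVec (f l) (f l)) := by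
  classical
  induction s using Finset.induction_on with
  | empty => simpa using GeOne.one
  | insert i s hi ih =>
    rw [Finset.sum_insert hi, add_comm (Matrix.vecMulVec _ _), ← add_assoc]
    exact ih.add_vecMulVec _

theorem geOne_gramSum (f : ℕ → Fin d → ℝ) (a t : ℕ) : GeOne (gramSum f a t) :=
  geOne_one_add_sum _ _

/-- A rank-one update multiplies the determinant by `1 + w`, where `w` is the form at the new
vector, and `w / (1 + w) ≤ log (1 + w)`; the logarithms telescope. -/
theorem sum_potential_le_log_det (f : ℕ → Fin d → ℝ) {a t : ℕ} (h : a ≤ t) :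
    ∑ l ∈ Ico a t, quad (gramSum f a l) (f l) / (1 + quad (gramSum f a l) (f l))
      ≤ Real.log (gramSum f a t).det := by
  induction t, h using Nat.le_induction with
  | base => simp [gramSum_self]
  | succ t hat ih =>
    have hg := geOne_gramSum f a t
    have hw : 0 < 1 + quad (gramSum f a t) (f t) := by linarith [hg.quad_nonneg (f t)]
    rw [Finset.sum_Ico_succ_top hat, gramSum_succ f hat, hg.det_update,
      Real.log_mul hg.det_pos.ne' hw.ne']
    refine add_le_add ih ?_
    have := Real.one_sub_inv_le_log_of_pos hw
    refine le_trans (le_of_eq ?_) this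
    field_simp
    ring

theorem log_det_gramSum_le (f : ℕ → Fin d → ℝ) (a t : ℕ)
    (hf : ∀ l ∈ Ico a t, f l ⬝ᵥ f l ≤ 1) :
    Real.log (gramSum f a t).det ≤ d * Real.log (d + (t - a : ℕ)) := by
  have hg := geOne_gramSum f a t
  have htr : (gramSum f a t).trace ≤ d + (t - a : ℕ) := by
    rw [gramSum, Matrix.trace_add, Matrix.trace_one, Matrix.trace_sum, Fintype.card_fin]
    gcongr
    calc ∑ l ∈ Ico a t, (Matrix.vecMulVec (f l) (f l)).trace ≤ ∑ l ∈ Ico a t, (1 : ℝ) := by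
          refine Finset.sum_le_sum fun l hl => ?_
          rw [Matrix.trace_vecMulVec]; exact hf l hl
      _ = _ := by simp
  have htr0 : 0 ≤ (gramSum f a t).trace := hg.posDef.posSemidef.trace_nonneg
  calc Real.log (gramSum f a t).det ≤ Real.log ((d + (t - a : ℕ) : ℝ) ^ d) :=
        Real.log_le_log hg.det_pos (hg.det_le_trace_pow.trans (by gcongr))
    _ = _ := by rw [Real.log_pow]

/-- The elliptical potential lemma. -/
theorem sum_sqrt_quad_le (f : ℕ → Fin d → ℝ) {a t : ℕ} (h : a ≤ t)
    (hf : ∀ l ∈ Ico a t, f l ⬝ᵥ f l ≤ 1) :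
    ∑ l ∈ Ico a t, √(quad (gramSum f a l) (f l))
      ≤ √(2 * (t - a : ℕ) * (d * Real.log (d + (t - a : ℕ)))) := by
  apply Real.le_sqrt_of_sq_le
  have h1 := Finset.sum_mul_sq_le_sq_mul_sq (Ico a t) (fun _ => (1 : ℝ))
    (fun l => √(quad (gramSum f a l) (f l)))
  simp only [one_mul, one_pow, Finset.sum_const, Nat.card_Ico, nsmul_eq_mul, mul_one] at h1
  refine h1.trans ?_
  rw [mul_comm (2 : ℝ), mul_assoc]
  gcongr
  -- For vectors in the unit ball `w ≤ 1`, hence `w ≤ 2 w / (1 + w)`.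
  calc ∑ l ∈ Ico a t, √(quad (gramSum f a l) (f l)) ^ 2
      ≤ ∑ l ∈ Ico a t,
          2 * (quad (gramSum f a l) (f l) / (1 + quad (gramSum f a l) (f l))) := by
        refine Finset.sum_le_sum fun l hl => ?_
        have hg := geOne_gramSum f a l
        have h0 := hg.quad_nonneg (f l)
        have h2 := (hg.quad_le (f l)).trans (hf l hl)
        rw [Real.sq_sqrt h0, ← mul_div_assoc, le_div_iff₀ (by linarith)]
        nlinarith
    _ = 2 * ∑ l ∈ Ico a t, (quad (gramSum f a l) (f l) / (1 + quad (gramSum f a l) (f l))) := by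
        rw [Finset.mul_sum]
    _ ≤ _ := by
        gcongr
        exact (sum_potential_le_log_det f h).trans (log_det_gramSum_le f a t hf)

/-- The sum of the squared leverages is at most the quadratic form. -/
theorem sum_sq_inv_dotProduct_le (f : ℕ → Fin d → ℝ) (a t : ℕ) (v : Fin d → ℝ) :
    ∑ l ∈ Ico a t, (v ⬝ᵥ ((gramSum f a t)⁻¹ *ᵥ f l)) ^ 2 ≤ quad (gramSum f a t) v := by
  have hg := geOne_gramSum f a t
  -- In terms of `u = Λ⁻¹ v` the form is `uᵀ Λ u = |u|² + ∑ (f_l · u)²`, and the squares `(f_l ·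
  -- u)²` are the squared leverages.
  set u := (gramSum f a t)⁻¹ *ᵥ v with hu
  have h1 : quad (gramSum f a t) v = u ⬝ᵥ (gramSum f a t *ᵥ u) := by
    rw [hu, hg.mulVec_inv, dotProduct_comm, quad]
  rw [h1]
  conv_rhs => rw [gramSum, Matrix.add_mulVec, Matrix.one_mulVec, dotProduct_add, Matrix.sum_mulVec,
    dotProduct_sum]
  have h2 : ∀ l, u ⬝ᵥ (Matrix.vecMulVec (f l) (f l) *ᵥ u)
      = (v ⬝ᵥ ((gramSum f a t)⁻¹ *ᵥ f l)) ^ 2 := by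
    intro l
    rw [GeOne.vecMulVec_mulVec', dotProduct_smul, smul_eq_mul, dotProduct_comm u, hg.inv_comm v,
      ← hu, sq]
  simp only [h2]
  linarith [dotProduct_self_nonneg' u]

/-- This bounds the effect of parameter drift: bounded errors in the targets are amplified only by
the square root of the number of observations. -/
theorem sum_abs_inv_dotProduct_le (f : ℕ → Fin d → ℝ) (a t : ℕ) (v : Fin d → ℝ) :
    ∑ l ∈ Ico a t, |v ⬝ᵥ ((gramSum f a t)⁻¹ *ᵥ f l)|
      ≤ √(t - a : ℕ) * √(quad (gramSum f a t) v) := by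
  rw [← Real.sqrt_mul (by positivity)]
  apply Real.le_sqrt_of_sq_le
  have h1 := Finset.sum_mul_sq_le_sq_mul_sq (Ico a t) (fun _ => (1 : ℝ))
    (fun l => |v ⬝ᵥ ((gramSum f a t)⁻¹ *ᵥ f l)|)
  simp only [one_mul, one_pow, Finset.sum_const, Nat.card_Ico, nsmul_eq_mul, mul_one, sq_abs] at h1
  exact h1.trans (by gcongr; exact sum_sq_inv_dotProduct_le f a t v)

end Gram

/-! ### Draws from random laws, and exponential supermartingales -/

section Draw

variable {Ω S : Type*} [MeasurableSpace S]

/-- Conditionally on the σ-algebra `m`, the variable `X` is drawn from the random law `κ`. -/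
structure IsDraw (m : MeasurableSpace Ω) [mΩ : MeasurableSpace Ω] (P : Measure Ω) (X : Ω → S)
    (κ : Ω → Measure S) : Prop where
  le : m ≤ mΩ
  measurable : Measurable X
  measurable_law : Measurable[m] κ
  prob : ∀ ω, IsProbabilityMeasure (κ ω)
  condExp_eq : ∀ B : Set S, MeasurableSet B →
    P[(X ⁻¹' B).indicator (fun _ => (1 : ℝ)) | m] =ᵐ[P] fun ω => (κ ω).real B

/-- The hypothesis identifies the law of `(T, X)` with `P.map T ⊗ₘ κ` on rectangles, hence
everywhere. The target `Ω'` is kept separate so that it can be `Ω` with a smaller σ-algebra, `T`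
being the identity. -/
theorem lintegral_eq_of_forall_rect {Ω' : Type*} [MeasurableSpace Ω'] [MeasurableSpace Ω]
    (P : Measure Ω) [IsProbabilityMeasure P] {T : Ω → Ω'} (hT : Measurable T) {X : Ω → S}
    (hX : Measurable X) (κ : Kernel Ω' S) [IsMarkovKernel κ]
    (h : ∀ A B, MeasurableSet A → MeasurableSet B →
      P (T ⁻¹' A ∩ X ⁻¹' B) = ∫⁻ ω in T ⁻¹' A, κ (T ω) B ∂P)
    {F : Ω' × S → ENNReal} (hF : Measurable F) :
    ∫⁻ ω, F (T ω, X ω) ∂P = ∫⁻ ω, ∫⁻ y, F (T ω, y) ∂(κ (T ω)) ∂P := by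
  have : IsProbabilityMeasure (P.map T) := Measure.isProbabilityMeasure_map hT.aemeasurable
  have heq : P.map (fun ω => (T ω, X ω)) = (P.map T) ⊗ₘ κ := by
    refine Measure.ext_prod fun {A B} hA hB => ?_
    rw [Measure.map_apply (hT.prodMk hX) (hA.prod hB), Measure.compProd_apply_prod hA hB,
      setLIntegral_map hA (κ.measurable_coe hB) hT, ← h A B hA hB]
    rfl
  rw [← lintegral_map hF (hT.prodMk hX), heq, Measure.lintegral_compProd hF,
    lintegral_map hF.lintegral_kernel_prod_right' hT]

theorem measurable_integral_law {Ω' : Type*} [MeasurableSpace Ω'] {κ : Ω' → Measure S}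
    (hκ : Measurable κ) (hp : ∀ ω, IsProbabilityMeasure (κ ω)) {g : Ω' × S → ℝ}
    (hg : Measurable g) : Measurable fun ω => ∫ y, g (ω, y) ∂(κ ω) := by
  let K : Kernel Ω' S := ⟨κ, hκ⟩
  have : IsMarkovKernel K := ⟨hp⟩
  have := hg.stronglyMeasurable.integral_kernel_prod_right' (κ := K)
  exact this.measurable

variable {m : MeasurableSpace Ω} [mΩ : MeasurableSpace Ω] {P : Measure Ω} [IsProbabilityMeasure P]
  {X : Ω → S} {κ : Ω → Measure S}

namespace IsDraw

theorem lintegral_eq (h : IsDraw m P X κ) {F : Ω × S → ENNReal}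
    (hF : Measurable[m.prod inferInstance] F) :
    ∫⁻ ω, F (ω, X ω) ∂P = ∫⁻ ω, ∫⁻ y, F (ω, y) ∂(κ ω) ∂P := by
  let K : @Kernel Ω S m _ := @Kernel.mk Ω S m _ κ h.measurable_law
  have hK : @IsMarkovKernel Ω S m _ K := @IsMarkovKernel.mk Ω S m _ K h.prob
  refine @lintegral_eq_of_forall_rect Ω S _ Ω m mΩ P _ id (measurable_id'' h.le) X h.measurable
    K hK ?_ F hF
  intro A B hA hB
  have hA' := h.le A hA
  have hBX := h.measurable hB
  have hp := h.prob
  have h1 := setIntegral_condExp h.le (μ := P)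
    (f := (X ⁻¹' B).indicator (fun _ => (1 : ℝ))) ((integrable_const 1).indicator hBX) hA
  have h2 : ∫ ω in A, (κ ω).real B ∂P = P.real (A ∩ X ⁻¹' B) := by
    rw [← setIntegral_congr_ae (g := fun ω => (κ ω).real B) hA'
      ((h.condExp_eq B hB).mono fun ω hω _ => hω), h1,
      setIntegral_indicator hBX, setIntegral_const, smul_eq_mul, mul_one]
  have hmeas : Measurable fun ω => κ ω B :=
    ((Measure.measurable_coe hB).comp h.measurable_law).mono h.le le_rfl
  have h3 : ∫⁻ ω in A, κ ω B ∂P = ENNReal.ofReal (∫ ω in A, (κ ω).real B ∂P) := by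
    rw [ofReal_integral_eq_lintegral_ofReal]
    · refine lintegral_congr fun ω => ?_
      rw [Measure.real, ENNReal.ofReal_toReal (measure_ne_top _ _)]
    · refine Integrable.of_bound (C := 1) hmeas.ennreal_toReal.aestronglyMeasurable ?_
      filter_upwards with ω
      rw [Real.norm_of_nonneg measureReal_nonneg]
      exact measureReal_le_one
    · filter_upwards with ω using measureReal_nonneg
  change P (A ∩ X ⁻¹' B) = ∫⁻ ω in A, κ ω B ∂P
  rw [h3, h2, Measure.real, ENNReal.ofReal_toReal (measure_ne_top _ _)]

/-- The step of a supermartingale: a factor known before the draw times a factor of conditional mean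
at most one. -/
theorem lintegral_mul_le (h : IsDraw m P X κ) {E : Ω → ENNReal} (hE : Measurable[m] E)
    {G : Ω × S → ENNReal} (hG : Measurable[m.prod inferInstance] G)
    (hle : ∀ ω, ∫⁻ y, G (ω, y) ∂(κ ω) ≤ 1) :
    ∫⁻ ω, E ω * G (ω, X ω) ∂P ≤ ∫⁻ ω, E ω ∂P := by
  have hE' : Measurable[m.prod inferInstance] fun z : Ω × S => E z.1 :=
    hE.comp (@measurable_fst Ω S m _)
  rw [h.lintegral_eq (F := fun z => E z.1 * G z) (hE'.mul hG)]
  refine lintegral_mono fun ω => ?_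
  have : Measurable fun y => G (ω, y) := hG.comp (@measurable_prodMk_left Ω S m _ ω)
  change ∫⁻ y, E ω * G (ω, y) ∂(κ ω) ≤ E ω
  rw [lintegral_const_mul _ this]
  calc E ω * ∫⁻ y, G (ω, y) ∂(κ ω) ≤ E ω * 1 := by gcongr; exact hle ω
    _ = E ω := mul_one _

end IsDraw

/-- Hoeffding's lemma, for `lintegral`. -/
theorem lintegral_exp_sub_integral_le (ν : Measure S) [IsProbabilityMeasure ν] {g : S → ℝ}
    (hg : Measurable g) {R : ℝ} (hR : 0 ≤ R) (hb : ∀ y, g y ∈ Set.Icc (-R) R) (s : ℝ) :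
    ∫⁻ y, ENNReal.ofReal (Real.exp (s * (g y - ∫ z, g z ∂ν))) ∂ν
      ≤ ENNReal.ofReal (Real.exp (s ^ 2 * R ^ 2 / 2)) := by
  have h := hasSubgaussianMGF_of_mem_Icc (μ := ν) hg.aemeasurable (Filter.Eventually.of_forall hb)
  rw [← ofReal_integral_eq_lintegral_ofReal (h.integrable_exp_mul s)
    (Filter.Eventually.of_forall fun y => (Real.exp_pos _).le)]
  refine ENNReal.ofReal_le_ofReal ((h.mgf_le s).trans (Real.exp_le_exp.mpr (le_of_eq ?_)))
  have : ‖R - -R‖ = 2 * R := by rw [Real.norm_of_nonneg (by linarith)]; ring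
  push_cast
  rw [this]
  ring

/-- One step of a sum of bounded martingale differences, exponentiated. -/
theorem lintegral_exp_diff_le_one (ν : Measure S) [IsProbabilityMeasure ν] {g : S → ℝ}
    (hg : Measurable g) {R : ℝ} (hR : 0 ≤ R) (hb : ∀ y, g y ∈ Set.Icc (-R) R) (s : ℝ) :
    ∫⁻ y, ENNReal.ofReal (Real.exp (s * (∫ z, g z ∂ν - g y) - s ^ 2 * R ^ 2 / 2)) ∂ν ≤ 1 := by
  have h := lintegral_exp_sub_integral_le ν hg hR hb (-s)
  have h1 : ∀ y, ENNReal.ofReal (Real.exp (s * (∫ z, g z ∂ν - g y) - s ^ 2 * R ^ 2 / 2))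
      = ENNReal.ofReal (Real.exp (-(s ^ 2 * R ^ 2 / 2)))
        * ENNReal.ofReal (Real.exp (-s * (g y - ∫ z, g z ∂ν))) := by
    intro y
    rw [← ENNReal.ofReal_mul (Real.exp_pos _).le, ← Real.exp_add]
    ring_nf
  simp only [h1]
  rw [lintegral_const_mul _ (by fun_prop)]
  calc _ ≤ ENNReal.ofReal (Real.exp (-(s ^ 2 * R ^ 2 / 2))) *
        ENNReal.ofReal (Real.exp ((-s) ^ 2 * R ^ 2 / 2)) := by gcongr
    _ = 1 := by
      rw [← ENNReal.ofReal_mul (Real.exp_pos _).le, ← Real.exp_add]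
      simp

theorem abs_sub_integral_le (ν : Measure S) [IsProbabilityMeasure ν] {g : S → ℝ}
    (hg : Measurable g) {R : ℝ} (hb : ∀ y, g y ∈ Set.Icc 0 R) (y : S) :
    |g y - ∫ z, g z ∂ν| ≤ R := by
  have hi : Integrable g ν := Integrable.of_mem_Icc 0 R hg.aemeasurable (.of_forall hb)
  have h0 : 0 ≤ ∫ z, g z ∂ν := integral_nonneg fun z => (hb z).1
  have h1 : ∫ z, g z ∂ν ≤ R := by
    have := integral_mono hi (integrable_const R) fun z => (hb z).2
    simpa using this
  rw [abs_le]
  constructor <;> linarith [(hb y).1, (hb y).2]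

/-- One step of the self-normalized process, exponentiated. -/
theorem lintegral_exp_quad_step_le_one (ν : Measure S) [IsProbabilityMeasure ν] {g : S → ℝ}
    (hg : Measurable g) {R : ℝ} (hR : 0 < R) (hb : ∀ y, g y ∈ Set.Icc 0 R) (x w : ℝ) (hw : 0 ≤ w) :
    ∫⁻ y, ENNReal.ofReal (Real.exp ((-x ^ 2 + 2 * (g y - ∫ z, g z ∂ν) * x
      + (g y - ∫ z, g z ∂ν) ^ 2 * w) / (1 + w) / (2 * R ^ 2) - w / (1 + w) / 2)) ∂ν ≤ 1 := by
  have hw1 : 0 < 1 + w := by linarith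
  have hb' : ∀ y, g y ∈ Set.Icc (-R) R := fun y => ⟨by linarith [(hb y).1], (hb y).2⟩
  -- With `e` the centred noise, `e² ≤ R²` makes the compensator absorb the term in `e²`. The rest
  -- is linear in `e` with slope `x / ((1 + w) R²)`; its Hoeffding cost `x² / (2 (1 + w)² R²)` is
  -- covered by the term `-x² / (2 (1 + w) R²)`.
  refine le_trans (lintegral_mono fun y => ENNReal.ofReal_le_ofReal (Real.exp_le_exp.mpr ?_))
    (lintegral_exp_diff_le_one ν hg hR.le hb' (-(x / ((1 + w) * R ^ 2))))
  set e := g y - ∫ z, g z ∂ν with he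
  have hsq : e ^ 2 ≤ R ^ 2 := sq_le_sq' (abs_le.mp (abs_sub_integral_le ν hg hb y)).1
    (abs_le.mp (abs_sub_integral_le ν hg hb y)).2
  have e1 : ∫ z, g z ∂ν - g y = -e := by ring
  rw [e1]
  have k1 : e ^ 2 * w / (1 + w) / (2 * R ^ 2) ≤ w / (1 + w) / 2 := by
    rw [div_div, div_div, div_le_div_iff₀ (by positivity) (by positivity)]
    nlinarith [mul_nonneg (mul_nonneg hw hw1.le) (sub_nonneg.mpr hsq)]
  have k2 : x ^ 2 / ((1 + w) ^ 2 * R ^ 2 * 2) ≤ x ^ 2 / ((1 + w) * R ^ 2 * 2) := by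
    apply div_le_div_of_nonneg_left (sq_nonneg x) (by positivity)
    have : (1 + w) ≤ (1 + w) ^ 2 := by nlinarith
    gcongr
  have l1 : (-x ^ 2 + 2 * e * x + e ^ 2 * w) / (1 + w) / (2 * R ^ 2)
      = -(x ^ 2 / ((1 + w) * R ^ 2 * 2)) + e * x / ((1 + w) * R ^ 2)
        + e ^ 2 * w / (1 + w) / (2 * R ^ 2) := by
    field_simp
  have l2 : -(x / ((1 + w) * R ^ 2)) * -e - (-(x / ((1 + w) * R ^ 2))) ^ 2 * R ^ 2 / 2
      = e * x / ((1 + w) * R ^ 2) - x ^ 2 / ((1 + w) ^ 2 * R ^ 2 * 2) := by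
    field_simp
  rw [l1, l2]
  linarith

end Draw

/-! ### Measurability of inverse matrices -/

section MeasurableInv

variable {α : Type*} [MeasurableSpace α] {d : ℕ}

theorem measurable_matrix_det {Λ : α → Matrix (Fin d) (Fin d) ℝ}
    (h : ∀ i j, Measurable fun z => Λ z i j) : Measurable fun z => (Λ z).det := by
  simp only [Matrix.det_apply']
  fun_prop

/-- The entries are cofactors over the determinant, hence measurable functions of the entries of
`Λ`. The inverse in `ℝ` is measurable everywhere, so singular matrices need no separate treatment.
-/
theorem measurable_matrix_inv {Λ : α → Matrix (Fin d) (Fin d) ℝ}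
    (h : ∀ i j, Measurable fun z => Λ z i j) (i j : Fin d) :
    Measurable fun z => (Λ z)⁻¹ i j := by
  simp only [Matrix.inv_def, Ring.inverse_eq_inv', Matrix.smul_apply, smul_eq_mul,
    Matrix.adjugate_apply]
  refine (measurable_matrix_det h).inv.mul (measurable_matrix_det fun k l => ?_)
  by_cases hk : k = j
  · subst hk; simp
  · simpa [Matrix.updateRow_ne hk] using h k l

theorem measurable_inv_mulVec {Λ : α → Matrix (Fin d) (Fin d) ℝ}
    (h : ∀ i j, Measurable fun z => Λ z i j) {v : α → Fin d → ℝ} (hv : Measurable v) :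
    Measurable fun z => (Λ z)⁻¹ *ᵥ v z := by
  have hv' : ∀ i, Measurable fun z => v z i := fun i => (measurable_pi_apply i).comp hv
  refine measurable_pi_lambda _ fun i => ?_
  simp only [Matrix.mulVec, dotProduct]
  exact Finset.measurable_sum _ fun j _ => (measurable_matrix_inv h i j).mul (hv' j)

theorem measurable_dotProduct {u v : α → Fin d → ℝ} (hu : Measurable u) (hv : Measurable v) :
    Measurable fun z => u z ⬝ᵥ v z := by
  simp only [dotProduct]
  exact Finset.measurable_sum _ fun j _ =>
    ((measurable_pi_apply j).comp hu).mul ((measurable_pi_apply j).comp hv)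

theorem measurable_one_add_sum_vecMulVec {ι : Type*} (s : Finset ι) {f : ι → α → Fin d → ℝ}
    (hf : ∀ l ∈ s, Measurable (f l)) (i j : Fin d) :
    Measurable fun z => (1 + ∑ l ∈ s, Matrix.vecMulVec (f l z) (f l z)) i j := by
  simp only [Matrix.add_apply, Matrix.sum_apply, Matrix.vecMulVec_apply]
  exact measurable_const.add (Finset.measurable_sum _ fun l hl =>
    ((measurable_pi_apply i).comp (hf l hl)).mul ((measurable_pi_apply j).comp (hf l hl)))

end MeasurableInv

/-! ### Concentration -/

section Concentration

variable {Ω S : Type*} [mS : MeasurableSpace S] [mΩ : MeasurableSpace Ω] {P : Measure Ω}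

/-- Markov's inequality for `exp Z`. Only an inclusion into a superlevel set is required, so `s`
need not be measurable. -/
theorem measure_le_ofReal_exp_neg {Z : Ω → ℝ} (hZ : Measurable Z) {s : Set Ω} {L : ℝ}
    (h : ∫⁻ ω, ENNReal.ofReal (Real.exp (Z ω)) ∂P ≤ 1) (hs : ∀ ω ∈ s, L ≤ Z ω) :
    P s ≤ ENNReal.ofReal (Real.exp (-L)) := by
  have h1 := mul_meas_ge_le_lintegral₀ (μ := P)
    (f := fun ω => ENNReal.ofReal (Real.exp (Z ω))) (by fun_prop) (ENNReal.ofReal (Real.exp L))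
  have h2 : P s ≤ P {ω | ENNReal.ofReal (Real.exp L) ≤ ENNReal.ofReal (Real.exp (Z ω))} :=
    measure_mono fun ω hω => ENNReal.ofReal_le_ofReal (Real.exp_le_exp.mpr (hs ω hω))
  have h3 : ENNReal.ofReal (Real.exp L) * P s ≤ 1 := (mul_le_mul_right h2 _).trans (h1.trans h)
  calc P s = ENNReal.ofReal (Real.exp (-L)) * (ENNReal.ofReal (Real.exp L) * P s) := by
        rw [← mul_assoc, ← ENNReal.ofReal_mul (Real.exp_pos _).le, ← Real.exp_add]
        simp
    _ ≤ ENNReal.ofReal (Real.exp (-L)) * 1 := by gcongr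
    _ = _ := mul_one _

variable [IsProbabilityMeasure P] {d : ℕ} (m : ℕ → MeasurableSpace Ω) (X : ℕ → Ω → S)
  (κ : ℕ → Ω → Measure S) (f : ℕ → Ω → Fin d → ℝ) (V : S → ℝ)

/-- The sum of the vectors `f l`, weighted with the noise of `V` at the draws `X l`. -/
def noiseSum (X : ℕ → Ω → S) (κ : ℕ → Ω → Measure S) (f : ℕ → Ω → Fin d → ℝ) (V : S → ℝ)
    (a t : ℕ) (ω : Ω) : Fin d → ℝ :=
  ∑ l ∈ Ico a t, (V (X l ω) - ∫ y, V y ∂(κ l ω)) • f l ω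

/-- The exponent of the self-normalized supermartingale. -/
def noiseExponent (X : ℕ → Ω → S) (κ : ℕ → Ω → Measure S) (f : ℕ → Ω → Fin d → ℝ) (V : S → ℝ)
    (R : ℝ) (a t : ℕ) (ω : Ω) : ℝ :=
  quad (gramSum (fun l => f l ω) a t) (noiseSum X κ f V a t ω) / (2 * R ^ 2)
    - (∑ l ∈ Ico a t, quad (gramSum (fun l => f l ω) a l) (f l ω)
        / (1 + quad (gramSum (fun l => f l ω) a l) (f l ω))) / 2

theorem measurable_quad_gramSum {α : Type*} [MeasurableSpace α] {f : ℕ → α → Fin d → ℝ} {a t : ℕ}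
    (hf : ∀ l ∈ Ico a t, Measurable (f l)) {v : α → Fin d → ℝ} (hv : Measurable v) :
    Measurable fun z => quad (gramSum (fun l => f l z) a t) (v z) :=
  measurable_dotProduct hv
    (measurable_inv_mulVec (measurable_one_add_sum_vecMulVec (Ico a t) hf) hv)

theorem measurable_leverage {α : Type*} [MeasurableSpace α] {f : ℕ → α → Fin d → ℝ} {a t : ℕ}
    (hf : ∀ l ∈ Ico a t, Measurable (f l)) {u v : α → Fin d → ℝ} (hu : Measurable u)
    (hv : Measurable v) :
    Measurable fun z => u z ⬝ᵥ ((gramSum (fun l => f l z) a t)⁻¹ *ᵥ v z) :=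
  measurable_dotProduct hu
    (measurable_inv_mulVec (measurable_one_add_sum_vecMulVec (Ico a t) hf) hv)

theorem measurable_noiseSum {α : Type*} [MeasurableSpace α] {X : ℕ → α → S}
    {κ : ℕ → α → Measure S} {f : ℕ → α → Fin d → ℝ} {V : S → ℝ} (hV : Measurable V) {a t : ℕ}
    (hX : ∀ l ∈ Ico a t, Measurable (X l)) (hκ : ∀ l ∈ Ico a t, Measurable (κ l))
    (hp : ∀ l ∈ Ico a t, ∀ ω, IsProbabilityMeasure (κ l ω))
    (hf : ∀ l ∈ Ico a t, Measurable (f l)) :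
    Measurable (noiseSum X κ f V a t) := by
  unfold noiseSum
  refine Finset.measurable_fun_sum _ fun l hl => ?_
  have h1 := measurable_integral_law (hκ l hl) (hp l hl) (g := fun z => V z.2)
    (hV.comp measurable_snd)
  exact ((hV.comp (hX l hl)).sub h1).smul (hf l hl)

theorem measurable_noiseExponent {α : Type*} [MeasurableSpace α] {X : ℕ → α → S}
    {κ : ℕ → α → Measure S} {f : ℕ → α → Fin d → ℝ} {V : S → ℝ} (hV : Measurable V) (R : ℝ)
    {a t : ℕ} (hX : ∀ l ∈ Ico a t, Measurable (X l)) (hκ : ∀ l ∈ Ico a t, Measurable (κ l))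
    (hp : ∀ l ∈ Ico a t, ∀ ω, IsProbabilityMeasure (κ l ω))
    (hf : ∀ l ∈ Ico a t, Measurable (f l)) :
    Measurable (noiseExponent X κ f V R a t) := by
  unfold noiseExponent
  refine ((measurable_quad_gramSum hf (measurable_noiseSum hV hX hκ hp hf)).div_const _).sub
    ((Finset.measurable_fun_sum _ fun l hl => ?_).div_const _)
  have : Measurable fun z => quad (gramSum (fun l => f l z) a l) (f l z) :=
    measurable_quad_gramSum (fun j hj => hf j (by simp only [Finset.mem_Ico] at *; omega)) (hf l hl)
  exact this.div (this.const_add 1)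

omit mΩ in
theorem noiseExponent_succ (R : ℝ) {a t : ℕ} (hat : a ≤ t) (ω : Ω) :
    let Λ := gramSum (fun l => f l ω) a t
    let x := f t ω ⬝ᵥ (Λ⁻¹ *ᵥ noiseSum X κ f V a t ω)
    let w := quad Λ (f t ω)
    let e := V (X t ω) - ∫ y, V y ∂(κ t ω)
    noiseExponent X κ f V R a (t + 1) ω = noiseExponent X κ f V R a t ω
      + ((-x ^ 2 + 2 * e * x + e ^ 2 * w) / (1 + w) / (2 * R ^ 2) - w / (1 + w) / 2) := by
  intro Λ x w e
  have h1 : noiseSum X κ f V a (t + 1) ω = noiseSum X κ f V a t ω + e • f t ω := by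
    rw [noiseSum, Finset.sum_Ico_succ_top hat, noiseSum]
  rw [noiseExponent, h1, gramSum_succ _ hat, (geOne_gramSum _ a t).quad_update,
    Finset.sum_Ico_succ_top hat, noiseExponent]
  ring

theorem measurable_quad_step {α : Type*} [MeasurableSpace α] {x I w : α → ℝ} {V : S → ℝ}
    (hx : Measurable x) (hI : Measurable I) (hw : Measurable w) (hV : Measurable V) (R : ℝ) :
    Measurable fun z : α × S => ENNReal.ofReal (Real.exp (
      (-(x z.1) ^ 2 + 2 * (V z.2 - I z.1) * x z.1 + (V z.2 - I z.1) ^ 2 * w z.1)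
        / (1 + w z.1) / (2 * R ^ 2) - w z.1 / (1 + w z.1) / 2)) := by
  fun_prop

/-- Given `m t`, everything in the increment of the exponent except the draw `X t` is known, so
`lintegral_exp_quad_step_le_one` bounds its conditional exponential moment by one. -/
theorem lintegral_exp_noiseExponent_le_one (hm : Monotone m) {a t : ℕ} (hat : a ≤ t)
    (hD : ∀ l ∈ Ico a t, IsDraw (m l) P (X l) (κ l))
    (hX : ∀ l ∈ Ico a t, Measurable[m (l + 1)] (X l))
    (hf : ∀ l ∈ Ico a t, Measurable[m l] (f l)) (hV : Measurable V) {R : ℝ} (hR : 0 < R)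
    (hb : ∀ y, V y ∈ Set.Icc 0 R) :
    ∫⁻ ω, ENNReal.ofReal (Real.exp (noiseExponent X κ f V R a t ω)) ∂P ≤ 1 := by
  induction t, hat using Nat.le_induction with
  | base => simp [noiseExponent, noiseSum, quad]
  | succ t hat ih =>
    have hsub : ∀ l ∈ Ico a t, l ∈ Ico a (t + 1) := fun l hl => by
      simp only [Finset.mem_Ico] at *; omega
    have ht : t ∈ Ico a (t + 1) := by simp [hat]
    have hDt := hD t ht
    have hlt : ∀ l ∈ Ico a t, l + 1 ≤ t := fun l hl => (Finset.mem_Ico.mp hl).2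
    have hX' : ∀ l ∈ Ico a t, Measurable[m t] (X l) := fun l hl =>
      (hX l (hsub l hl)).mono (hm (hlt l hl)) le_rfl
    have hκ' : ∀ l ∈ Ico a t, Measurable[m t] (κ l) := fun l hl =>
      (hD l (hsub l hl)).measurable_law.mono (hm (Nat.le_of_succ_le (hlt l hl))) le_rfl
    have hf' : ∀ l ∈ Ico a t, Measurable[m t] (f l) := fun l hl =>
      (hf l (hsub l hl)).mono (hm (Nat.le_of_succ_le (hlt l hl))) le_rfl
    have hp' : ∀ l ∈ Ico a t, ∀ ω, IsProbabilityMeasure (κ l ω) := fun l hl =>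
      (hD l (hsub l hl)).prob
    have hE : Measurable[m t] (noiseExponent X κ f V R a t) :=
      @measurable_noiseExponent S _ d Ω (m t) X κ f V hV R a t hX' hκ' hp' hf'
    have hN : Measurable[m t] (noiseSum X κ f V a t) :=
      @measurable_noiseSum S _ d Ω (m t) X κ f V hV a t hX' hκ' hp' hf'
    have hw : Measurable[m t] fun ω => quad (gramSum (fun l => f l ω) a t) (f t ω) :=
      @measurable_quad_gramSum d Ω (m t) f a t hf' (f t) (hf t ht)
    have hx : Measurable[m t] fun ω => f t ω ⬝ᵥ
        ((gramSum (fun l => f l ω) a t)⁻¹ *ᵥ noiseSum X κ f V a t ω) :=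
      @measurable_leverage d Ω (m t) f a t hf' (f t) _ (hf t ht) hN
    have hI : Measurable[m t] fun ω => ∫ y, V y ∂(κ t ω) :=
      @measurable_integral_law S _ Ω (m t) (κ t) hDt.measurable_law hDt.prob (fun z => V z.2)
        (hV.comp (@measurable_snd Ω S (m t) mS))
    have hp := hDt.prob
    refine le_trans (le_trans (le_of_eq ?_) (hDt.lintegral_mul_le
      (E := fun ω => ENNReal.ofReal (Real.exp (noiseExponent X κ f V R a t ω)))
      (G := fun z => ENNReal.ofReal (Real.exp (
        (-(f t z.1 ⬝ᵥ ((gramSum (fun l => f l z.1) a t)⁻¹ *ᵥ noiseSum X κ f V a t z.1)) ^ 2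
          + 2 * (V z.2 - ∫ y, V y ∂(κ t z.1)) *
            (f t z.1 ⬝ᵥ ((gramSum (fun l => f l z.1) a t)⁻¹ *ᵥ noiseSum X κ f V a t z.1))
          + (V z.2 - ∫ y, V y ∂(κ t z.1)) ^ 2 * quad (gramSum (fun l => f l z.1) a t) (f t z.1))
          / (1 + quad (gramSum (fun l => f l z.1) a t) (f t z.1)) / (2 * R ^ 2)
          - quad (gramSum (fun l => f l z.1) a t) (f t z.1)
            / (1 + quad (gramSum (fun l => f l z.1) a t) (f t z.1)) / 2)))
      (ENNReal.measurable_ofReal.comp (Real.measurable_exp.comp hE)) ?_ fun ω => ?_))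
      (ih (fun l hl => hD l (hsub l hl)) (fun l hl => hX l (hsub l hl))
        fun l hl => hf l (hsub l hl))
    · refine lintegral_congr fun ω => ?_
      rw [← ENNReal.ofReal_mul (Real.exp_pos _).le, ← Real.exp_add, noiseExponent_succ _ _ _ _ _ hat]
    · have h1 := @measurable_quad_step S mS Ω (m t) _ _ _ V hx hI hw hV R
      exact h1
    · have := lintegral_exp_quad_step_le_one (κ t ω) hV hR hb
        (f t ω ⬝ᵥ ((gramSum (fun l => f l ω) a t)⁻¹ *ᵥ noiseSum X κ f V a t ω))
        (quad (gramSum (fun l => f l ω) a t) (f t ω)) ((geOne_gramSum _ a t).quad_nonneg _)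
      simpa only using this

/-- The self-normalized deviation inequality for a fixed function `V`. -/
theorem measure_quad_noiseSum_ge_le (hm : Monotone m) {a t : ℕ} (hat : a ≤ t)
    (hD : ∀ l ∈ Ico a t, IsDraw (m l) P (X l) (κ l))
    (hX : ∀ l ∈ Ico a t, Measurable[m (l + 1)] (X l))
    (hf : ∀ l ∈ Ico a t, Measurable[m l] (f l))
    (hf1 : ∀ l ∈ Ico a t, ∀ ω, f l ω ⬝ᵥ f l ω ≤ 1) (hV : Measurable V) {R : ℝ} (hR : 0 < R)
    (hb : ∀ y, V y ∈ Set.Icc 0 R) (L : ℝ) :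
    P {ω | R ^ 2 * (d * Real.log (d + (t - a : ℕ)) + 2 * L)
        ≤ quad (gramSum (fun l => f l ω) a t) (noiseSum X κ f V a t ω)}
      ≤ ENNReal.ofReal (Real.exp (-L)) := by
  have hmeas : Measurable (noiseExponent X κ f V R a t) :=
    measurable_noiseExponent hV R (fun l hl => (hD l hl).measurable)
      (fun l hl => (hD l hl).measurable_law.mono (hD l hl).le le_rfl) (fun l hl => (hD l hl).prob)
      (fun l hl => (hf l hl).mono (hD l hl).le le_rfl)
  refine measure_le_ofReal_exp_neg hmeas
    (lintegral_exp_noiseExponent_le_one m X κ f V hm hat hD hX hf hV hR hb) fun ω hω => ?_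
  -- The compensator is at most the log-determinant, so on this set the exponent is at least `L`.
  have h1 := (sum_potential_le_log_det (fun l => f l ω) hat).trans
    (log_det_gramSum_le (fun l => f l ω) a t fun l hl => hf1 l hl ω)
  rw [Set.mem_ofPred_eq] at hω
  have h2 : (d * Real.log (d + (t - a : ℕ)) + 2 * L) / 2
      ≤ quad (gramSum (fun l => f l ω) a t) (noiseSum X κ f V a t ω) / (2 * R ^ 2) := by
    rw [div_le_div_iff₀ (by norm_num) (by positivity)]
    linarith
  rw [noiseExponent]
  linarith

theorem lintegral_exp_sum_diff_le_one (hm : Monotone m) (t : ℕ)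
    (hD : ∀ l < t, IsDraw (m l) P (X l) (κ l)) (hX : ∀ l < t, Measurable[m (l + 1)] (X l))
    (g : ℕ → Ω × S → ℝ) (hg : ∀ l < t, Measurable[(m l).prod inferInstance] (g l)) {R : ℝ}
    (hR : 0 ≤ R) (hb : ∀ l < t, ∀ z, g l z ∈ Set.Icc (-R) R) (s : ℝ) :
    ∫⁻ ω, ENNReal.ofReal (Real.exp (∑ l ∈ range t,
      (s * (∫ y, g l (ω, y) ∂(κ l ω) - g l (ω, X l ω)) - s ^ 2 * R ^ 2 / 2))) ∂P ≤ 1 := by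
  have hI : ∀ l < t, Measurable[m l] fun ω => ∫ y, g l (ω, y) ∂(κ l ω) := fun l hl =>
    @measurable_integral_law S _ Ω (m l) (κ l) (hD l hl).measurable_law (hD l hl).prob (g l)
      (hg l hl)
  induction t with
  | zero => simp
  | succ t ih =>
    have hDt := hD t (Nat.lt_succ_self t)
    have hp := hDt.prob
    have hgX : ∀ l < t, Measurable[m t] fun ω => g l (ω, X l ω) := fun l hl => by
      have h1 : @Measurable Ω (Ω × S) (m t) ((m l).prod inferInstance) fun ω => (ω, X l ω) :=
        @Measurable.prodMk Ω (m t) Ω S (m l) mS _ _ (measurable_id'' (hm hl.le))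
          ((hX l (hl.trans (Nat.lt_succ_self t))).mono (hm hl) le_rfl)
      exact (hg l (hl.trans (Nat.lt_succ_self t))).comp h1
    have hE : Measurable[m t] fun ω => ∑ l ∈ range t,
        (s * (∫ y, g l (ω, y) ∂(κ l ω) - g l (ω, X l ω)) - s ^ 2 * R ^ 2 / 2) := by
      refine @Finset.measurable_fun_sum ℝ ℕ Ω _ _ _ (m t) _ _ fun l hl => ?_
      have hl' := Finset.mem_range.mp hl
      exact ((((hI l (hl'.trans (Nat.lt_succ_self t))).mono (hm hl'.le) le_rfl).sub
        (hgX l hl')).const_mul s).sub_const _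
    refine le_trans (le_trans (le_of_eq ?_) (hDt.lintegral_mul_le
      (E := fun ω => ENNReal.ofReal (Real.exp (∑ l ∈ range t,
        (s * (∫ y, g l (ω, y) ∂(κ l ω) - g l (ω, X l ω)) - s ^ 2 * R ^ 2 / 2))))
      (G := fun z => ENNReal.ofReal (Real.exp (
        s * (∫ y, g t (z.1, y) ∂(κ t z.1) - g t z) - s ^ 2 * R ^ 2 / 2)))
      (ENNReal.measurable_ofReal.comp (Real.measurable_exp.comp hE)) ?_ fun ω => ?_))
      (ih (fun l hl => hD l (hl.trans (Nat.lt_succ_self t)))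
        (fun l hl => hX l (hl.trans (Nat.lt_succ_self t)))
        (fun l hl => hg l (hl.trans (Nat.lt_succ_self t)))
        (fun l hl => hb l (hl.trans (Nat.lt_succ_self t)))
        (fun l hl => hI l (hl.trans (Nat.lt_succ_self t))))
    · refine lintegral_congr fun ω => ?_
      rw [← ENNReal.ofReal_mul (Real.exp_pos _).le, ← Real.exp_add, Finset.sum_range_succ]
    · have h1 := (hI t (Nat.lt_succ_self t)).comp (@measurable_fst Ω S (m t) mS)
      exact ENNReal.measurable_ofReal.comp (Real.measurable_exp.comp
        (((h1.sub (hg t (Nat.lt_succ_self t))).const_mul s).sub_const _))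
    · exact lintegral_exp_diff_le_one (κ t ω)
        ((hg t (Nat.lt_succ_self t)).comp (@measurable_prodMk_left Ω S (m t) _ ω)) hR
        (fun y => hb t (Nat.lt_succ_self t) (ω, y)) s

/-- An Azuma-type inequality for functions that depend on the past. -/
theorem measure_sum_diff_ge_le (hm : Monotone m) (t : ℕ) (ht : 0 < t)
    (hD : ∀ l < t, IsDraw (m l) P (X l) (κ l)) (hX : ∀ l < t, Measurable[m (l + 1)] (X l))
    (g : ℕ → Ω × S → ℝ) (hg : ∀ l < t, Measurable[(m l).prod inferInstance] (g l)) {R : ℝ}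
    (hR : 0 < R) (hb : ∀ l < t, ∀ z, g l z ∈ Set.Icc (-R) R) (L : ℝ) :
    P {ω | R * √t * (L + 1 / 2)
        ≤ ∑ l ∈ range t, (∫ y, g l (ω, y) ∂(κ l ω) - g l (ω, X l ω))}
      ≤ ENNReal.ofReal (Real.exp (-L)) := by
  have ht' : 0 < √(t : ℝ) := Real.sqrt_pos.mpr (by exact_mod_cast ht)
  -- This choice makes the total variance correction exactly `1 / 2`. The threshold is linear in `L`
  -- instead of `√L`, which only affects the power of the logarithm.
  set s : ℝ := 1 / (R * √t) with hs
  refine measure_le_ofReal_exp_neg ?_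
    (lintegral_exp_sum_diff_le_one m X κ hm t hD hX g hg hR.le hb s) fun ω hω => ?_
  · refine Finset.measurable_fun_sum _ fun l hl => ?_
    have hl' := Finset.mem_range.mp hl
    have h1 := (@measurable_integral_law S _ Ω (m l) (κ l) (hD l hl').measurable_law
      (hD l hl').prob (g l) (hg l hl')).mono (hD l hl').le le_rfl
    have h2 : Measurable fun ω => g l (ω, X l ω) := by
      have h1 : @Measurable Ω (Ω × S) mΩ ((m l).prod inferInstance) fun ω => (ω, X l ω) :=
        @Measurable.prodMk Ω mΩ Ω S (m l) mS _ _ (measurable_id'' (hD l hl').le)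
          (hD l hl').measurable
      exact (hg l hl').comp h1
    exact ((h1.sub h2).const_mul s).sub_const _
  · rw [Finset.sum_sub_distrib, ← Finset.mul_sum, Finset.sum_const, Finset.card_range, nsmul_eq_mul]
    rw [Set.mem_ofPred_eq] at hω
    have h1 : s * (R * √t * (L + 1 / 2)) = L + 1 / 2 := by rw [hs]; field_simp
    have h2 : (t : ℝ) * (s ^ 2 * R ^ 2 / 2) = 1 / 2 := by
      have : (t : ℝ) = √t ^ 2 := (Real.sq_sqrt (by positivity)).symm
      rw [hs]
      nth_rewrite 1 [this]
      field_simp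
    have h3 := mul_le_mul_of_nonneg_left hω (show 0 ≤ s by positivity)
    linarith

end Concentration

theorem integral_bind_kernel {S : Type*} [MeasurableSpace S] (ρ : Measure S)
    (κ : Kernel S S) {g : S → ℝ} (hg : Integrable g (ρ.bind κ)) :
    ∫ y, g y ∂(ρ.bind κ) = ∫ x, ∫ y, g y ∂(κ x) ∂ρ := by
  have h := Kernel.integral_comp (η := κ) (κ := Kernel.const Unit ρ) (a := ()) (f := g)
    (by simpa [Kernel.comp_apply] using hg)
  simpa [Kernel.comp_apply] using h

/-! ### Integrals against signed measures -/

section SignedIntegral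

variable {S : Type*} [MeasurableSpace S]

/-- The integral of a real function against a signed measure. -/
def signedIntegral (ν : SignedMeasure S) (V : S → ℝ) : ℝ :=
  VectorMeasure.integral ν V (ContinuousLinearMap.lsmul ℝ ℝ).flip

theorem integrable_variation (ν : SignedMeasure S) {V : S → ℝ} (hV : Measurable V) {R : ℝ}
    (hb : ∀ y, |V y| ≤ R) : VectorMeasure.Integrable ν V := by
  rw [VectorMeasure.Integrable, ← SignedMeasure.totalVariation_eq_variation]
  exact Integrable.of_bound hV.aestronglyMeasurable R (.of_forall hb)

theorem abs_signedIntegral_le (ν : SignedMeasure S) {V : S → ℝ} {R : ℝ} (hR : 0 ≤ R)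
    (hb : ∀ y, |V y| ≤ R) : |signedIntegral ν V| ≤ R * ν.totalVariation.real Set.univ := by
  have hfin : IsFiniteMeasure ν.variation := by
    rw [← SignedMeasure.totalVariation_eq_variation]; infer_instance
  have h := VectorMeasure.norm_integral_le_of_norm_le_const (μ := ν) (f := V)
    (B := (ContinuousLinearMap.lsmul ℝ ℝ : ℝ →L[ℝ] ℝ →L[ℝ] ℝ).flip) (C := R)
    (.of_forall hb)
  have hB : ‖(ContinuousLinearMap.lsmul ℝ ℝ : ℝ →L[ℝ] ℝ →L[ℝ] ℝ).flip‖ ≤ 1 := by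
    rw [ContinuousLinearMap.opNorm_flip]
    exact ContinuousLinearMap.opNorm_lsmul_le
  rw [Real.norm_eq_abs, ← SignedMeasure.totalVariation_eq_variation] at h
  refine h.trans ?_
  have h0 : 0 ≤ ν.totalVariation.real Set.univ := measureReal_nonneg
  gcongr
  nlinarith

theorem signedIntegral_sub (ν ν' : SignedMeasure S) {V : S → ℝ} (hV : Measurable V) {R : ℝ}
    (hb : ∀ y, |V y| ≤ R) :
    signedIntegral (ν - ν') V = signedIntegral ν V - signedIntegral ν' V :=
  VectorMeasure.integral_sub_vectorMeasure (integrable_variation ν hV hb)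
    (integrable_variation ν' hV hb)

/-- The hypothesis says that `ρ` and `∑ c i • ν i` are the same signed measure, and the integral is
linear in the measure. -/
theorem integral_eq_sum_signedIntegral {d : ℕ} (ρ : Measure S) [IsFiniteMeasure ρ]
    (c : Fin d → ℝ) (ν : Fin d → SignedMeasure S)
    (h : ∀ B, MeasurableSet B → ρ.real B = ∑ i, c i * ν i B) {V : S → ℝ} (hV : Measurable V)
    {R : ℝ} (hb : ∀ y, |V y| ≤ R) :
    ∫ y, V y ∂ρ = ∑ i, c i * signedIntegral (ν i) V := by
  have heq : ρ.toSignedMeasure = ∑ i, c i • ν i := by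
    ext B hB
    rw [Measure.toSignedMeasure_apply_measurable hB, h B hB]
    simp
  rw [← VectorMeasure.integral_toSignedMeasure, heq,
    VectorMeasure.integral_finsetSum_vectorMeasure fun i _ => integrable_variation _ hV hb]
  simp [signedIntegral]

theorem totalVariation_sub_real_le (ν ν' : SignedMeasure S) :
    (ν - ν').totalVariation.real Set.univ
      ≤ ν.totalVariation.real Set.univ + ν'.totalVariation.real Set.univ := by
  rw [← measureReal_add_apply]
  refine ENNReal.toReal_mono (measure_ne_top _ _) ?_
  have := VectorMeasure.variation_sub_le (μ := ν) (ν := ν')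
  simp only [SignedMeasure.totalVariation_eq_variation]
  exact this Set.univ

theorem tvNorm_nonneg {d : ℕ} (ν : Fin d → SignedMeasure S) : 0 ≤ tvNorm ν := norm_nonneg _

theorem tvNorm_sub_le {d : ℕ} (ν ν' : Fin d → SignedMeasure S) :
    tvNorm (fun i => ν i - ν' i) ≤ tvNorm ν + tvNorm ν' := by
  unfold tvNorm
  refine le_trans ?_ (norm_add_le _ _)
  rw [EuclideanSpace.norm_eq, EuclideanSpace.norm_eq]
  apply Real.sqrt_le_sqrt
  refine Finset.sum_le_sum fun i _ => ?_
  simp only [PiLp.add_apply, Real.norm_eq_abs, sq_abs]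
  have := totalVariation_sub_real_le (ν i) (ν' i)
  gcongr

end SignedIntegral

/-! ### The transition operator as a linear function of the features. -/

namespace LinearMDP

variable {S A : Type*} [MeasurableSpace S] [MeasurableSpace A] {d H K : ℕ}
  (M : LinearMDP S A d H K)

/-- The vector of integrals of `V` against the transition parameters. -/
def transVec (k h : ℕ) (V : S → ℝ) : EuclideanSpace ℝ (Fin d) :=
  WithLp.toLp 2 fun i => signedIntegral (M.μ k h i) V

variable {M}

theorem norm_toLp_signedIntegral_le (ν : Fin d → SignedMeasure S) {V : S → ℝ} {R : ℝ}
    (hR : 0 ≤ R) (hb : ∀ y, |V y| ≤ R) :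
    ‖(WithLp.toLp 2 fun i => signedIntegral (ν i) V : EuclideanSpace ℝ (Fin d))‖
      ≤ R * tvNorm ν := by
  rw [tvNorm, ← abs_of_nonneg hR, ← Real.norm_eq_abs, ← norm_smul, EuclideanSpace.norm_eq,
    EuclideanSpace.norm_eq]
  apply Real.sqrt_le_sqrt
  refine Finset.sum_le_sum fun i _ => ?_
  simp only [PiLp.smul_apply, Real.norm_eq_abs, smul_eq_mul]
  gcongr ?_ ^ 2
  refine (abs_signedIntegral_le (ν i) hR hb).trans (le_abs_self _)

theorem norm_transVec_le {k h : ℕ} {V : S → ℝ} {R : ℝ} (hR : 0 ≤ R) (hb : ∀ y, |V y| ≤ R) :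
    ‖M.transVec k h V‖ ≤ R * tvNorm (M.μ k h) :=
  norm_toLp_signedIntegral_le _ hR hb

theorem norm_transVec_sub_le {k l h : ℕ} {V : S → ℝ} (hV : Measurable V) {R : ℝ} (hR : 0 ≤ R)
    (hb : ∀ y, |V y| ≤ R) :
    ‖M.transVec k h V - M.transVec l h V‖ ≤ R * tvNorm (fun i => M.μ k h i - M.μ l h i) := by
  refine le_trans (le_of_eq ?_) (norm_toLp_signedIntegral_le _ hR hb)
  congr 1
  ext i
  simp [transVec, signedIntegral_sub _ _ hV hb]

theorem integral_trans {k h : ℕ} (hk : k < K) (hh : h < H) (s : S) (a : A) {V : S → ℝ}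
    (hV : Measurable V) {R : ℝ} (hb : ∀ y, |V y| ≤ R) :
    ∫ y, V y ∂(M.trans k h (s, a)) = inner ℝ (M.φ s a) (M.transVec k h V) := by
  have := M.markov k hk h hh
  rw [integral_eq_sum_signedIntegral (M.trans k h (s, a)) (fun i => M.φ s a i) (M.μ k h)
    (fun B hB => M.trans_eq k hk h hh s a B hB) hV hb, PiLp.inner_apply]
  simp [transVec, mul_comm]

/-! ### Values -/

theorem reward_mem_Icc {k h : ℕ} (hk : k < K) (hh : h < H) (s : S) (a : A) :
    M.reward k h s a ∈ Set.Icc (0 : ℝ) 1 := M.reward_mem k hk h hh s a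

theorem measurable_reward (k h : ℕ) : Measurable fun z : S × A => M.reward k h z.1 z.2 := by
  unfold reward
  exact M.measurable_φ.inner_const

theorem isProbabilityMeasure_stateLaw {k : ℕ} (hk : k < K) {f : ℕ → S → A}
    (hf : ∀ h, h < H → Measurable (f h)) {h : ℕ} (s : S) {j : ℕ} (hj : h + j ≤ H) :
    IsProbabilityMeasure (M.stateLaw k f h s j) := by
  induction j with
  | zero => rw [stateLaw]; infer_instance
  | succ j ih =>
    have := ih (by omega)
    have := M.markov k hk (h + j) (by omega)
    rw [stateLaw]
    refine ⟨?_⟩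
    rw [Measure.bind_apply MeasurableSet.univ]
    · simp
    · exact ((M.trans k (h + j)).measurable.comp
        (measurable_id.prodMk (hf (h + j) (by omega)))).aemeasurable

/-- The parameter in `α` lets the policy be random: joint measurability is needed when the policy
depends on the outcome. -/
theorem measurable_stateLaw {α : Type*} [MeasurableSpace α] {k : ℕ} (hk : k < K)
    {f : α → ℕ → S → A} (hf : ∀ h, h < H → Measurable fun z : α × S => f z.1 h z.2) {h : ℕ}
    {j : ℕ} (hj : h + j ≤ H) :
    Measurable fun z : α × S => M.stateLaw k (f z.1) h z.2 j := by
  induction j with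
  | zero =>
    simp only [stateLaw]
    exact Measure.measurable_dirac.comp measurable_snd
  | succ j ih =>
    have ih := ih (by omega)
    have hfm : ∀ z : α, ∀ h, h < H → Measurable (f z h) := fun z h hh =>
      (hf h hh).comp measurable_prodMk_left
    let κ : Kernel (α × S) S := ⟨_, ih⟩
    have : IsMarkovKernel κ :=
      ⟨fun z => isProbabilityMeasure_stateLaw hk (hfm z.1) z.2 (by omega)⟩
    refine Measure.measurable_of_measurable_coe _ fun B hB => ?_
    have h1 : Measurable fun y : (α × S) × S =>
        M.trans k (h + j) (y.2, f y.1.1 (h + j) y.2) B := by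
      refine (Kernel.measurable_coe _ hB).comp (measurable_snd.prodMk ?_)
      exact (hf (h + j) (by omega)).comp (measurable_fst.fst.prodMk measurable_snd)
    have h2 := h1.lintegral_kernel_prod_right' (κ := κ)
    convert h2 using 2 with z
    simp only [stateLaw]
    rw [Measure.bind_apply hB]
    · rfl
    · exact ((M.trans k (h + j)).measurable.comp
        (measurable_id.prodMk (hfm z.1 (h + j) (by omega)))).aemeasurable

theorem measurable_reward_comp {f : ℕ → S → A} {k h : ℕ} (hf : Measurable (f h)) :
    Measurable fun x => M.reward k h x (f h x) :=
  (measurable_reward k h).comp (measurable_id.prodMk hf)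

theorem measurable_value {α : Type*} [MeasurableSpace α] {k : ℕ} (hk : k < K)
    {f : α → ℕ → S → A} (hf : ∀ h, h < H → Measurable fun z : α × S => f z.1 h z.2) (h : ℕ) :
    Measurable fun z : α × S => M.value k (f z.1) h z.2 := by
  unfold value
  refine Finset.measurable_fun_sum _ fun j hj => ?_
  have hj' := Finset.mem_range.mp hj
  refine measurable_integral_law (measurable_stateLaw hk hf (by omega))
    (fun z => isProbabilityMeasure_stateLaw hk (fun h hh => (hf h hh).comp measurable_prodMk_left)
      z.2 (by omega))
    (g := fun y : (α × S) × S => M.reward k (h + j) y.2 (f y.1.1 (h + j) y.2)) ?_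
  exact (measurable_reward k (h + j)).comp (measurable_snd.prodMk
    ((hf (h + j) (by omega)).comp (measurable_fst.fst.prodMk measurable_snd)))

theorem measurable_value_state {k : ℕ} (hk : k < K) {f : ℕ → S → A}
    (hf : ∀ h, h < H → Measurable (f h)) (h : ℕ) : Measurable (M.value k f h) :=
  (measurable_value (α := Unit) (f := fun _ => f) hk (fun h hh => (hf h hh).comp measurable_snd)
    h).comp (measurable_const.prodMk measurable_id : Measurable fun s : S => ((), s))

theorem value_mem_Icc {k : ℕ} (hk : k < K) {f : ℕ → S → A} (hf : ∀ h, h < H → Measurable (f h))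
    (h : ℕ) (s : S) : M.value k f h s ∈ Set.Icc (0 : ℝ) H := by
  have key : ∀ j ∈ range (H - h),
      ∫ x, M.reward k (h + j) x (f (h + j) x) ∂(M.stateLaw k f h s j) ∈ Set.Icc (0 : ℝ) 1 := by
    intro j hj
    have hj' := Finset.mem_range.mp hj
    have hlt : h + j < H := by omega
    have := isProbabilityMeasure_stateLaw (M := M) hk hf s hlt.le
    refine ⟨integral_nonneg fun x => (reward_mem_Icc hk hlt _ _).1, ?_⟩
    have h2 := integral_mono (μ := M.stateLaw k f h s j)
      (Integrable.of_mem_Icc 0 1 (measurable_reward_comp (M := M) (k := k) (hf _ hlt)).aemeasurable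
        (.of_forall fun x => reward_mem_Icc hk hlt x _)) (integrable_const 1)
      fun x => (reward_mem_Icc (M := M) hk hlt x (f (h + j) x)).2
    simpa using h2
  refine ⟨Finset.sum_nonneg fun j hj => (key j hj).1, ?_⟩
  calc M.value k f h s ≤ ∑ j ∈ range (H - h), (1 : ℝ) :=
        Finset.sum_le_sum fun j hj => (key j hj).2
    _ ≤ H := by simp

/-- The recursive definition appends the last transition, while the Bellman equation splits off the
first one; associativity of `bind` converts between the two. -/
theorem stateLaw_succ {k : ℕ} {f : ℕ → S → A} (hk : k < K)
    (hf : ∀ h, h < H → Measurable (f h)) (h : ℕ) (s : S) {j : ℕ} (hj : h + j < H) :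
    M.stateLaw k f h s (j + 1)
      = (M.trans k h (s, f h s)).bind (fun y => M.stateLaw k f (h + 1) y j) := by
  have hm : ∀ i, i < H → Measurable fun x => M.trans k i (x, f i x) := fun i hi =>
    (M.trans k i).measurable.comp (measurable_id.prodMk (hf i hi))
  induction j with
  | zero =>
    have h1 : (fun y => M.stateLaw k f (h + 1) y 0) = Measure.dirac := by funext y; rw [stateLaw]
    rw [h1, Measure.bind_dirac, stateLaw, stateLaw]
    exact Measure.dirac_bind (hm h (by omega)) s
  | succ j ih =>
    have h1 : Measurable fun y => M.stateLaw k f (h + 1) y j :=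
      (measurable_stateLaw (M := M) (α := Unit) (f := fun _ => f) hk
        (fun h hh => (hf h hh).comp measurable_snd) (by omega)).comp
        (measurable_const.prodMk measurable_id : Measurable fun s : S => ((), s))
    rw [stateLaw, ih (by omega), Measure.bind_bind h1.aemeasurable (hm (h + (j + 1)) hj).aemeasurable]
    congr 1
    funext y
    rw [stateLaw, show h + (j + 1) = h + 1 + j by ring]

/-- The Bellman equation of a policy. -/
theorem value_eq {k : ℕ} {f : ℕ → S → A} (hk : k < K) (hf : ∀ h, h < H → Measurable (f h))
    {h : ℕ} (hh : h < H) (s : S) :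
    M.value k f h s = M.reward k h s (f h s)
      + ∫ y, M.value k f (h + 1) y ∂(M.trans k h (s, f h s)) := by
  have := M.markov k hk h hh
  have hr : ∀ j ∈ range (H - (h + 1)),
      Measurable fun x => M.reward k (h + 1 + j) x (f (h + 1 + j) x) := fun j hj =>
    measurable_reward_comp (hf _ (by have := Finset.mem_range.mp hj; omega))
  have hl : ∀ j ∈ range (H - (h + 1)), Measurable fun y => M.stateLaw k f (h + 1) y j :=
    fun j hj => (measurable_stateLaw (M := M) (α := Unit) (f := fun _ => f) hk
      (fun h hh => (hf h hh).comp measurable_snd)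
      (by have := Finset.mem_range.mp hj; omega)).comp
      (measurable_const.prodMk measurable_id : Measurable fun s : S => ((), s))
  have hp : ∀ j ∈ range (H - (h + 1)), ∀ y, IsProbabilityMeasure (M.stateLaw k f (h + 1) y j) :=
    fun j hj y => isProbabilityMeasure_stateLaw hk hf y
      (by have := Finset.mem_range.mp hj; omega)
  have hb : ∀ j ∈ range (H - (h + 1)), ∀ x,
      M.reward k (h + 1 + j) x (f (h + 1 + j) x) ∈ Set.Icc (0 : ℝ) 1 := fun j hj x =>
    reward_mem_Icc hk (by have := Finset.mem_range.mp hj; omega) _ _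
  unfold value
  rw [show H - h = H - (h + 1) + 1 by omega, Finset.sum_range_succ', add_comm]
  congr 1
  · rw [stateLaw, integral_dirac' _ _ (by
      simpa using (measurable_reward_comp (M := M) (k := k) (hf h hh)).stronglyMeasurable)]
    simp
  · rw [integral_finsetSum]
    · refine Finset.sum_congr rfl fun j hj => ?_
      have hjlt : h + j < H := by have := Finset.mem_range.mp hj; omega
      have e : h + (j + 1) = h + 1 + j := by ring
      rw [stateLaw_succ hk hf h s hjlt, e]
      let κ : Kernel S S := ⟨_, hl j hj⟩
      have : IsMarkovKernel κ := ⟨hp j hj⟩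
      exact integral_bind_kernel _ κ (Integrable.of_mem_Icc 0 1 (hr j hj).aemeasurable
        (.of_forall (hb j hj)))
    · intro j hj
      have hpj := hp j hj
      refine Integrable.of_bound (C := 1) ?_ (.of_forall fun y => ?_)
      · exact (measurable_integral_law (hl j hj) (hp j hj)
          (g := fun z : S × S => M.reward k (h + 1 + j) z.2 (f (h + 1 + j) z.2))
          ((hr j hj).comp measurable_snd)).aestronglyMeasurable
      · refine (norm_integral_le_of_norm_le_const (C := 1) (.of_forall fun x => ?_)).trans
          (by simp)
        rw [Real.norm_of_nonneg (hb j hj x).1]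
        exact (hb j hj x).2

end LinearMDP

/-! ### Elementary estimates: suprema, square roots, rounding, dot products. -/

theorem abs_ciSup_sub_ciSup_le {ι : Type*} [Finite ι] [Nonempty ι] {f g : ι → ℝ} {ε : ℝ}
    (h : ∀ i, |f i - g i| ≤ ε) : |(⨆ i, f i) - ⨆ i, g i| ≤ ε := by
  have hf : BddAbove (Set.range f) := Set.finite_range f |>.bddAbove
  have hg : BddAbove (Set.range g) := Set.finite_range g |>.bddAbove
  have h1 : ⨆ i, f i ≤ (⨆ i, g i) + ε :=
    ciSup_le fun i => by linarith [(abs_le.mp (h i)).2, le_ciSup hg i]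
  have h2 : ⨆ i, g i ≤ (⨆ i, f i) + ε :=
    ciSup_le fun i => by linarith [(abs_le.mp (h i)).1, le_ciSup hf i]
  exact abs_le.mpr ⟨by linarith, by linarith⟩

/-- No signs are assumed, because rounding the entries of an inverse Gram matrix may destroy
positivity; `√` is then `0`. -/
theorem abs_sqrt_sub_sqrt_le (a b : ℝ) : |√a - √b| ≤ √|a - b| := by
  have key : ∀ a b : ℝ, √a ≤ √b + √|a - b| := by
    intro a b
    refine Real.sqrt_le_iff.mpr ⟨by positivity, ?_⟩
    have h1 : b ≤ √b ^ 2 := by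
      rcases le_total 0 b with hb | hb
      · rw [Real.sq_sqrt hb]
      · exact hb.trans (sq_nonneg _)
    have h2 := Real.sq_sqrt (abs_nonneg (a - b))
    nlinarith [le_abs_self (a - b), mul_nonneg (Real.sqrt_nonneg b) (Real.sqrt_nonneg |a - b|)]
  rw [abs_le]
  have h1 := key a b
  have h2 := key b a
  rw [abs_sub_comm b a] at h2
  constructor <;> linarith

/-- Rounding `z` down to a multiple of `η` moves it by at most `η`. -/
theorem abs_sub_floor_mul_le {η : ℝ} (hη : 0 < η) (z : ℝ) : |z - η * ⌊z / η⌋| ≤ η := by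
  have h1 := Int.floor_le (z / η)
  have h2 := (Int.lt_floor_add_one (z / η)).le
  rw [le_div_iff₀ hη] at h1
  rw [div_le_iff₀ hη] at h2
  rw [abs_le]
  constructor <;> nlinarith

theorem floor_div_mem_Icc {η B z : ℝ} (hη : 0 < η) (hz : |z| ≤ B) {N : ℕ} (hN : B / η + 1 ≤ N) :
    ⌊z / η⌋ ∈ Icc (-(N : ℤ)) N := by
  have h0 : |z / η| ≤ B / η := by rw [abs_div, abs_of_pos hη]; gcongr
  have h1 := Int.floor_le (z / η)
  have h2 := Int.lt_floor_add_one (z / η)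
  rw [abs_le] at h0
  rw [Finset.mem_Icc]
  constructor
  · have : (-(N : ℤ) : ℝ) ≤ (⌊z / η⌋ : ℝ) := by push_cast; linarith
    exact_mod_cast this
  · have : (⌊z / η⌋ : ℝ) ≤ ((N : ℤ) : ℝ) := by push_cast; linarith
    exact_mod_cast this

theorem inner_eq_dotProduct {d : ℕ} (u v : EuclideanSpace ℝ (Fin d)) :
    inner ℝ u v = u.ofLp ⬝ᵥ v.ofLp := by
  rw [PiLp.inner_apply, dotProduct]
  simp [mul_comm]

theorem dotProduct_self_eq_norm_sq {d : ℕ} (u : EuclideanSpace ℝ (Fin d)) :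
    u.ofLp ⬝ᵥ u.ofLp = ‖u‖ ^ 2 := by
  rw [← inner_eq_dotProduct, real_inner_self_eq_norm_sq]

namespace LinearMDP

variable {S A : Type*} [MeasurableSpace S] [MeasurableSpace A] {d H K : ℕ}
  (M : LinearMDP S A d H K)

theorem φ_dotProduct_self_le (s : S) (a : A) : (M.φ s a).ofLp ⬝ᵥ (M.φ s a).ofLp ≤ 1 := by
  rw [dotProduct_self_eq_norm_sq]
  exact pow_le_one₀ (norm_nonneg _) (M.norm_φ_le s a)

/-! ### The class of the value estimates -/

/-- The greedy value of the weights `w`, with a bonus given by `β` and the matrix `B`, clipped to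
`[0, H]`. -/
def clippedValue (β : ℝ) (w : Fin d → ℝ) (B : Matrix (Fin d) (Fin d) ℝ) (s : S) : ℝ :=
  max 0 (⨆ b, min ((M.φ s b).ofLp ⬝ᵥ w
    + β * √((M.φ s b).ofLp ⬝ᵥ (B *ᵥ (M.φ s b).ofLp))) H)

variable {M}

theorem measurable_φ_left [MeasurableSingletonClass A] (b : A) :
    Measurable fun s => (M.φ s b).ofLp :=
  (WithLp.measurable_ofLp 2 (Fin d → ℝ)).comp (M.measurable_φ.comp (measurable_id.prodMk measurable_const))

theorem measurable_const_mulVec {α : Type*} [MeasurableSpace α] (B : Matrix (Fin d) (Fin d) ℝ)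
    {v : α → Fin d → ℝ} (hv : Measurable v) : Measurable fun z => B *ᵥ v z := by
  refine measurable_pi_lambda _ fun i => ?_
  exact measurable_dotProduct measurable_const hv

theorem measurable_clippedValue [MeasurableSingletonClass A] [Fintype A] (β : ℝ) (w : Fin d → ℝ)
    (B : Matrix (Fin d) (Fin d) ℝ) : Measurable (M.clippedValue β w B) := by
  unfold clippedValue
  refine measurable_const.max (Measurable.iSup fun b => ?_)
  have h := measurable_φ_left (M := M) b
  exact ((measurable_dotProduct h measurable_const).add
    ((measurable_dotProduct h (measurable_const_mulVec B h)).sqrt.const_mul β)).min measurable_const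

variable [Finite A] [Nonempty A]

omit [Finite A] in
theorem clippedValue_mem_Icc (β : ℝ) (w : Fin d → ℝ) (B : Matrix (Fin d) (Fin d) ℝ) (s : S) :
    M.clippedValue β w B s ∈ Set.Icc (0 : ℝ) H :=
  ⟨le_max_left _ _, max_le (Nat.cast_nonneg _) (ciSup_le fun _ => min_le_right _ _)⟩

omit [Finite A] [Nonempty A] in
theorem abs_apply_le_one (s : S) (b : A) (i : Fin d) : |(M.φ s b).ofLp i| ≤ 1 :=
  dotProduct_le_one_of_sq (M.φ_dotProduct_self_le s b) i

theorem abs_clippedValue_sub_le {β : ℝ} (hβ : 0 ≤ β) {w w' : Fin d → ℝ}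
    {B B' : Matrix (Fin d) (Fin d) ℝ} {η : ℝ} (hw : ∀ i, |w i - w' i| ≤ η)
    (hB : ∀ i j, |B i j - B' i j| ≤ η) (s : S) :
    |M.clippedValue β w B s - M.clippedValue β w' B' s| ≤ d * η + β * (d * √η) := by
  unfold clippedValue
  have hη : 0 ≤ d * η + β * (d * √η) := by
    -- In dimension `0` nothing forces `η ≥ 0`, but the bound is `0`.
    rcases Nat.eq_zero_or_pos d with rfl | hd
    · simp
    · have : 0 ≤ η := (abs_nonneg _).trans (hw ⟨0, hd⟩)
      positivity
  refine (abs_max_sub_max_le_max _ _ _ _).trans (max_le (by simpa using hη)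
    (abs_ciSup_sub_ciSup_le fun b => ?_))
  refine (abs_min_sub_min_le_max _ _ _ _).trans (max_le ?_ (by simpa using hη))
  set f := (M.φ s b).ofLp with hf
  have hf1 : ∀ i, |f i| ≤ 1 := abs_apply_le_one s b
  have h1 : |f ⬝ᵥ w - f ⬝ᵥ w'| ≤ d * η := by
    rw [← dotProduct_sub, dotProduct]
    refine (Finset.abs_sum_le_sum_abs _ _).trans ?_
    calc ∑ i, |f i * (w - w') i| ≤ ∑ _i : Fin d, η := by
          refine Finset.sum_le_sum fun i _ => ?_
          rw [abs_mul]
          calc |f i| * |(w - w') i| ≤ 1 * |(w - w') i| := by gcongr; exact hf1 i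
            _ ≤ η := by rw [one_mul]; exact hw i
      _ = d * η := by simp
  have h2 : |f ⬝ᵥ (B *ᵥ f) - f ⬝ᵥ (B' *ᵥ f)| ≤ d ^ 2 * η := by
    rw [← dotProduct_sub, ← Matrix.sub_mulVec, dotProduct]
    refine (Finset.abs_sum_le_sum_abs _ _).trans ?_
    calc ∑ i, |f i * ((B - B') *ᵥ f) i| ≤ ∑ _i : Fin d, d * η := by
          refine Finset.sum_le_sum fun i _ => ?_
          rw [abs_mul]
          calc |f i| * |((B - B') *ᵥ f) i| ≤ 1 * |((B - B') *ᵥ f) i| := by gcongr; exact hf1 i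
            _ ≤ ∑ _j : Fin d, η := by
              rw [one_mul, Matrix.mulVec, dotProduct]
              refine (Finset.abs_sum_le_sum_abs _ _).trans (Finset.sum_le_sum fun j _ => ?_)
              rw [abs_mul]
              calc |(B - B') i j| * |f j| ≤ |(B - B') i j| * 1 := by gcongr; exact hf1 j
                _ ≤ η := by rw [mul_one]; exact hB i j
            _ = d * η := by simp
      _ = d ^ 2 * η := by simp; ring
  have h3 : |√(f ⬝ᵥ (B *ᵥ f)) - √(f ⬝ᵥ (B' *ᵥ f))| ≤ d * √η := by
    refine (abs_sqrt_sub_sqrt_le _ _).trans ((Real.sqrt_le_sqrt h2).trans ?_)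
    rw [Real.sqrt_mul (by positivity), Real.sqrt_sq (by positivity)]
  calc _ = |(f ⬝ᵥ w - f ⬝ᵥ w') + β * (√(f ⬝ᵥ (B *ᵥ f)) - √(f ⬝ᵥ (B' *ᵥ f)))| := by
        congr 1; ring
    _ ≤ |f ⬝ᵥ w - f ⬝ᵥ w'| + |β * (√(f ⬝ᵥ (B *ᵥ f)) - √(f ⬝ᵥ (B' *ᵥ f)))| := abs_add_le _ _
    _ ≤ d * η + β * (d * √η) := by
        rw [abs_mul, abs_of_nonneg hβ]
        gcongr

omit [Finite A] [Nonempty A]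

/-! ### The error of one regression -/

theorem varθ_nonneg (a b : ℕ) : 0 ≤ M.varθ a b :=
  Finset.sum_nonneg fun _ _ => Finset.sum_nonneg fun _ _ => norm_nonneg _

theorem varμ_nonneg (a b : ℕ) : 0 ≤ M.varμ a b :=
  Finset.sum_nonneg fun _ _ => Finset.sum_nonneg fun _ _ => tvNorm_nonneg _

/-- The parameter of the linear function `r_h^k + P_h^k V`. -/
def backupVec (M : LinearMDP S A d H K) (k h : ℕ) (V : S → ℝ) : EuclideanSpace ℝ (Fin d) :=
  M.θ k h + M.transVec k h V

theorem inner_backupVec {k h : ℕ} (hk : k < K) (hh : h < H) (s : S) (a : A) {V : S → ℝ}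
    (hV : Measurable V) {R : ℝ} (hb : ∀ y, |V y| ≤ R) :
    (M.φ s a).ofLp ⬝ᵥ (M.backupVec k h V).ofLp
      = M.reward k h s a + ∫ y, V y ∂(M.trans k h (s, a)) := by
  rw [← inner_eq_dotProduct, backupVec, inner_add_right, integral_trans hk hh s a hV hb, reward]

theorem norm_backupVec_le {k h : ℕ} (hk : k < K) (hh : h < H) {V : S → ℝ} {R : ℝ} (hR : 0 ≤ R)
    (hb : ∀ y, |V y| ≤ R) : ‖M.backupVec k h V‖ ≤ (1 + R) * √d := by
  have h1 := M.norm_θ_le k hk h hh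
  have h2 := norm_transVec_le (M := M) (k := k) (h := h) hR hb
  have h3 : R * tvNorm (M.μ k h) ≤ R * √d := by gcongr; exact M.norm_μ_le k hk h hh
  refine (norm_add_le _ _).trans ?_
  linarith

/-- Telescoping over the episodes from `l` to `k`, all inside the epoch; the change at the single
step `h` is bounded by the sum over all steps. -/
theorem norm_backupVec_sub_le {l k τ e h : ℕ} (hτ : τ ≤ l) (hlk : l ≤ k) (hke : k < e)
    (hh : h < H) {V : S → ℝ} (hV : Measurable V) {R : ℝ} (hR : 0 ≤ R) (hb : ∀ y, |V y| ≤ R) :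
    ‖M.backupVec l h V - M.backupVec k h V‖ ≤ M.varθ τ e + R * M.varμ τ e := by
  rw [← dist_eq_norm]
  refine (dist_le_Ico_sum_dist (fun i => M.backupVec i h V) hlk).trans ?_
  have h1 : ∀ i, dist (M.backupVec i h V) (M.backupVec (i + 1) h V)
      ≤ ∑ h ∈ range H, ‖M.θ (i + 1) h - M.θ (i + 1 - 1) h‖
        + R * ∑ h ∈ range H, tvNorm (fun j => M.μ (i + 1) h j - M.μ (i + 1 - 1) h j) := by
    intro i
    rw [dist_comm, dist_eq_norm, backupVec, backupVec, add_sub_add_comm]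
    refine (norm_add_le _ _).trans ?_
    have hm := Finset.mem_range.mpr hh
    have a1 := Finset.single_le_sum (f := fun h => ‖M.θ (i + 1) h - M.θ (i + 1 - 1) h‖)
      (fun _ _ => norm_nonneg _) hm
    have a2 := Finset.single_le_sum
      (f := fun h => tvNorm (fun j => M.μ (i + 1) h j - M.μ (i + 1 - 1) h j))
      (fun _ _ => tvNorm_nonneg _) hm
    have a3 := norm_transVec_sub_le (M := M) (k := i + 1) (l := i) (h := h) hV hR hb
    simp only [Nat.add_sub_cancel] at a1 a2 ⊢
    exact add_le_add a1 (a3.trans (by gcongr))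
  refine (Finset.sum_le_sum fun i _ => h1 i).trans ?_
  rw [Finset.sum_add_distrib, ← Finset.mul_sum, varθ, varμ]
  have hsub : Ico (l + 1) (k + 1) ⊆ Ico (τ + 1) e := by
    intro j; simp only [Finset.mem_Ico]; omega
  rw [Finset.sum_Ico_add' (fun i => ∑ h ∈ range H, ‖M.θ i h - M.θ (i - 1) h‖) l k 1,
    Finset.sum_Ico_add'
      (fun i => ∑ h ∈ range H, tvNorm (fun j => M.μ i h j - M.μ (i - 1) h j)) l k 1]
  have b1 := Finset.sum_le_sum_of_subset_of_nonneg
    (f := fun i => ∑ h ∈ range H, ‖M.θ i h - M.θ (i - 1) h‖) hsub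
    fun _ _ _ => Finset.sum_nonneg fun _ _ => norm_nonneg _
  have b2 := Finset.sum_le_sum_of_subset_of_nonneg
    (f := fun i => ∑ h ∈ range H, tvNorm (fun j => M.μ i h j - M.μ (i - 1) h j)) hsub
    fun _ _ _ => Finset.sum_nonneg fun _ _ => tvNorm_nonneg _
  gcongr

/-- The features visited at step `h`. -/
def features (M : LinearMDP S A d H K) (x : ℕ → ℕ → S) (a : ℕ → ℕ → A) (h l : ℕ) : Fin d → ℝ :=
  (M.φ (x l h) (a l h)).ofLp

theorem gram_eq (W : ℕ) (x : ℕ → ℕ → S) (a : ℕ → ℕ → A) (k h : ℕ) :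
    M.gram W x a k h = gramSum (M.features x a h) (epochStart (W / H) k) k := rfl

/-- The accumulated noise of `V` in the regression at step `h` of episode `k`. -/
def regressionNoise (M : LinearMDP S A d H K) (x : ℕ → ℕ → S) (a : ℕ → ℕ → A) (τ k h : ℕ)
    (V : S → ℝ) : Fin d → ℝ :=
  ∑ l ∈ Ico τ k, (V (x l (h + 1)) - ∫ y, V y ∂(M.trans l h (x l h, a l h))) • M.features x a h l

/-- All parameters are compared with `zk`: since `∑ f fᵀ = Λ - 1`, the common part contributes `Λ
zk`, which the regression recovers exactly, and the bias `-zk`. -/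
theorem sum_target_eq (f : ℕ → Fin d → ℝ) (τ k : ℕ) (z : ℕ → Fin d → ℝ) (n : ℕ → ℝ)
    (zk : Fin d → ℝ) :
    ∑ l ∈ Ico τ k, (f l ⬝ᵥ z l + n l) • f l
      = ∑ l ∈ Ico τ k, n l • f l + gramSum f τ k *ᵥ zk - zk
        + ∑ l ∈ Ico τ k, (f l ⬝ᵥ (z l - zk)) • f l := by
  rw [gramSum, Matrix.add_mulVec, Matrix.one_mulVec, Matrix.sum_mulVec]
  simp only [GeOne.vecMulVec_mulVec', add_smul, dotProduct_sub, sub_smul, Finset.sum_add_distrib,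
    Finset.sum_sub_distrib]
  abel

/-- The three summands are noise, regularization bias and drift. The first two use Cauchy–Schwarz
for `Λ⁻¹`, the drift uses the sum of the leverages. -/
theorem abs_regression_error_le (f : ℕ → Fin d → ℝ) {τ k : ℕ} (z : ℕ → Fin d → ℝ)
    (n : ℕ → ℝ) (zk v : Fin d → ℝ) {D Z : ℝ} (hZ : √(zk ⬝ᵥ zk) ≤ Z)
    (hD : ∀ l ∈ Ico τ k, |f l ⬝ᵥ (z l - zk)| ≤ D) (hD0 : 0 ≤ D) :
    |v ⬝ᵥ ((gramSum f τ k)⁻¹ *ᵥ ∑ l ∈ Ico τ k, (f l ⬝ᵥ z l + n l) • f l) - v ⬝ᵥ zk|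
      ≤ (√(quad (gramSum f τ k) (∑ l ∈ Ico τ k, n l • f l)) + Z + D * √(k - τ : ℕ))
        * √(quad (gramSum f τ k) v) := by
  have hg := geOne_gramSum f τ k
  rw [sum_target_eq f τ k z n zk, Matrix.mulVec_add, Matrix.mulVec_sub, Matrix.mulVec_add,
    hg.inv_mulVec, dotProduct_add, dotProduct_sub, dotProduct_add]
  have h1 := hg.abs_inv_dotProduct_le v (∑ l ∈ Ico τ k, n l • f l)
  have h2 := hg.abs_inv_dotProduct_le v zk
  have h2' : √(quad (gramSum f τ k) zk) ≤ Z := (Real.sqrt_le_sqrt (hg.quad_le zk)).trans hZ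
  have h3 : |v ⬝ᵥ ((gramSum f τ k)⁻¹ *ᵥ ∑ l ∈ Ico τ k, (f l ⬝ᵥ (z l - zk)) • f l)|
      ≤ D * (√(k - τ : ℕ) * √(quad (gramSum f τ k) v)) := by
    rw [Matrix.mulVec_sum, dotProduct_sum]
    simp only [Matrix.mulVec_smul, dotProduct_smul, smul_eq_mul]
    refine (Finset.abs_sum_le_sum_abs _ _).trans ?_
    calc _ ≤ ∑ l ∈ Ico τ k, D * |v ⬝ᵥ ((gramSum f τ k)⁻¹ *ᵥ f l)| := by
          refine Finset.sum_le_sum fun l hl => ?_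
          rw [abs_mul]
          gcongr
          exact hD l hl
      _ ≤ _ := by
          rw [← Finset.mul_sum]
          gcongr
          exact sum_abs_inv_dotProduct_le f τ k v
  have h4 : √(quad (gramSum f τ k) v) * √(quad (gramSum f τ k) zk)
      ≤ √(quad (gramSum f τ k) v) * Z := by gcongr
  rw [abs_le] at h1 h2 h3 ⊢
  constructor <;> nlinarith

/-- The error of the regression at step `h` of episode `k`, for a next-step value `V` with values
in `[0, R]`. -/
theorem abs_weight_error_le {W k h e : ℕ} (x : ℕ → ℕ → S) (a : ℕ → ℕ → A) (hk : k < K)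
    (hke : k < e) (hh : h < H) {V : S → ℝ} (hV : Measurable V) {R : ℝ} (hR : 0 ≤ R)
    (hb : ∀ y, |V y| ≤ R) (Q : S → A → ℝ)
    (hQ : ∀ l ∈ Ico (epochStart (W / H) k) k, ⨆ b, Q (x l (h + 1)) b = V (x l (h + 1)))
    (s : S) (b : A) :
    |(M.φ s b).ofLp ⬝ᵥ M.weight W x a k h Q
        - (M.reward k h s b + ∫ y, V y ∂(M.trans k h (s, b)))|
      ≤ (√(quad (M.gram W x a k h) (M.regressionNoise x a (epochStart (W / H) k) k h V))
          + (1 + R) * √d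
          + (M.varθ (epochStart (W / H) k) e + R * M.varμ (epochStart (W / H) k) e)
            * √(k - epochStart (W / H) k : ℕ))
        * √(quad (M.gram W x a k h) (M.φ s b).ofLp) := by
  set τ := epochStart (W / H) k with hτ
  have hD0 : 0 ≤ M.varθ τ e + R * M.varμ τ e := by
    have := M.varθ_nonneg τ e
    have := M.varμ_nonneg τ e
    positivity
  have key := abs_regression_error_le (M.features x a h) (τ := τ) (k := k)
    (fun l => (M.backupVec l h V).ofLp)
    (fun l => V (x l (h + 1)) - ∫ y, V y ∂(M.trans l h (x l h, a l h)))
    (M.backupVec k h V).ofLp (M.φ s b).ofLp (D := M.varθ τ e + R * M.varμ τ e)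
    (Z := (1 + R) * √d) ?_ ?_ hD0
  · rw [← inner_backupVec hk hh s b hV hb, gram_eq, weight, gram_eq, ← hτ]
    refine le_trans (le_of_eq ?_) key
    congr 4
    refine Finset.sum_congr rfl fun l hl => ?_
    have hlK : l < K := (Finset.mem_Ico.mp hl).2.trans hk
    rw [hQ l hl, features, inner_backupVec hlK hh _ _ hV hb]
    congr 1
    ring
  · rw [dotProduct_self_eq_norm_sq, Real.sqrt_sq (norm_nonneg _)]
    exact norm_backupVec_le hk hh hR hb
  · intro l hl
    have hl' := Finset.mem_Ico.mp hl
    rw [features, ← WithLp.ofLp_sub, ← inner_eq_dotProduct]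
    refine (abs_real_inner_le_norm _ _).trans ?_
    have h1 := M.norm_φ_le (x l h) (a l h)
    have h2 := norm_backupVec_sub_le (M := M) hl'.1 hl'.2.le hke hh hV hR hb
    calc _ ≤ 1 * (M.varθ τ e + R * M.varμ τ e) := by gcongr
      _ = _ := one_mul _

theorem abs_weight_le {W k h : ℕ} (x : ℕ → ℕ → S) (a : ℕ → ℕ → A) (hk : k < K) (hh : h < H)
    (Q : S → A → ℝ) {R : ℝ} (hR : 0 ≤ R)
    (hQ : ∀ l ∈ Ico (epochStart (W / H) k) k, ⨆ b, Q (x l (h + 1)) b ∈ Set.Icc 0 R) (i : Fin d) :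
    |M.weight W x a k h Q i| ≤ k * (1 + R) := by
  have hg := geOne_gramSum (M.features x a h) (epochStart (W / H) k) k
  set v := ∑ l ∈ Ico (epochStart (W / H) k) k,
    (M.reward l h (x l h) (a l h) + ⨆ b, Q (x l (h + 1)) b) • M.features x a h l with hv
  have h1 : √(v ⬝ᵥ v) ≤ k * (1 + R) := by
    -- For the identity matrix the form is the squared Euclidean length, so this is the triangle
    -- inequality.
    have h2 := GeOne.one.sqrt_quad_sum_le (Ico (epochStart (W / H) k) k) fun l =>
      (M.reward l h (x l h) (a l h) + ⨆ b, Q (x l (h + 1)) b) • M.features x a h l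
    rw [← hv, quad, inv_one, Matrix.one_mulVec] at h2
    refine h2.trans ?_
    calc _ ≤ ∑ _l ∈ Ico (epochStart (W / H) k) k, (1 + R) := by
          refine Finset.sum_le_sum fun l hl => Real.sqrt_le_iff.mpr ⟨by positivity, ?_⟩
          have hlK : l < K := (Finset.mem_Ico.mp hl).2.trans hk
          have hr := reward_mem_Icc (M := M) hlK hh (x l h) (a l h)
          have hq := hQ l hl
          rw [GeOne.quad_smul, quad, inv_one, Matrix.one_mulVec]
          have hf := M.φ_dotProduct_self_le (x l h) (a l h)
          have hf0 := dotProduct_self_nonneg' (M.features x a h l)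
          have h0 : 0 ≤ M.reward l h (x l h) (a l h) + ⨆ b, Q (x l (h + 1)) b :=
            add_nonneg hr.1 hq.1
          calc _ ≤ (M.reward l h (x l h) (a l h) + ⨆ b, Q (x l (h + 1)) b) ^ 2 * 1 := by
                gcongr; exact hf
            _ ≤ _ := by rw [mul_one]; gcongr; exacts [hr.2, hq.2]
      _ ≤ k * (1 + R) := by
          rw [Finset.sum_const, nsmul_eq_mul, Nat.card_Ico]
          gcongr
          omega
  have h3 : M.weight W x a k h Q i ^ 2 ≤ v ⬝ᵥ v := by
    refine le_trans ?_ (hg.inv_sq_le v)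
    rw [sq]
    exact Finset.single_le_sum (f := fun j => M.weight W x a k h Q j * M.weight W x a k h Q j)
      (fun _ _ => mul_self_nonneg _) (Finset.mem_univ i)
  exact (Real.abs_le_sqrt h3).trans h1

theorem abs_inv_apply_le_one {Λ : Matrix (Fin d) (Fin d) ℝ} (h : GeOne Λ) (i j : Fin d) :
    |Λ⁻¹ i j| ≤ 1 := by
  have h1 := h.inv_sq_le (Pi.single j 1)
  have h2 : (Pi.single j 1 : Fin d → ℝ) ⬝ᵥ Pi.single j 1 = 1 := by simp
  rw [h2] at h1
  simpa using dotProduct_le_one_of_sq h1 i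

end LinearMDP

namespace LinearMDP

variable {S A : Type*} [MeasurableSpace S] [MeasurableSpace A] {d H K : ℕ}
  {M : LinearMDP S A d H K}

/-! ### Optimism -/

/-- The greedy value of the estimate. -/
def estValue (M : LinearMDP S A d H K) (W : ℕ) (β : ℕ → ℝ) (x : ℕ → ℕ → S) (a : ℕ → ℕ → A)
    (k h : ℕ) (s : S) : ℝ :=
  ⨆ b, M.estimate W β x a k h s b

theorem estimate_of_lt {W : ℕ} {β : ℕ → ℝ} {x : ℕ → ℕ → S} {a : ℕ → ℕ → A} {k h : ℕ} (hh : h < H)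
    (s : S) (b : A) :
    M.estimate W β x a k h s b
      = min ((M.φ s b).ofLp ⬝ᵥ M.weight W x a k h (M.estimate W β x a k (h + 1))
        + β k * √(quad (M.gram W x a k h) (M.φ s b).ofLp)) H := by
  obtain ⟨n, rfl⟩ : ∃ n, H = h + (n + 1) := ⟨H - (h + 1), by omega⟩
  have e1 : h + (n + 1) - h = n + 1 := by omega
  have e2 : h + (n + 1) - (h + 1) = n := by omega
  have e3 : h + (n + 1) - (n + 1) = h := by omega
  simp only [estimate, e1, e2, estimateAux, e3, quad]

theorem estimate_last {W : ℕ} {β : ℕ → ℝ} {x : ℕ → ℕ → S} {a : ℕ → ℕ → A} {k : ℕ} :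
    M.estimate W β x a k H = fun _ _ => 0 := by
  simp [estimate, estimateAux]

/-- The regression noise in episode `k` is at most `ρ`, uniformly over the class of the value
estimates. -/
def NoiseBound (M : LinearMDP S A d H K) (W : ℕ) (β ρ : ℝ) (x : ℕ → ℕ → S) (a : ℕ → ℕ → A)
    (k : ℕ) : Prop :=
  ∀ h, h + 1 < H → ∀ (w : Fin d → ℝ) (B : Matrix (Fin d) (Fin d) ℝ),
    (∀ i, |w i| ≤ 2 * K * H) → (∀ i j, |B i j| ≤ 1) →
    √(quad (M.gram W x a k h)
      (M.regressionNoise x a (epochStart (W / H) k) k h (M.clippedValue β w B))) ≤ ρ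

variable [MeasurableSingletonClass A] [Fintype A] [Nonempty A]
  {W : ℕ} {β : ℕ → ℝ} {x : ℕ → ℕ → S} {a : ℕ → ℕ → A} {k : ℕ} {ρ : ℝ} {e : ℕ}

omit [MeasurableSingletonClass A] [Nonempty A] in
theorem le_estValue (h : ℕ) (s : S) (b : A) :
    M.estimate W β x a k h s b ≤ M.estValue W β x a k h s :=
  le_ciSup (f := fun b => M.estimate W β x a k h s b) (Set.finite_range _).bddAbove b

omit [MeasurableSingletonClass A] [Fintype A] in
theorem estValue_last (s : S) : M.estValue W β x a k H s = 0 := by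
  simp [estValue, estimate_last]

omit [MeasurableSingletonClass A] [Fintype A] in
theorem estValue_le {h : ℕ} (hh : h ≤ H) (s : S) : M.estValue W β x a k h s ≤ H := by
  rcases hh.lt_or_eq with hlt | rfl
  · exact ciSup_le fun b => by rw [estimate_of_lt hlt]; exact min_le_right _ _
  · rw [estValue_last]; positivity

-- The algorithm does not clip at `0`, whereas the class does, so that all its members lie in `[0,
-- H]`. For a nonnegative estimate the clipping is invisible.
omit [MeasurableSingletonClass A] [Fintype A] [Nonempty A] in
theorem estValue_eq_clippedValue {h : ℕ} (hh : h < H)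
    (h0 : ∀ s, 0 ≤ M.estValue W β x a k h s) :
    M.estValue W β x a k h = M.clippedValue (β k)
      (M.weight W x a k h (M.estimate W β x a k (h + 1))) (M.gram W x a k h)⁻¹ := by
  funext s
  rw [clippedValue]
  have : M.estValue W β x a k h s = ⨆ b, min ((M.φ s b).ofLp ⬝ᵥ
      M.weight W x a k h (M.estimate W β x a k (h + 1))
      + β k * √((M.φ s b).ofLp ⬝ᵥ ((M.gram W x a k h)⁻¹ *ᵥ (M.φ s b).ofLp))) H := by
    rw [estValue]
    simp only [estimate_of_lt hh, quad]
  rw [← this, max_eq_right (h0 s)]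

/-- The regression at step `h` of episode `k` is accurate up to the bonus. -/
def AccurateAt (M : LinearMDP S A d H K) (W : ℕ) (β : ℕ → ℝ) (x : ℕ → ℕ → S) (a : ℕ → ℕ → A)
    (k h : ℕ) : Prop :=
  ∀ s b, |(M.φ s b).ofLp ⬝ᵥ M.weight W x a k h (M.estimate W β x a k (h + 1))
      - (M.reward k h s b + ∫ y, M.estValue W β x a k (h + 1) y ∂(M.trans k h (s, b)))|
    ≤ β k * √(quad (M.gram W x a k h) (M.φ s b).ofLp)

/-- The four claims need each other. Accuracy at step `h` uses the noise bound for the next value,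
which belongs to the class once it is nonnegative and has bounded weights; accuracy in turn makes
the value at `h` nonnegative, because a backup of a nonnegative function is nonnegative. -/
theorem estValue_props (hk : k < K) (hke : k < e) (hρ : 0 ≤ ρ)
    (hacc : M.NoiseBound W (β k) ρ x a k)
    (hβ : ρ + (1 + H) * √d + (M.varθ (epochStart (W / H) k) e
      + H * M.varμ (epochStart (W / H) k) e) * √(k - epochStart (W / H) k : ℕ) ≤ β k)
    (n h : ℕ) (hn : h + n = H) :
    (∀ s, 0 ≤ M.estValue W β x a k h s) ∧ Measurable (M.estValue W β x a k h) ∧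
      (h < H → M.AccurateAt W β x a k h) ∧
      (h < H → ∀ i, |M.weight W x a k h (M.estimate W β x a k (h + 1)) i| ≤ 2 * K * H) := by
  induction n generalizing h with
  | zero =>
    obtain rfl : h = H := by omega
    have h1 : M.estValue W β x a k h = fun _ => 0 := funext estValue_last
    exact ⟨fun s => by rw [h1], by rw [h1]; exact measurable_const,
      fun hlt => absurd hlt (lt_irrefl _), fun hlt => absurd hlt (lt_irrefl _)⟩
  | succ n ih =>
    obtain ⟨ih0, ihm, -, ihw⟩ := ih (h + 1) (by omega)
    have hh : h < H := by omega
    have hH1 : (1 : ℝ) ≤ H := by exact_mod_cast (by omega : 1 ≤ H)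
    have hmem : ∀ s, M.estValue W β x a k (h + 1) s ∈ Set.Icc (0 : ℝ) H := fun s =>
      ⟨ih0 s, estValue_le (by omega) s⟩
    have hb : ∀ s, |M.estValue W β x a k (h + 1) s| ≤ H := fun s => by
      rw [abs_of_nonneg (ih0 s)]; exact (hmem s).2
    have hnoise : √(quad (M.gram W x a k h) (M.regressionNoise x a (epochStart (W / H) k) k h
        (M.estValue W β x a k (h + 1)))) ≤ ρ := by
      -- At the last step the next value is identically `0`, so there is no noise and the states
      -- with index `H` play no role.
      rcases (by omega : h + 1 < H ∨ h + 1 = H) with hlt | heq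
      · rw [estValue_eq_clippedValue hlt ih0]
        exact hacc h hlt _ _ (ihw hlt) (abs_inv_apply_le_one (geOne_one_add_sum _ _))
      · have h1 : M.estValue W β x a k (h + 1) = fun _ => 0 := by
          rw [heq]; exact funext estValue_last
        rw [h1]
        simpa [regressionNoise, quad] using hρ
    have hacc' : M.AccurateAt W β x a k h := fun s b => by
      refine (abs_weight_error_le x a hk hke hh ihm (Nat.cast_nonneg H) hb
        (M.estimate W β x a k (h + 1)) (fun _ _ => rfl) s b).trans ?_
      gcongr
      linarith
    have hw : ∀ i, |M.weight W x a k h (M.estimate W β x a k (h + 1)) i| ≤ 2 * K * H := fun i => by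
      refine (abs_weight_le x a hk hh (M.estimate W β x a k (h + 1)) (Nat.cast_nonneg H)
        (fun l _ => hmem _) i).trans ?_
      have : (k : ℝ) ≤ K := by exact_mod_cast hk.le
      have hK0 : (0 : ℝ) ≤ K := by positivity
      nlinarith
    have h0 : ∀ s, 0 ≤ M.estValue W β x a k h s := fun s => by
      obtain ⟨b⟩ := ‹Nonempty A›
      refine le_trans ?_ (le_estValue h s b)
      rw [estimate_of_lt hh]
      refine le_min ?_ (Nat.cast_nonneg H)
      have h1 := (abs_le.mp (hacc' s b)).1
      have h2 := (reward_mem_Icc (M := M) hk hh s b).1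
      have h3 : 0 ≤ ∫ y, M.estValue W β x a k (h + 1) y ∂(M.trans k h (s, b)) :=
        integral_nonneg ih0
      linarith
    refine ⟨h0, ?_, fun _ => hacc', fun _ => hw⟩
    rw [estValue_eq_clippedValue hh h0]
    exact measurable_clippedValue _ _ _

/-- The estimated value function is nonnegative and measurable, and all regressions are
accurate. -/
structure GoodEstimates (M : LinearMDP S A d H K) (W : ℕ) (β : ℕ → ℝ) (x : ℕ → ℕ → S)
    (a : ℕ → ℕ → A) (k : ℕ) : Prop where
  nonneg : ∀ h ≤ H, ∀ s, 0 ≤ M.estValue W β x a k h s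
  measurable : ∀ h ≤ H, Measurable (M.estValue W β x a k h)
  accurate : ∀ h < H, M.AccurateAt W β x a k h

theorem goodEstimates (hk : k < K) (hke : k < e) (hρ : 0 ≤ ρ)
    (hacc : M.NoiseBound W (β k) ρ x a k)
    (hβ : ρ + (1 + H) * √d + (M.varθ (epochStart (W / H) k) e
      + H * M.varμ (epochStart (W / H) k) e) * √(k - epochStart (W / H) k : ℕ) ≤ β k) :
    M.GoodEstimates W β x a k := by
  have := fun h (hh : h ≤ H) => estValue_props hk hke hρ hacc hβ (H - h) h (by omega)
  exact ⟨fun h hh => (this h hh).1, fun h hh => (this h hh).2.1, fun h hh => (this h hh.le).2.2.1 hh⟩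

namespace GoodEstimates

variable (hg : M.GoodEstimates W β x a k)
include hg

theorem integrable {h : ℕ} (hh : h ≤ H) (ν : Measure S) [IsFiniteMeasure ν] :
    Integrable (M.estValue W β x a k h) ν :=
  Integrable.of_mem_Icc 0 H (hg.measurable h hh).aemeasurable
    (.of_forall fun s => ⟨hg.nonneg h hh s, estValue_le hh s⟩)

/-- Optimism: by accuracy the regression plus bonus is at least the backup of the next estimate,
which by induction is at least the backup of the next value. The truncation at `H` is harmless, as
values are at most `H`. -/
theorem value_le (hk : k < K) {f : ℕ → S → A} (hf : ∀ h, h < H → Measurable (f h)) (n h : ℕ)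
    (hn : h + n = H) (s : S) : M.value k f h s ≤ M.estValue W β x a k h s := by
  induction n generalizing h s with
  | zero =>
    obtain rfl : h = H := by omega
    rw [estValue_last]; simp [value]
  | succ n ih =>
    have hh : h < H := by omega
    have := M.markov k hk h hh
    refine le_trans ?_ (le_estValue h s (f h s))
    rw [estimate_of_lt hh]
    refine le_min ?_ (value_mem_Icc hk hf h s).2
    rw [value_eq hk hf hh]
    have h1 := (abs_le.mp (hg.accurate h hh s (f h s))).1
    have h2 : ∫ y, M.value k f (h + 1) y ∂(M.trans k h (s, f h s))
        ≤ ∫ y, M.estValue W β x a k (h + 1) y ∂(M.trans k h (s, f h s)) :=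
      integral_mono (Integrable.of_mem_Icc 0 H (measurable_value_state hk hf _).aemeasurable
        (.of_forall fun s => value_mem_Icc hk hf _ s)) (hg.integrable (by omega) _)
        fun y => ih (h + 1) (by omega) y
    linarith

theorem optValue_le (hk : k < K) (s : S) : M.optValue k 0 s ≤ M.estValue W β x a k 0 s := by
  have : Nonempty (Policy S A) :=
    ⟨⟨fun _ _ => Classical.arbitrary A, fun _ => measurable_const⟩⟩
  exact ciSup_le fun π => hg.value_le hk (fun h _ => π.measurable_act h) H 0 (by omega) s

/-- The gap of the greedy policy is at most the bonuses along the trajectory and the sum of the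
martingale differences. -/
theorem estValue_sub_value_le (hk : k < K) {f : ℕ → S → A} (hf : ∀ h, h < H → Measurable (f h))
    (hgreedy : ∀ h < H, ∀ s b, M.estimate W β x a k h s b ≤ M.estimate W β x a k h s (f h s))
    (y : ℕ → S) (n h : ℕ) (hn : h + n + 1 = H) :
    M.estValue W β x a k h (y h) - M.value k f h (y h)
      ≤ ∑ i ∈ Ico h H, 2 * (β k * √(quad (M.gram W x a k i) (M.φ (y i) (f i (y i))).ofLp))
        + ∑ i ∈ Ico h (H - 1),
          (∫ z, (M.estValue W β x a k (i + 1) z - M.value k f (i + 1) z)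
              ∂(M.trans k i (y i, f i (y i)))
            - (M.estValue W β x a k (i + 1) (y (i + 1)) - M.value k f (i + 1) (y (i + 1)))) := by
  -- The factor `2`: the bonus is paid once as regression error and once because it is added to the
  -- estimate.
  have step : ∀ h < H, M.estValue W β x a k h (y h) - M.value k f h (y h)
      ≤ 2 * (β k * √(quad (M.gram W x a k h) (M.φ (y h) (f h (y h))).ofLp))
        + ∫ z, (M.estValue W β x a k (h + 1) z - M.value k f (h + 1) z)
              ∂(M.trans k h (y h, f h (y h))) := by
    intro h hh
    have := M.markov k hk h hh
    rw [integral_sub (hg.integrable (by omega) _) (Integrable.of_mem_Icc 0 H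
      (measurable_value_state hk hf _).aemeasurable
        (.of_forall fun s => value_mem_Icc hk hf _ s)), value_eq hk hf hh]
    have h1 := (abs_le.mp (hg.accurate h hh (y h) (f h (y h)))).2
    have h2 : M.estValue W β x a k h (y h) ≤ M.estimate W β x a k h (y h) (f h (y h)) :=
      ciSup_le fun b => hgreedy h hh _ b
    rw [estimate_of_lt hh] at h2
    have h3 := h2.trans (min_le_left _ _)
    linarith
  induction n generalizing h with
  | zero =>
    obtain rfl : H = h + 1 := by omega
    have h1 := step h (by omega)
    have h2 : ∀ z, M.estValue W β x a k (h + 1) z - M.value k f (h + 1) z = 0 := fun z => by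
      rw [estValue_last]; simp [value]
    simp only [h2, integral_zero, add_zero] at h1
    simpa using h1
  | succ n ih =>
    have h1 := step h (by omega)
    have h2 := ih (h + 1) (by omega)
    rw [Finset.sum_eq_sum_Ico_succ_bot (by omega : h < H),
      Finset.sum_eq_sum_Ico_succ_bot (by omega : h < H - 1)]
    linarith

end GoodEstimates

end LinearMDP

namespace LinearMDP

variable {S A : Type*} [mS : MeasurableSpace S] [mA : MeasurableSpace A] {d H K : ℕ}
  {M : LinearMDP S A d H K}

/-! ### Measurability of the estimates -/

theorem measurable_features {α : Type*} [MeasurableSpace α] {x : ℕ → ℕ → α → S}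
    {a : ℕ → ℕ → α → A} {h l : ℕ} (hx : Measurable (x l h)) (ha : Measurable (a l h)) :
    Measurable fun z => M.features (fun l j => x l j z) (fun l j => a l j z) h l :=
  (WithLp.measurable_ofLp 2 (Fin d → ℝ)).comp (M.measurable_φ.comp (hx.prodMk ha))

theorem measurable_estimate [MeasurableSingletonClass A] [Fintype A] {α : Type*}
    [MeasurableSpace α] {x : ℕ → ℕ → α → S} {a : ℕ → ℕ → α → A} (W : ℕ) (β : ℕ → ℝ) {k : ℕ}
    (hx : ∀ l < k, ∀ j < H, Measurable (x l j)) (ha : ∀ l < k, ∀ j < H, Measurable (a l j))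
    (n h : ℕ) (hn : h + n = H) (b : A) :
    Measurable fun z : α × S =>
      M.estimate W β (fun l j => x l j z.1) (fun l j => a l j z.1) k h z.2 b := by
  induction n generalizing h b with
  | zero =>
    obtain rfl : h = H := by omega
    simp only [estimate_last]
    exact measurable_const
  | succ n ih =>
    have hh : h < H := by omega
    have ih := ih (h + 1) (by omega)
    simp only [estimate_of_lt hh]
    have hf : ∀ l ∈ Ico (epochStart (W / H) k) k,
        Measurable fun z => M.features (fun l j => x l j z) (fun l j => a l j z) h l :=
      fun l hl => measurable_features (hx l (Finset.mem_Ico.mp hl).2 h hh)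
        (ha l (Finset.mem_Ico.mp hl).2 h hh)
    have hΛ : ∀ i j, Measurable fun z =>
        M.gram W (fun l j => x l j z) (fun l j => a l j z) k h i j := by
      exact measurable_one_add_sum_vecMulVec _ hf
    have hφ : Measurable fun z : α × S => (M.φ z.2 b).ofLp := (measurable_φ_left b).comp measurable_snd
    have hw : Measurable fun z => M.weight W (fun l j => x l j z) (fun l j => a l j z) k h
        (M.estimate W β (fun l j => x l j z) (fun l j => a l j z) k (h + 1)) := by
      unfold weight
      refine measurable_inv_mulVec hΛ (Finset.measurable_fun_sum _ fun l hl => ?_)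
      have hlk := (Finset.mem_Ico.mp hl).2
      have hr : Measurable fun z => M.reward l h (x l h z) (a l h z) :=
        (measurable_reward l h).comp ((hx l hlk h hh).prodMk (ha l hlk h hh))
      have hs : ∀ c, Measurable fun z => M.estimate W β (fun l j => x l j z) (fun l j => a l j z)
          k (h + 1) (x l (h + 1) z) c := fun c => by
        rcases (by omega : h + 1 < H ∨ h + 1 = H) with hlt | heq
        · exact (ih c).comp (measurable_id.prodMk (hx l hlk (h + 1) hlt))
        · rw [heq]
          simp only [estimate_last]
          exact measurable_const
      exact (hr.add (Measurable.iSup hs)).smul (hf l hl)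
    have hq : Measurable fun z : α × S =>
        quad (M.gram W (fun l j => x l j z.1) (fun l j => a l j z.1) k h) (M.φ z.2 b).ofLp :=
      measurable_dotProduct hφ (measurable_inv_mulVec (fun i j => (hΛ i j).comp measurable_fst) hφ)
    exact ((measurable_dotProduct hφ (hw.comp measurable_fst)).add (hq.sqrt.const_mul _)).min
      measurable_const

theorem measurable_estValue [MeasurableSingletonClass A] [Fintype A] {α : Type*}
    [MeasurableSpace α] {x : ℕ → ℕ → α → S} {a : ℕ → ℕ → α → A} (W : ℕ) (β : ℕ → ℝ) {k : ℕ}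
    (hx : ∀ l < k, ∀ j < H, Measurable (x l j)) (ha : ∀ l < k, ∀ j < H, Measurable (a l j))
    {h : ℕ} (hh : h ≤ H) :
    Measurable fun z : α × S =>
      M.estValue W β (fun l j => x l j z.1) (fun l j => a l j z.1) k h z.2 :=
  Measurable.iSup fun b => measurable_estimate W β hx ha (H - h) h (by omega) b

/-! ### Discretization of the class of the value estimates -/

/-- The grid points that index the discretized class. -/
def netIndex (d N : ℕ) : Finset ((Fin d → ℤ) × (Fin d → Fin d → ℤ)) :=
  Fintype.piFinset (fun _ => Icc (-(N : ℤ)) N) ×ˢ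
    Fintype.piFinset fun _ => Fintype.piFinset fun _ => Icc (-(N : ℤ)) N

theorem card_netIndex (d N : ℕ) : #(netIndex d N) = (2 * N + 1) ^ (d + d * d) := by
  have h : #(Icc (-(N : ℤ)) N) = 2 * N + 1 := by rw [Int.card_Icc]; omega
  simp [netIndex, Finset.card_product, Fintype.card_piFinset, h, pow_add, pow_mul]

/-- The clipped value at a grid point. -/
def netValue (M : LinearMDP S A d H K) (β η : ℝ) (u : (Fin d → ℤ) × (Fin d → Fin d → ℤ)) : S → ℝ :=
  M.clippedValue β (fun i => η * u.1 i) (Matrix.of fun i j => η * u.2 i j)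

/-- The two noise vectors differ by at most `K` features with coefficients of size at most `2 ε`,
and every visited feature has form at most `1`. -/
theorem sqrt_quad_regressionNoise_le {W k h : ℕ} {x : ℕ → ℕ → S} {a : ℕ → ℕ → A} (hk : k < K)
    (hh : h < H) {V V' : S → ℝ} (hV : Measurable V) (hV' : Measurable V') {R ε : ℝ}
    (hb : ∀ y, V y ∈ Set.Icc 0 R) (hb' : ∀ y, V' y ∈ Set.Icc 0 R)
    (hε : ∀ y, |V y - V' y| ≤ ε) :
    √(quad (M.gram W x a k h) (M.regressionNoise x a (epochStart (W / H) k) k h V))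
      ≤ √(quad (M.gram W x a k h) (M.regressionNoise x a (epochStart (W / H) k) k h V'))
        + 2 * ε * K := by
  have hg : GeOne (M.gram W x a k h) := geOne_one_add_sum _ _
  set τ := epochStart (W / H) k with hτ
  have hε0 : 0 ≤ ε := (abs_nonneg _).trans (hε (x 0 0))
  set δ : ℕ → ℝ := fun l => (V (x l (h + 1)) - ∫ y, V y ∂(M.trans l h (x l h, a l h)))
    - (V' (x l (h + 1)) - ∫ y, V' y ∂(M.trans l h (x l h, a l h))) with hδ
  have hδ2 : ∀ l ∈ Ico τ k, |δ l| ≤ 2 * ε := by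
    intro l hl
    have hlK : l < K := (Finset.mem_Ico.mp hl).2.trans hk
    have := M.markov l hlK h hh
    have h1 := hε (x l (h + 1))
    have h2 : |∫ y, V y ∂(M.trans l h (x l h, a l h)) - ∫ y, V' y ∂(M.trans l h (x l h, a l h))|
        ≤ ε := by
      rw [← integral_sub (Integrable.of_mem_Icc 0 R hV.aemeasurable (.of_forall hb))
        (Integrable.of_mem_Icc 0 R hV'.aemeasurable (.of_forall hb'))]
      have h3 := norm_integral_le_of_norm_le_const (μ := M.trans l h (x l h, a l h))
        (f := fun y => V y - V' y) (C := ε) (.of_forall hε)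
      simpa using h3
    rw [abs_le] at h1 h2 ⊢
    simp only [hδ]
    constructor <;> linarith
  have heq : M.regressionNoise x a τ k h V = M.regressionNoise x a τ k h V'
      + ∑ l ∈ Ico τ k, δ l • M.features x a h l := by
    simp only [regressionNoise, hδ, ← Finset.sum_add_distrib, ← add_smul]
    refine Finset.sum_congr rfl fun l _ => ?_
    congr 1
    ring
  rw [heq]
  refine (hg.sqrt_quad_add_le _ _).trans ?_
  gcongr
  refine (hg.sqrt_quad_sum_le _ _).trans ?_
  calc _ ≤ ∑ _l ∈ Ico τ k, 2 * ε := by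
        refine Finset.sum_le_sum fun l hl => ?_
        rw [GeOne.quad_smul, Real.sqrt_mul (sq_nonneg _), Real.sqrt_sq_eq_abs]
        have h1 : √(quad (M.gram W x a k h) (M.features x a h l)) ≤ 1 := by
          rw [Real.sqrt_le_one]
          exact (hg.quad_le _).trans (M.φ_dotProduct_self_le _ _)
        calc _ ≤ |δ l| * 1 := by gcongr
          _ ≤ 2 * ε := by rw [mul_one]; exact hδ2 l hl
    _ = (k - τ : ℕ) * (2 * ε) := by simp
    _ ≤ K * (2 * ε) := by gcongr; omega
    _ = 2 * ε * K := by ring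

section Net

variable [MeasurableSingletonClass A] [Fintype A] [Nonempty A]

theorem noiseBound_of_net {W : ℕ} {β ρ η : ℝ} {x : ℕ → ℕ → S} {a : ℕ → ℕ → A} {k : ℕ} (hk : k < K)
    (hβ : 0 ≤ β) (hη : 0 < η) {N : ℕ} (hN : 2 * K * H / η + 1 ≤ N)
    (hnet : ∀ h, h + 1 < H → ∀ u ∈ netIndex d N, √(quad (M.gram W x a k h)
      (M.regressionNoise x a (epochStart (W / H) k) k h (M.netValue β η u))) ≤ ρ) :
    M.NoiseBound W β (ρ + 2 * (d * η + β * (d * √η)) * K) x a k := by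
  intro h hh w B hw hB
  -- The matrix entries are bounded by `1`, hence by the range allowed for the weights, and one grid
  -- size `N` serves both.
  have hKH : (1 : ℝ) ≤ 2 * K * H := by
    have h1 : (1 : ℝ) ≤ K := by exact_mod_cast (by omega : 1 ≤ K)
    have h2 : (1 : ℝ) ≤ H := by exact_mod_cast (by omega : 1 ≤ H)
    nlinarith
  set u : (Fin d → ℤ) × (Fin d → Fin d → ℤ) := (fun i => ⌊w i / η⌋, fun i j => ⌊B i j / η⌋) with hu
  have hmem : u ∈ netIndex d N := by
    simp only [netIndex, Finset.mem_product, Fintype.mem_piFinset, hu]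
    exact ⟨fun i => floor_div_mem_Icc hη (hw i) hN,
      fun i j => floor_div_mem_Icc hη ((hB i j).trans hKH) hN⟩
  refine (sqrt_quad_regressionNoise_le hk (by omega) (measurable_clippedValue _ _ _)
    (V' := M.netValue β η u) (measurable_clippedValue _ _ _) (clippedValue_mem_Icc _ _ _)
    (clippedValue_mem_Icc _ _ _) (abs_clippedValue_sub_le hβ (η := η) ?_ ?_)).trans ?_
  · exact fun i => abs_sub_floor_mul_le hη (w i)
  · exact fun i j => abs_sub_floor_mul_le hη (B i j)
  · gcongr
    exact hnet h hh u hmem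

end Net

/-! ### The good event -/

variable {Ω : Type*} [mΩ : MeasurableSpace Ω] {P : Measure Ω} {ℱ : Filtration ℕ mΩ}
  {x : ℕ → ℕ → Ω → S} {π : ℕ → ℕ → Ω → S → A}

/-- The action played at step `h` of episode `k`. -/
def played (x : ℕ → ℕ → Ω → S) (π : ℕ → ℕ → Ω → S → A) (k h : ℕ) (ω : Ω) : A := π k h ω (x k h ω)

namespace IsInteraction

variable (hI : M.IsInteraction P ℱ x π)
include hI

theorem measurable_played {k h : ℕ} (hk : k < K) (hh : h < H) :
    Measurable[ℱ (k * H + h)] (played x π k h) := by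
  have h1 : @Measurable Ω (Ω × S) (ℱ (k * H + h)) ((ℱ (k * H)).prod mS) fun ω => (ω, x k h ω) :=
    @Measurable.prodMk Ω (ℱ (k * H + h)) Ω S (ℱ (k * H)) mS _ _
      (measurable_id'' (ℱ.mono (Nat.le_add_right _ _))) (hI.measurable_state k hk h hh)
  exact (hI.measurable_policy k hk h hh).comp h1

theorem isDraw {k h : ℕ} (hk : k < K) (hh : h + 1 < H) :
    IsDraw (ℱ (k * H + h)) P (x k (h + 1))
      (fun ω => M.trans k h (x k h ω, played x π k h ω)) where
  le := ℱ.le _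
  measurable := (hI.measurable_state k hk (h + 1) hh).mono (ℱ.le _) le_rfl
  measurable_law := (M.trans k h).measurable.comp
    (@Measurable.prodMk Ω (ℱ (k * H + h)) S A mS mA _ _
      (hI.measurable_state k hk h (by omega)) (hI.measurable_played hk (by omega)))
  prob := fun ω => by
    have := M.markov k hk h (by omega)
    infer_instance
  condExp_eq := fun B hB => hI.transition k hk h hh B hB

theorem measurable_features {k h : ℕ} (hk : k < K) (hh : h < H) :
    Measurable[ℱ (k * H + h)] fun ω =>
      M.features (fun l j => x l j ω) (fun l j => played x π l j ω) h k :=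
  @LinearMDP.measurable_features S A mS mA d H K M Ω (ℱ (k * H + h)) x (played x π) h k
    (hI.measurable_state k hk h hh) (hI.measurable_played hk hh)

/-- The state after step `h` is revealed at time `k H + h + 1`, which is no later than step `h` of
the next episode. -/
theorem measurable_next {k h : ℕ} (hk : k < K) (hh : h + 1 < H) :
    Measurable[ℱ ((k + 1) * H + h)] (x k (h + 1)) :=
  (hI.measurable_state k hk (h + 1) hh).mono (ℱ.mono (by nlinarith)) le_rfl

end IsInteraction

/-- Both concentration bounds fix the step `h` and run over the episodes, with this subsequence of
the filtration. -/
theorem monotone_filtration_step (ℱ : Filtration ℕ mΩ) (h : ℕ) :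
    Monotone fun k => (ℱ (k * H + h) : MeasurableSpace Ω) := fun i j hij =>
  ℱ.mono (by gcongr)

/-- The difference between the estimated value, clipped at `0`, and the value of the policy
played. -/
def valueGap (M : LinearMDP S A d H K) (W : ℕ) (β : ℕ → ℝ) (x : ℕ → ℕ → Ω → S)
    (π : ℕ → ℕ → Ω → S → A) (k h : ℕ) (z : Ω × S) : ℝ :=
  max 0 (M.estValue W β (fun l j => x l j z.1) (fun l j => played x π l j z.1) k h z.2)
    - M.value k (fun j => π k j z.1) h z.2

theorem IsInteraction.measurable_act (hI : M.IsInteraction P ℱ x π) {k h : ℕ} (hk : k < K)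
    (hh : h < H) (ω : Ω) : Measurable (π k h ω) :=
  (hI.measurable_policy k hk h hh).comp (@measurable_prodMk_left Ω S (ℱ (k * H)) mS ω)

variable [MeasurableSingletonClass A] [Fintype A] [Nonempty A]

omit [MeasurableSingletonClass A] [Fintype A] in
theorem IsInteraction.valueGap_mem_Icc (hI : M.IsInteraction P ℱ x π) (W : ℕ) (β : ℕ → ℝ)
    {k h : ℕ} (hk : k < K) (hh : h ≤ H) (z : Ω × S) :
    M.valueGap W β x π k h z ∈ Set.Icc (-(H : ℝ)) H := by
  have h1 := value_mem_Icc (M := M) hk (f := fun j => π k j z.1)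
    (fun j hj => hI.measurable_act hk hj z.1) h z.2
  have h2 : max 0 (M.estValue W β (fun l j => x l j z.1) (fun l j => played x π l j z.1) k h z.2)
      ≤ H := max_le (by positivity) (estValue_le hh _)
  have h3 := le_max_left 0
    (M.estValue W β (fun l j => x l j z.1) (fun l j => played x π l j z.1) k h z.2)
  unfold valueGap
  constructor <;> linarith [h1.1, h1.2]

omit [Nonempty A] in
theorem IsInteraction.measurable_valueGap (hI : M.IsInteraction P ℱ x π) (W : ℕ) (β : ℕ → ℝ)
    {k h : ℕ} (hk : k < K) (hh : h ≤ H) (i : ℕ) :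
    Measurable[(ℱ (k * H + i)).prod mS] (M.valueGap W β x π k h) := by
  -- The estimate of episode `k` uses only earlier episodes, all of whose times precede `k H`.
  have hle : ∀ l < k, ∀ j < H, l * H + j ≤ k * H + i := fun l hl j hj => by
    have : (l + 1) * H ≤ k * H := by gcongr; omega
    nlinarith
  have h1 := @measurable_estValue S A mS mA d H K M _ _ Ω (ℱ (k * H + i)) x (played x π) W β k
    (fun l hl j hj => (hI.measurable_state l (hl.trans hk) j hj).mono (ℱ.mono (hle l hl j hj)) le_rfl)
    (fun l hl j hj => (hI.measurable_played (hl.trans hk) hj).mono (ℱ.mono (hle l hl j hj)) le_rfl)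
    h hh
  have h2 := @measurable_value S A mS mA d H K M Ω (ℱ (k * H + i)) k hk (fun ω j => π k j ω)
    (fun j hj => (hI.measurable_policy k hk j hj).mono
      (sup_le_sup (MeasurableSpace.comap_mono (ℱ.mono (Nat.le_add_right _ _))) le_rfl) le_rfl) h
  exact (measurable_const.max h1).sub h2

variable [IsProbabilityMeasure P]

/-- A grid point gives a function independent of the outcome, to which the self-normalized
inequality applies. The coefficient `β` is deterministic too, so it is not discretized. -/
theorem IsInteraction.measure_noise_ge_le (hI : M.IsInteraction P ℱ x π) (hH : 0 < H) {W k h : ℕ}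
    (hk : k < K) (hh : h + 1 < H) (β η : ℝ) (u : (Fin d → ℤ) × (Fin d → Fin d → ℤ)) (L : ℝ) :
    P {ω | (H : ℝ) ^ 2 * (d * Real.log (d + (k - epochStart (W / H) k : ℕ)) + 2 * L)
        ≤ quad (M.gram W (fun l j => x l j ω) (fun l j => played x π l j ω) k h)
          (M.regressionNoise (fun l j => x l j ω) (fun l j => played x π l j ω)
            (epochStart (W / H) k) k h (M.netValue β η u))}
      ≤ ENNReal.ofReal (Real.exp (-L)) := by
  have hτ : epochStart (W / H) k ≤ k := Nat.div_mul_le_self _ _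
  have hlK : ∀ l ∈ Ico (epochStart (W / H) k) k, l < K := fun l hl =>
    (Finset.mem_Ico.mp hl).2.trans hk
  exact measure_quad_noiseSum_ge_le (fun l => ℱ (l * H + h)) (fun l => x l (h + 1))
    (fun l ω => M.trans l h (x l h ω, played x π l h ω))
    (fun l ω => M.features (fun l j => x l j ω) (fun l j => played x π l j ω) h l)
    (M.netValue β η u) (monotone_filtration_step ℱ h) hτ
    (fun l hl => hI.isDraw (hlK l hl) hh) (fun l hl => hI.measurable_next (hlK l hl) hh)
    (fun l hl => hI.measurable_features (hlK l hl) (by omega))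
    (fun l _ ω => M.φ_dotProduct_self_le _ _) (measurable_clippedValue _ _ _)
    (R := H) (by exact_mod_cast hH) (clippedValue_mem_Icc _ _ _) L

theorem IsInteraction.measure_sum_valueGap_ge_le (hI : M.IsInteraction P ℱ x π) (hK : 0 < K)
    (W : ℕ) (β : ℕ → ℝ) {h : ℕ} (hh : h + 1 < H) (L : ℝ) :
    P {ω | (H : ℝ) * √K * (L + 1 / 2) ≤ ∑ k ∈ range K,
        (∫ y, M.valueGap W β x π k (h + 1) (ω, y) ∂(M.trans k h (x k h ω, played x π k h ω))
          - M.valueGap W β x π k (h + 1) (ω, x k (h + 1) ω))}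
      ≤ ENNReal.ofReal (Real.exp (-L)) :=
  measure_sum_diff_ge_le (fun l => ℱ (l * H + h)) (fun l => x l (h + 1))
    (fun l ω => M.trans l h (x l h ω, played x π l h ω)) (monotone_filtration_step ℱ h) K hK
    (fun _ hl => hI.isDraw hl hh) (fun _ hl => hI.measurable_next hl hh)
    (fun k => M.valueGap W β x π k (h + 1))
    (fun _ hl => hI.measurable_valueGap W β hl hh.le h) (R := H)
    (by exact_mod_cast (by omega : 0 < H)) (fun _ hl => hI.valueGap_mem_Icc W β hl hh.le) L

/-- Outside an event of small probability, the regression noise and the martingale differences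
are bounded. -/
theorem IsInteraction.exists_bad_event (hI : M.IsInteraction P ℱ x π) (hK : 0 < K) (hH : 0 < H)
    (W : ℕ) {β : ℕ → ℝ} (hβ : ∀ k < K, 0 ≤ β k) {η : ℝ} (hη : 0 < η) {N : ℕ}
    (hN : 2 * K * H / η + 1 ≤ N) {ε : ℝ} (hε : ∀ k < K, d * η + β k * (d * √η) ≤ ε) (L L' : ℝ) :
    ∃ E : Set Ω, P E ≤ ENNReal.ofReal (K * H * (2 * N + 1) ^ (d + d * d) * Real.exp (-L)
        + H * Real.exp (-L')) ∧
      ∀ ω ∉ E,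
        (∀ k < K, M.NoiseBound W (β k)
          (H * √(d * Real.log (d + K) + 2 * L) + 2 * ε * K)
          (fun l j => x l j ω) (fun l j => played x π l j ω) k) ∧
        ∀ h, h + 1 < H → ∑ k ∈ range K,
          (∫ y, M.valueGap W β x π k (h + 1) (ω, y) ∂(M.trans k h (x k h ω, played x π k h ω))
            - M.valueGap W β x π k (h + 1) (ω, x k (h + 1) ω)) ≤ H * √K * (L' + 1 / 2) := by
  set E1 : ℕ → ℕ → ((Fin d → ℤ) × (Fin d → Fin d → ℤ)) → Set Ω := fun k h u =>
    {ω | (H : ℝ) ^ 2 * (d * Real.log (d + (k - epochStart (W / H) k : ℕ)) + 2 * L)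
        ≤ quad (M.gram W (fun l j => x l j ω) (fun l j => played x π l j ω) k h)
          (M.regressionNoise (fun l j => x l j ω) (fun l j => played x π l j ω)
            (epochStart (W / H) k) k h (M.netValue (β k) η u))} with hE1
  set E2 : ℕ → Set Ω := fun h => {ω | (H : ℝ) * √K * (L' + 1 / 2) ≤ ∑ k ∈ range K,
        (∫ y, M.valueGap W β x π k (h + 1) (ω, y) ∂(M.trans k h (x k h ω, played x π k h ω))
          - M.valueGap W β x π k (h + 1) (ω, x k (h + 1) ω))} with hE2
  -- Only the `H - 1` steps followed by another state carry noise.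
  refine ⟨(⋃ i ∈ (range K ×ˢ range (H - 1)) ×ˢ netIndex d N, E1 i.1.1 i.1.2 i.2)
    ∪ ⋃ h ∈ range (H - 1), E2 h, ?_, ?_⟩
  · have b1 : P (⋃ i ∈ (range K ×ˢ range (H - 1)) ×ˢ netIndex d N, E1 i.1.1 i.1.2 i.2)
        ≤ ENNReal.ofReal (K * H * (2 * N + 1) ^ (d + d * d) * Real.exp (-L)) := by
      refine (measure_biUnion_finset_le _ _).trans ?_
      calc _ ≤ ∑ i ∈ (range K ×ˢ range (H - 1)) ×ˢ netIndex d N,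
            ENNReal.ofReal (Real.exp (-L)) := by
            refine Finset.sum_le_sum fun i hi => ?_
            simp only [Finset.mem_product, Finset.mem_range] at hi
            exact hI.measure_noise_ge_le hH hi.1.1 (by omega) _ _ _ _
        _ = ENNReal.ofReal ((K * (H - 1 : ℕ) * (2 * N + 1) ^ (d + d * d) : ℕ) * Real.exp (-L)) := by
            rw [Finset.sum_const, nsmul_eq_mul, ENNReal.ofReal_mul (by positivity),
              ENNReal.ofReal_natCast, Finset.card_product, Finset.card_product, card_netIndex,
              Finset.card_range, Finset.card_range]
        _ ≤ _ := by
            apply ENNReal.ofReal_le_ofReal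
            push_cast
            gcongr
            exact_mod_cast Nat.sub_le _ _
    have b2 : P (⋃ h ∈ range (H - 1), E2 h) ≤ ENNReal.ofReal (H * Real.exp (-L')) := by
      refine (measure_biUnion_finset_le _ _).trans ?_
      calc _ ≤ ∑ h ∈ range (H - 1), ENNReal.ofReal (Real.exp (-L')) := by
            refine Finset.sum_le_sum fun h hh => ?_
            exact hI.measure_sum_valueGap_ge_le hK W β (by have := Finset.mem_range.mp hh; omega) L'
        _ = ENNReal.ofReal ((H - 1 : ℕ) * Real.exp (-L')) := by
            rw [Finset.sum_const, nsmul_eq_mul, ENNReal.ofReal_mul (by positivity),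
              ENNReal.ofReal_natCast, Finset.card_range]
        _ ≤ _ := by
            apply ENNReal.ofReal_le_ofReal
            gcongr
            exact_mod_cast Nat.sub_le _ _
    rw [ENNReal.ofReal_add (by positivity) (by positivity)]
    exact (measure_union_le _ _).trans (add_le_add b1 b2)
  · intro ω hω
    simp only [Set.mem_union, Set.mem_iUnion, not_or, not_exists] at hω
    obtain ⟨h1, h2⟩ := hω
    refine ⟨fun k hk => ?_, fun h hh => ?_⟩
    · have hb := noiseBound_of_net (M := M) (W := W) (ρ := H * √(d * Real.log (d + K) + 2 * L))
        (x := fun l j => x l j ω) (a := fun l j => played x π l j ω) hk (hβ k hk) hη hN ?_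
      · intro h hh w B hw hB
        refine (hb h hh w B hw hB).trans ?_
        gcongr
        exact hε k hk
      · intro h hh u hu
        have h3 := h1 ((k, h), u) (by
          simp only [Finset.mem_product, Finset.mem_range]
          exact ⟨⟨hk, by omega⟩, hu⟩)
        simp only [hE1, Set.mem_ofPred_eq, not_le] at h3
        have hH0 : (0 : ℝ) ≤ H := Nat.cast_nonneg H
        have e1 : (H : ℝ) * √(d * Real.log (d + K) + 2 * L)
            = √((H : ℝ) ^ 2 * (d * Real.log (d + K) + 2 * L)) := by
          rw [Real.sqrt_mul (sq_nonneg _), Real.sqrt_sq hH0]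
        rw [e1]
        refine Real.sqrt_le_sqrt (h3.le.trans ?_)
        -- Monotonicity of the logarithm needs a positive argument; for `d = 0` the logarithmic term
        -- vanishes.
        rcases Nat.eq_zero_or_pos d with rfl | hd
        · simp
        have hd' : (0 : ℝ) < d := by exact_mod_cast hd
        have hle : Real.log (d + (k - epochStart (W / H) k : ℕ)) ≤ Real.log (d + K) := by
          refine Real.log_le_log (by positivity) ?_
          gcongr
          omega
        gcongr
    · have h3 := h2 h (Finset.mem_range.mpr (by omega))
      simp only [hE2, Set.mem_ofPred_eq, not_le] at h3
      exact h3.le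

end LinearMDP

/-! ### Sums over epochs -/

theorem sum_Ico_succ_add_le {g : ℕ → ℝ} (hg : ∀ k, 0 ≤ g k) {a b : ℕ} (h : a ≤ b) :
    ∑ k ∈ Ico (0 + 1) a, g k + ∑ k ∈ Ico (a + 1) b, g k ≤ ∑ k ∈ Ico (0 + 1) b, g k := by
  rw [← Finset.sum_union]
  · refine Finset.sum_le_sum_of_subset_of_nonneg (fun j => ?_) fun _ _ _ => hg _
    simp only [Finset.mem_union, Finset.mem_Ico]; omega
  · rw [Finset.disjoint_left]
    intro j; simp only [Finset.mem_Ico]; omega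

namespace LinearMDP

variable {S A : Type*} [MeasurableSpace S] [MeasurableSpace A] {d H K : ℕ}
  {M : LinearMDP S A d H K}

theorem varθ_add_le {a b : ℕ} (h : a ≤ b) : M.varθ 0 a + M.varθ a b ≤ M.varθ 0 b :=
  sum_Ico_succ_add_le (fun _ => Finset.sum_nonneg fun _ _ => norm_nonneg _) h

theorem varμ_add_le {a b : ℕ} (h : a ≤ b) : M.varμ 0 a + M.varμ a b ≤ M.varμ 0 b :=
  sum_Ico_succ_add_le (fun _ => Finset.sum_nonneg fun _ _ => tvNorm_nonneg _) h

theorem varθ_le (a : ℕ) {b : ℕ} (hb : b ≤ K) : M.varθ a b ≤ K * (H * (2 * √d)) := by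
  calc M.varθ a b ≤ ∑ _k ∈ Ico (a + 1) b, ∑ _h ∈ range H, 2 * √(d : ℝ) := by
        refine Finset.sum_le_sum fun k hk => Finset.sum_le_sum fun h hh => ?_
        have hk' := Finset.mem_Ico.mp hk
        have hh' := Finset.mem_range.mp hh
        refine (norm_sub_le _ _).trans ?_
        linarith [M.norm_θ_le k (by omega) h hh', M.norm_θ_le (k - 1) (by omega) h hh']
    _ = (b - (a + 1) : ℕ) * (H * (2 * √d)) := by simp
    _ ≤ _ := by gcongr; omega

theorem varμ_le (a : ℕ) {b : ℕ} (hb : b ≤ K) : M.varμ a b ≤ K * (H * (2 * √d)) := by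
  calc M.varμ a b ≤ ∑ _k ∈ Ico (a + 1) b, ∑ _h ∈ range H, 2 * √(d : ℝ) := by
        refine Finset.sum_le_sum fun k hk => Finset.sum_le_sum fun h hh => ?_
        have hk' := Finset.mem_Ico.mp hk
        have hh' := Finset.mem_range.mp hh
        refine (tvNorm_sub_le _ _).trans ?_
        linarith [M.norm_μ_le k (by omega) h hh', M.norm_μ_le (k - 1) (by omega) h hh']
    _ = (b - (a + 1) : ℕ) * (H * (2 * √d)) := by simp
    _ ≤ _ := by gcongr; omega

/-- Induction on the number of epochs. Epoch `j` contributes at most `(b₀ + D_j r) Y`, where `D_j`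
is its variation; the `D_j` add up to at most the total, since changes across an epoch boundary are
counted in none of them. -/
theorem sum_bonus_le {n : ℕ} (hn : 0 < n) {β s : ℕ → ℝ} {b₀ r Y : ℝ} (hb₀ : 0 ≤ b₀) (hr : 0 ≤ r)
    (hs : ∀ k, 0 ≤ s k)
    (hβ : ∀ j k, j * n ≤ k → k < min (j * n + n) K → β k ≤ b₀
      + (M.varθ (j * n) (min (j * n + n) K) + H * M.varμ (j * n) (min (j * n + n) K)) * r)
    (hY : ∀ j, j * n ≤ K → ∑ k ∈ Ico (j * n) (min (j * n + n) K), s k ≤ Y) (J : ℕ) :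
    ∑ k ∈ range (min (J * n) K), β k * s k
      ≤ (J * b₀ + (M.varθ 0 (min (J * n) K) + H * M.varμ 0 (min (J * n) K)) * r) * Y := by
  have hY0 : 0 ≤ Y := (Finset.sum_nonneg fun k _ => hs k).trans (hY 0 (by simp))
  induction J with
  | zero => simp [varθ, varμ]
  | succ J ih =>
    -- If the episodes are already exhausted, the new epoch is empty.
    rcases Nat.lt_or_ge K (J * n) with hlt | hge
    · have e1 : min (J * n) K = K := by omega
      have e2 : min ((J + 1) * n) K = K := by rw [Nat.succ_mul]; omega
      rw [e1] at ih
      rw [e2]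
      refine ih.trans ?_
      push_cast
      gcongr
      linarith
    · have e1 : min (J * n) K = J * n := by omega
      rw [e1] at ih
      rw [Nat.succ_mul]
      set e := min (J * n + n) K with he
      have hle : J * n ≤ e := by omega
      rw [Finset.range_eq_Ico] at ih ⊢
      rw [← Finset.sum_Ico_consecutive _ (Nat.zero_le _) hle]
      set D := M.varθ (J * n) e + H * M.varμ (J * n) e with hD
      have hD0 : 0 ≤ D := by
        have := M.varθ_nonneg (J * n) e
        have := M.varμ_nonneg (J * n) e
        positivity
      have h1 : ∑ k ∈ Ico (J * n) e, β k * s k ≤ (b₀ + D * r) * Y := by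
        calc _ ≤ ∑ k ∈ Ico (J * n) e, (b₀ + D * r) * s k := by
              refine Finset.sum_le_sum fun k hk => ?_
              have hk' := Finset.mem_Ico.mp hk
              exact mul_le_mul_of_nonneg_right (hβ J k hk'.1 hk'.2) (hs k)
          _ = (b₀ + D * r) * ∑ k ∈ Ico (J * n) e, s k := by rw [Finset.mul_sum]
          _ ≤ _ := by gcongr; exact hY J hge
      have h2 := varθ_add_le (M := M) hle
      have h3 := varμ_add_le (M := M) hle
      have h4 : (M.varθ 0 (J * n) + H * M.varμ 0 (J * n)) + D
          ≤ M.varθ 0 e + H * M.varμ 0 e := by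
        have : (H : ℝ) * (M.varμ 0 (J * n) + M.varμ (J * n) e) ≤ H * M.varμ 0 e := by gcongr
        rw [hD]; linarith
      calc _ ≤ (J * b₀ + (M.varθ 0 (J * n) + H * M.varμ 0 (J * n)) * r) * Y
            + (b₀ + D * r) * Y := add_le_add ih h1
        _ = ((J + 1) * b₀ + ((M.varθ 0 (J * n) + H * M.varμ 0 (J * n)) + D) * r) * Y := by ring
        _ ≤ _ := by push_cast; gcongr

/-- In dimension `0` the linear model would give the whole space transition probability `0`. -/
theorem dim_pos [Nonempty S] [Nonempty A] (M : LinearMDP S A d H K) (hK : 0 < K) (hH : 0 < H) :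
    0 < d := by
  rcases Nat.eq_zero_or_pos d with rfl | hd
  · exfalso
    have := M.markov 0 hK 0 hH
    have h := M.trans_eq 0 hK 0 hH (Classical.arbitrary S) (Classical.arbitrary A) Set.univ
      MeasurableSet.univ
    simp at h
  · exact hd

theorem epochStart_eq {n j k : ℕ} (h1 : j * n ≤ k) (h2 : k < j * n + n) :
    epochStart n k = j * n := by
  rw [epochStart]
  congr 1
  exact Nat.div_eq_of_lt_le h1 (by rw [Nat.succ_mul]; exact h2)

/-! ### Parameters -/

/-- The argument of the logarithm. -/
structure LogArg (d H K : ℕ) (p X : ℝ) : Prop where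
  hd : 0 < d
  hK : 0 < K
  hH : 0 < H
  hp : 0 < p
  hp1 : p < 1
  eq : X = 2 * d * (K * H) / p

namespace LogArg

variable {p X : ℝ} (h : LogArg d H K p X)
include h

theorem two_mul_le : 2 * (d : ℝ) * (K * H) ≤ X := by
  rw [h.eq, le_div_iff₀ h.hp]
  have : (0 : ℝ) ≤ 2 * d * (K * H) := by positivity
  nlinarith [h.hp1]

theorem one_le_d : (1 : ℝ) ≤ d := by exact_mod_cast h.hd
theorem one_le_K : (1 : ℝ) ≤ K := by exact_mod_cast h.hK
theorem one_le_H : (1 : ℝ) ≤ H := by exact_mod_cast h.hH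

theorem two_le : 2 ≤ X := by
  refine le_trans ?_ h.two_mul_le
  have h1 := one_le_mul_of_one_le_of_one_le h.one_le_K h.one_le_H
  have h2 := one_le_mul_of_one_le_of_one_le h.one_le_d h1
  linarith

theorem half_le_log : 1 / 2 ≤ Real.log X := by
  have h1 := Real.log_le_log (by norm_num) h.two_le
  have := Real.log_two_gt_d9
  linarith

theorem add_le : (d : ℝ) + K ≤ X := by
  refine le_trans ?_ h.two_mul_le
  have h1 := h.one_le_d
  have h2 := h.one_le_K
  have h3 := h.one_le_H
  have h4 : (d : ℝ) * K ≤ d * (K * H) := by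
    have : (0 : ℝ) ≤ d * K := by positivity
    nlinarith
  nlinarith [mul_nonneg (sub_nonneg.mpr h1) (sub_nonneg.mpr h2)]

theorem dH_le : (d : ℝ) * H ≤ X := by
  refine le_trans ?_ h.two_mul_le
  have h2 := h.one_le_K
  have : (0 : ℝ) ≤ d * H := by positivity
  nlinarith

theorem K_le : (K : ℝ) ≤ X := by linarith [h.add_le, h.one_le_d]

theorem d_le : (d : ℝ) ≤ X := by linarith [h.add_le, h.one_le_K]

theorem H_le : (H : ℝ) ≤ X := by
  have := h.dH_le
  have h1 := h.one_le_d
  have : (0 : ℝ) ≤ H := by positivity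
  nlinarith

theorem KH_le : 2 * (K : ℝ) * H ≤ X := by
  refine le_trans ?_ h.two_mul_le
  have h1 := h.one_le_d
  have : (0 : ℝ) ≤ K * H := by positivity
  nlinarith

theorem KH_le_mul : (K : ℝ) * H ≤ X * (p / 2) := by
  have h0 := h.hp
  have h1 := h.one_le_d
  have : (0 : ℝ) ≤ K * H := by positivity
  have e : X * (p / 2) = d * (K * H) := by rw [h.eq]; field_simp
  rw [e]
  nlinarith

theorem H_div_le : (H : ℝ) * Real.exp (-Real.log X) ≤ p / 2 := by
  have hX := h.two_le
  rw [Real.exp_neg, Real.exp_log (by linarith), ← div_eq_mul_inv, div_le_iff₀ (by linarith)]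
  have := h.KH_le_mul
  have h2 := h.one_le_K
  have : (0 : ℝ) ≤ H := by positivity
  nlinarith

/-- The grid has at most `X ^ (60 d²)` points, as `30 (d + d²) ≤ 60 d²`. The deviation level `61 d²
log X` leaves a spare factor `X ^ (-d²) ≤ 1 / X`, which with `K H ≤ X p / 2` gives half of the
failure probability. -/
theorem net_le {N : ℕ} (hN : (2 * N + 1 : ℝ) ≤ X ^ 30) :
    (K : ℝ) * H * (2 * N + 1) ^ (d + d * d) * Real.exp (-(61 * d ^ 2 * Real.log X)) ≤ p / 2 := by
  have hX := h.two_le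
  have hX0 : 0 < X := by linarith
  have hd : 1 ≤ d := h.hd
  have e1 : Real.exp (-(61 * d ^ 2 * Real.log X)) = (X ^ (61 * d ^ 2))⁻¹ := by
    rw [Real.exp_neg, ← Real.exp_log hX0, ← Real.exp_nat_mul, Real.log_exp]
    push_cast
    rfl
  have h1 : (2 * N + 1 : ℝ) ^ (d + d * d) ≤ X ^ (60 * d ^ 2) := by
    calc (2 * N + 1 : ℝ) ^ (d + d * d) ≤ (X ^ 30) ^ (d + d * d) := by gcongr
      _ = X ^ (30 * (d + d * d)) := by rw [← pow_mul]
      _ ≤ X ^ (60 * d ^ 2) := pow_le_pow_right₀ (by linarith) (by nlinarith)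
  rw [e1, ← div_eq_mul_inv, div_le_iff₀ (by positivity)]
  have hp := h.hp
  calc _ ≤ X * (p / 2) * X ^ (60 * d ^ 2) :=
        mul_le_mul h.KH_le_mul h1 (by positivity) (by positivity)
    _ = p / 2 * X ^ (60 * d ^ 2 + 1) := by ring
    _ ≤ p / 2 * X ^ (61 * d ^ 2) := by
        gcongr
        · linarith
        · nlinarith

theorem sqrt_log_le : √(Real.log X) ≤ X := by
  have hX := h.two_le
  rw [Real.sqrt_le_iff]
  refine ⟨by linarith, (Real.log_le_self (by linarith)).trans ?_⟩
  nlinarith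

theorem half_le_sqrt_log : 1 / 2 ≤ √(Real.log X) := by
  apply Real.le_sqrt_of_sq_le
  linarith [h.half_le_log]

theorem sqrt_log_le_two_mul : √(Real.log X) ≤ 2 * Real.log X := by
  have h1 := h.half_le_sqrt_log
  have h2 := Real.sq_sqrt (show 0 ≤ Real.log X by linarith [h.half_le_log])
  nlinarith

/-- Under the root there is at most `(1 + 122) d² log X`, and `123 ≤ 12²`. -/
theorem radius_le : (H : ℝ) * √(d * Real.log (d + K) + 2 * (61 * d ^ 2 * Real.log X))
    ≤ 12 * d * H * √(Real.log X) := by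
  have h0 := h.half_le_log
  have h1 := h.one_le_d
  have hl : Real.log (d + K) ≤ Real.log X := Real.log_le_log (by positivity) h.add_le
  have h2 : d * Real.log (d + K) + 2 * (61 * d ^ 2 * Real.log X) ≤ (12 * d) ^ 2 * Real.log X := by
    have : d * Real.log (d + K) ≤ d * Real.log X := by gcongr
    have : d * Real.log X ≤ d * d * Real.log X := by
      have : 0 ≤ d * Real.log X := by positivity
      nlinarith
    have : 0 ≤ (d : ℝ) * d * Real.log X := by positivity
    nlinarith
  have h3 := Real.sqrt_le_sqrt h2
  rw [Real.sqrt_mul (by positivity), Real.sqrt_sq (by positivity)] at h3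
  calc _ ≤ H * (12 * d * √(Real.log X)) := by gcongr
    _ = _ := by ring

end LogArg

theorem lt_epochStart_add {n : ℕ} (k : ℕ) (hn : 0 < n) : k < epochStart n k + n :=
  Nat.lt_div_mul_add hn

section Bonus

variable {p X c : ℝ} (h : LogArg d H K p X) {W k : ℕ}
include h

theorem bonus_eq : M.bonus c p W k = c * d * H * √(Real.log X)
    + M.varθ (epochStart (W / H) k) (min (epochStart (W / H) k + W / H) K)
      * √(d * ((k - epochStart (W / H) k : ℕ) : ℝ))
    + M.varμ (epochStart (W / H) k) (min (epochStart (W / H) k + W / H) K) * H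
      * √(d * ((k - epochStart (W / H) k : ℕ) : ℝ)) := by
  have : epochStart (W / H) k ≤ k := Nat.div_mul_le_self _ _
  rw [Nat.cast_sub this, h.eq]
  rfl

theorem bonus_nonneg (hc : 0 ≤ c) : 0 ≤ M.bonus c p W k := by
  rw [bonus_eq h]
  have h1 := M.varθ_nonneg (epochStart (W / H) k) (min (epochStart (W / H) k + W / H) K)
  have h2 := M.varμ_nonneg (epochStart (W / H) k) (min (epochStart (W / H) k + W / H) K)
  positivity

/-- Only polynomial growth in `X` matters here, to choose the grid resolution, so the variations are
bounded trivially by `2√d` per step and episode. -/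
theorem bonus_le (hk : k < K) : M.bonus 20 p W k ≤ X ^ 10 := by
  rw [bonus_eq h]
  set τ := epochStart (W / H) k
  set e := min (τ + W / H) K
  have hX := h.two_le
  have hs : √(d * ((k - τ : ℕ) : ℝ)) ≤ √d * K := by
    rw [Real.sqrt_mul (by positivity)]
    gcongr
    rw [Real.sqrt_le_left (by positivity)]
    have h1 : ((k - τ : ℕ) : ℝ) ≤ K := by exact_mod_cast (by omega : k - τ ≤ K)
    nlinarith [h.one_le_K]
  have hdd : √(d : ℝ) * √d = d := Real.mul_self_sqrt (by positivity)
  have h1 : 20 * d * H * √(Real.log X) ≤ X ^ 7 := by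
    calc 20 * d * H * √(Real.log X) = 20 * ((d * H) * √(Real.log X)) := by ring
      _ ≤ 20 * (X * X) := by
          gcongr
          · exact h.dH_le
          · exact h.sqrt_log_le
      _ ≤ X ^ 5 * (X * X) := by
          gcongr
          calc (20 : ℝ) ≤ 2 ^ 5 := by norm_num
            _ ≤ X ^ 5 := by gcongr
      _ = X ^ 7 := by ring
  have h2 : M.varθ τ e * √(d * ((k - τ : ℕ) : ℝ)) ≤ X ^ 2 := by
    calc _ ≤ K * (H * (2 * √d)) * (√d * K) := by
          gcongr
          exact varθ_le _ (min_le_right _ _)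
      _ = (2 * d * (K * H)) * K := by linear_combination (2 * K * H * K : ℝ) * hdd
      _ ≤ X * X := by
          gcongr
          · exact h.two_mul_le
          · exact h.K_le
      _ = X ^ 2 := by ring
  have h3 : M.varμ τ e * H * √(d * ((k - τ : ℕ) : ℝ)) ≤ X ^ 3 := by
    calc _ ≤ K * (H * (2 * √d)) * H * (√d * K) := by
          gcongr
          exact varμ_le _ (min_le_right _ _)
      _ = (2 * d * (K * H)) * K * H := by linear_combination (2 * K * H * K * H : ℝ) * hdd
      _ ≤ X * X * X := by
          gcongr
          · exact h.two_mul_le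
          · exact h.K_le
          · exact h.H_le
      _ = X ^ 3 := by ring
  have h4 : X ^ 2 ≤ X ^ 7 := pow_le_pow_right₀ (by linarith) (by norm_num)
  have h5 : X ^ 3 ≤ X ^ 7 := pow_le_pow_right₀ (by linarith) (by norm_num)
  have h6 : X ^ 7 * 8 ≤ X ^ 10 := by
    calc X ^ 7 * 8 ≤ X ^ 7 * X ^ 3 := by
          gcongr
          calc (8 : ℝ) = 2 ^ 3 := by norm_num
            _ ≤ X ^ 3 := by gcongr
      _ = X ^ 10 := by ring
  have h7 : 0 ≤ X ^ 7 := by positivity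
  linarith

/-- The resolution of the grid suffices. -/
theorem resolution_le (hk : k < K) :
    d * (1 / X ^ 26) + M.bonus 20 p W k * (d * √(1 / X ^ 26)) ≤ 1 / X := by
  have hX := h.two_le
  have hX0 : 0 < X := by linarith
  -- The square root halves the exponent of the resolution; `X ^ 13` still beats the bonus, at most
  -- `X ^ 10`, times `d ≤ X`.
  have e1 : √(1 / X ^ 26) = 1 / X ^ 13 := by
    rw [Real.sqrt_eq_iff_mul_self_eq (by positivity) (by positivity)]
    field_simp
  rw [e1]
  have h1 : d * (1 / X ^ 26) ≤ 1 / X ^ 2 := by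
    calc d * (1 / X ^ 26) ≤ X * (1 / X ^ 26) := by gcongr; exact h.d_le
      _ = 1 / X ^ 25 := by field_simp
      _ ≤ 1 / X ^ 2 := by
          apply one_div_le_one_div_of_le (by positivity)
          exact pow_le_pow_right₀ (by linarith) (by norm_num)
  have h2 : M.bonus 20 p W k * (d * (1 / X ^ 13)) ≤ 1 / X ^ 2 := by
    calc _ ≤ X ^ 10 * (X * (1 / X ^ 13)) := by
          gcongr
          · exact bonus_le h hk
          · exact h.d_le
      _ = 1 / X ^ 2 := by field_simp
  calc _ ≤ 1 / X ^ 2 + 1 / X ^ 2 := add_le_add h1 h2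
    _ = 2 / X * (1 / X) := by field_simp; ring
    _ ≤ 1 * (1 / X) := by
        gcongr
        rw [div_le_one hX0]; exact hX
    _ = 1 / X := one_mul _

theorem grid_size : 2 * K * H / (1 / X ^ 26) + 1 ≤ ((⌈X ^ 27⌉₊ + 1 : ℕ) : ℝ) ∧
    (2 * ((⌈X ^ 27⌉₊ + 1 : ℕ) : ℝ) + 1) ≤ X ^ 30 := by
  have hX := h.two_le
  have hX0 : 0 < X := by linarith
  have h1 := Nat.le_ceil (X ^ 27)
  have h2 := Nat.ceil_lt_add_one (show 0 ≤ X ^ 27 by positivity)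
  push_cast
  constructor
  · have : 2 * K * H / (1 / X ^ 26) ≤ X ^ 27 := by
      rw [div_div_eq_mul_div, div_one, show X ^ 27 = X * X ^ 26 by ring]
      gcongr
      exact h.KH_le
    linarith
  · have h3 : (1 : ℝ) ≤ X ^ 27 := one_le_pow₀ (by linarith)
    have h4 : X ^ 27 * 8 ≤ X ^ 30 := by
      calc X ^ 27 * 8 ≤ X ^ 27 * X ^ 3 := by
            gcongr
            calc (8 : ℝ) = 2 ^ 3 := by norm_num
              _ ≤ X ^ 3 := by gcongr
        _ = X ^ 30 := by ring
    linarith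

/-- The value `c = 20` splits as `12` for the noise and `8` for the discretization error and the
bias: these are at most `2 + 2dH ≤ 4dH`, and `√log X ≥ 1 / 2`. The drift terms are dominated because
`d ≥ 1`. -/
theorem radius_le_bonus :
    (H * √(d * Real.log (d + K) + 2 * (61 * d ^ 2 * Real.log X)) + 2 * (1 / X) * K)
      + (1 + H) * √d + (M.varθ (epochStart (W / H) k) (min (epochStart (W / H) k + W / H) K)
        + H * M.varμ (epochStart (W / H) k) (min (epochStart (W / H) k + W / H) K))
        * √(k - epochStart (W / H) k : ℕ) ≤ M.bonus 20 p W k := by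
  rw [bonus_eq h]
  have h1 := M.varθ_nonneg (epochStart (W / H) k) (min (epochStart (W / H) k + W / H) K)
  have h2 := M.varμ_nonneg (epochStart (W / H) k) (min (epochStart (W / H) k + W / H) K)
  set τ := epochStart (W / H) k
  set e := min (τ + W / H) K
  have hX := h.two_le
  have hd := h.one_le_d
  have hH := h.one_le_H
  have hs : √((k - τ : ℕ) : ℝ) ≤ √(d * ((k - τ : ℕ) : ℝ)) := by
    apply Real.sqrt_le_sqrt
    have : (0 : ℝ) ≤ ((k - τ : ℕ) : ℝ) := by positivity
    nlinarith
  have a1 := h.radius_le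
  have a2 : 2 * (1 / X) * K ≤ 2 := by
    have : K / X ≤ 1 := by rw [div_le_one (by linarith)]; exact h.K_le
    calc 2 * (1 / X) * K = 2 * (K / X) := by ring
      _ ≤ 2 := by linarith
  have hdH : (1 : ℝ) ≤ d * H := one_le_mul_of_one_le_of_one_le hd hH
  have a3 : (1 + H) * √(d : ℝ) ≤ 2 * (d * H) := by
    have : √(d : ℝ) ≤ d := by
      rw [Real.sqrt_le_left (by linarith)]; nlinarith
    calc (1 + H) * √(d : ℝ) ≤ (H + H) * d := by gcongr
      _ = _ := by ring
  have a4 : 4 * ((d : ℝ) * H) ≤ 8 * (d * H) * √(Real.log X) := by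
    have := h.half_le_sqrt_log
    have : (0 : ℝ) ≤ d * H := by positivity
    nlinarith
  have a5 : (M.varθ τ e + H * M.varμ τ e) * √((k - τ : ℕ) : ℝ)
      ≤ M.varθ τ e * √(d * ((k - τ : ℕ) : ℝ)) + M.varμ τ e * H * √(d * ((k - τ : ℕ) : ℝ)) := by
    calc _ ≤ (M.varθ τ e + H * M.varμ τ e) * √(d * ((k - τ : ℕ) : ℝ)) := by gcongr
      _ = _ := by ring
  have a6 : 0 ≤ (d : ℝ) * H * √(Real.log X) := by positivity
  linarith

end Bonus

end LinearMDP

namespace LinearMDP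

/-! ### The dynamic regret -/

/-- With `W = n H` the half-integer powers of `H` combine to `H²`. -/
theorem rate_eq {d H K n : ℕ} (hH : 0 < H) (hn : 0 < n) :
    (H : ℝ) ^ (3 / 2 : ℝ) * (d : ℝ) ^ (3 / 2 : ℝ) * (K * H)
      * ((n * H : ℕ) : ℝ) ^ (-(1 / 2) : ℝ) = K * H ^ 2 * (d * √d) / √n := by
  have e : ∀ m : ℕ, (m : ℝ) ^ (3 / 2 : ℝ) = m * √m := by
    intro m
    rw [Real.sqrt_eq_rpow, show (3 / 2 : ℝ) = 1 + 1 / 2 by norm_num,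
      Real.rpow_add' (by positivity) (by norm_num), Real.rpow_one]
  have hH' : 0 < √(H : ℝ) := Real.sqrt_pos.mpr (by exact_mod_cast hH)
  have hn' : 0 < √(n : ℝ) := Real.sqrt_pos.mpr (by exact_mod_cast hn)
  rw [e, e, Real.rpow_neg (by positivity), ← Real.sqrt_eq_rpow]
  push_cast
  rw [Real.sqrt_mul (by positivity)]
  field_simp

section Regret

variable {p X : ℝ} {d H K : ℕ} (h : LogArg d H K p X)
include h

/-- There are at most `2K / n` epochs, and their fixed bonus parts give `K H² d√d / √n`; the
variation parts multiply `√(dn)` by `H√(dn)`, that is `d W`. The martingale term `H²√K` is absorbed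
through `n ≤ K`. Stray factors `√log X` are at most `2 log X`. -/
theorem total_le {n : ℕ} (hn : 0 < n) (hnK : n ≤ K) {Bθ Bμ : ℝ} (hθ : 0 ≤ Bθ) (hμ : 0 ≤ Bμ) :
    2 * ((((K / n + 1 : ℕ) : ℝ) * (20 * d * H * √(Real.log X)) + (Bθ + H * Bμ) * √(d * n))
        * (H * √(2 * n * (d * Real.log X)))) + H * (H * √K * (Real.log X + 1 / 2))
      ≤ 200 * Real.log X ^ 1 * (K * H ^ 2 * (d * √d) / √n + Bθ * d * (n * H : ℕ)
          + Bμ * d * H * (n * H : ℕ)) := by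
  have hn1 : (1 : ℝ) ≤ n := by exact_mod_cast hn
  have hnK' : (n : ℝ) ≤ K := by exact_mod_cast hnK
  have hd := h.one_le_d
  have hH := h.one_le_H
  have hl := h.half_le_log
  have hs2 := h.sqrt_log_le_two_mul
  set ι := Real.log X with hι
  have hι0 : 0 ≤ ι := by linarith
  set r := √(n : ℝ) with hr
  have hr0 : 0 < r := Real.sqrt_pos.mpr (by linarith)
  have hrr : r * r = n := Real.mul_self_sqrt (by linarith)
  set q := √(d : ℝ) with hq
  have hq1 : 1 ≤ q := Real.one_le_sqrt.mpr hd
  have hqq : q * q = d := Real.mul_self_sqrt (by linarith)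
  set s := √ι with hs
  have hs0 : 0 ≤ s := Real.sqrt_nonneg _
  have hss : s * s = ι := Real.mul_self_sqrt hι0
  have hY : √(2 * n * (d * ι)) ≤ 2 * (r * q * s) := by
    have e : r * q * s = √(n * (d * ι)) := by
      rw [Real.sqrt_mul (by positivity), Real.sqrt_mul (by positivity)]; ring
    rw [e, show 2 * (n : ℝ) * (d * ι) = 2 * (n * (d * ι)) by ring, Real.sqrt_mul (by norm_num)]
    gcongr
    rw [Real.sqrt_le_left (by norm_num)]
    norm_num
  have hdn : √((d : ℝ) * n) = q * r := Real.sqrt_mul (by positivity) _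
  have hJ : (((K / n + 1 : ℕ) : ℝ)) ≤ 2 * (K / (r * r)) := by
    rw [hrr]
    push_cast
    have h1 : ((K / n : ℕ) : ℝ) ≤ K / n := Nat.cast_div_le
    have h2 : 1 ≤ (K : ℝ) / n := by rw [one_le_div (by linarith)]; exact hnK'
    linarith
  have hKr : √(K : ℝ) ≤ K / r := by
    rw [le_div_iff₀ hr0]
    calc √(K : ℝ) * r ≤ √(K : ℝ) * √K := by rw [hr]; gcongr
      _ = K := Real.mul_self_sqrt (by positivity)
  rw [hdn, pow_one]
  push_cast
  set G : ℝ := K * H ^ 2 * (d * q) / r with hG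
  have hG0 : 0 ≤ G := by positivity
  have t1 : 2 * (((K / n : ℕ) : ℝ) + 1) * (20 * d * H * s) * (H * √(2 * n * (d * ι)))
      ≤ 160 * ι * G := by
    have hJ' : ((K / n : ℕ) : ℝ) + 1 ≤ 2 * (K / (r * r)) := by exact_mod_cast hJ
    calc _ ≤ 2 * (2 * (K / (r * r))) * (20 * d * H * s) * (H * (2 * (r * q * s))) := by gcongr
      _ = 160 * (s * s) * G := by rw [hG]; field_simp; ring
      _ = _ := by rw [hss]
  have t2 : 2 * ((Bθ + H * Bμ) * (q * r)) * (H * √(2 * n * (d * ι)))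
      ≤ 8 * ι * (Bθ * d * (n * H) + Bμ * d * H * (n * H)) := by
    calc _ ≤ 2 * ((Bθ + H * Bμ) * (q * r)) * (H * (2 * (r * q * s))) := by gcongr
      _ = 4 * s * ((Bθ + H * Bμ) * (q * q) * (r * r) * H) := by ring
      _ ≤ 4 * (2 * ι) * ((Bθ + H * Bμ) * (q * q) * (r * r) * H) := by gcongr
      _ = _ := by rw [hqq, hrr]; ring
  have t3 : H * (H * √(K : ℝ) * (ι + 1 / 2)) ≤ 2 * ι * G := by
    have hdq : (1 : ℝ) ≤ d * q := one_le_mul_of_one_le_of_one_le hd hq1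
    calc _ ≤ H * (H * (K / r) * (ι + ι)) := by gcongr
      _ = 2 * ι * (K * H ^ 2 * 1 / r) := by ring
      _ ≤ 2 * ι * G := by rw [hG]; gcongr
  have t4 : 0 ≤ ι * (Bθ * d * (n * H) + Bμ * d * H * (n * H)) := by positivity
  have t5 : 0 ≤ ι * G := by positivity
  linarith

variable {S A Ω : Type*} [MeasurableSpace S] [MeasurableSpace A] [MeasurableSingletonClass A]
  [Fintype A] [Nonempty A] [mΩ : MeasurableSpace Ω] {P : Measure Ω} {ℱ : Filtration ℕ mΩ}
  {M : LinearMDP S A d H K} {x : ℕ → ℕ → Ω → S} {π : ℕ → ℕ → Ω → S → A} {n : ℕ}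

omit [MeasurableSingletonClass A] [Fintype A] [Nonempty A] in
/-- The sum of the bonuses along the trajectory. -/
theorem sum_bonuses_le (hn : 0 < n) (y : ℕ → ℕ → S) (a : ℕ → ℕ → A) :
    ∑ k ∈ range K, M.bonus 20 p (n * H) k * ∑ i ∈ range H,
        √(quad (M.gram (n * H) y a k i) (M.φ (y k i) (a k i)).ofLp)
      ≤ (((K / n + 1 : ℕ) : ℝ) * (20 * d * H * √(Real.log X))
          + (M.varθ 0 K + H * M.varμ 0 K) * √(d * n)) * (H * √(2 * n * (d * Real.log X))) := by
  have hWH : n * H / H = n := Nat.mul_div_cancel _ h.hH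
  have hlog := h.half_le_log
  -- One more than the rounded-down quotient, to include a possibly shorter last epoch.
  have hmin : min ((K / n + 1) * n) K = K := by
    have : K < K / n * n + n := Nat.lt_div_mul_add hn
    rw [Nat.succ_mul]; omega
  have key := sum_bonus_le (M := M) hn (β := M.bonus 20 p (n * H))
    (s := fun k => ∑ i ∈ range H, √(quad (M.gram (n * H) y a k i) (M.φ (y k i) (a k i)).ofLp))
    (b₀ := 20 * d * H * √(Real.log X)) (r := √(d * n))
    (Y := H * √(2 * n * (d * Real.log X))) (by positivity) (by positivity)
    (fun k => Finset.sum_nonneg fun _ _ => Real.sqrt_nonneg _) ?_ ?_ (K / n + 1)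
  · rwa [hmin] at key
  · intro j k hjk hk
    have he : epochStart n k = j * n := epochStart_eq hjk (by omega)
    rw [bonus_eq h, hWH, he]
    have h1 := M.varθ_nonneg (j * n) (min (j * n + n) K)
    have h2 := M.varμ_nonneg (j * n) (min (j * n + n) K)
    have h3 : √(d * ((k - j * n : ℕ) : ℝ)) ≤ √(d * n) := by
      gcongr
      omega
    have h4 : M.varθ (j * n) (min (j * n + n) K) * √(d * ((k - j * n : ℕ) : ℝ))
        ≤ M.varθ (j * n) (min (j * n + n) K) * √(d * n) := by gcongr
    have h5 : M.varμ (j * n) (min (j * n + n) K) * H * √(d * ((k - j * n : ℕ) : ℝ))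
        ≤ M.varμ (j * n) (min (j * n + n) K) * H * √(d * n) := by gcongr
    linarith
  · intro j hj
    set e := min (j * n + n) K with he
    rw [Finset.sum_comm]
    calc _ ≤ ∑ _i ∈ range H, √(2 * n * (d * Real.log X)) := by
          refine Finset.sum_le_sum fun i _ => ?_
          have h1 := sum_sqrt_quad_le (M.features y a i) (a := j * n) (t := e) (by omega)
            fun l _ => M.φ_dotProduct_self_le _ _
          refine le_trans (le_of_eq (Finset.sum_congr rfl fun k hk => ?_)) (h1.trans ?_)
          · have hk' := Finset.mem_Ico.mp hk
            have hes : epochStart n k = j * n := epochStart_eq hk'.1 (by omega)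
            rw [gram_eq, hWH, hes]
            rfl
          · have h2 : ((e - j * n : ℕ) : ℝ) ≤ n := by exact_mod_cast (by omega : e - j * n ≤ n)
            have h3 : Real.log (d + (e - j * n : ℕ)) ≤ Real.log X := by
              have h4 : ((e - j * n : ℕ) : ℝ) ≤ K := by exact_mod_cast (by omega : e - j * n ≤ K)
              have h5 := h.one_le_d
              exact Real.log_le_log (by positivity) (by linarith [h.add_le])
            have h6 : 0 ≤ Real.log (d + (e - j * n : ℕ)) := Real.log_nonneg (by
              have := h.one_le_d
              have : (0 : ℝ) ≤ (e - j * n : ℕ) := by positivity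
              linarith)
            gcongr
      _ = _ := by simp

/-- On the good event, the dynamic regret is at most the bonuses plus the martingale terms. -/
theorem dynReg_le (hn : 0 < n) (hI : M.IsInteraction P ℱ x π)
    (hL : M.IsLSVIUCBRestart (n * H) (M.bonus 20 p (n * H)) x π) {ω : Ω} {D : ℝ} (hD : 0 ≤ D)
    (h1 : ∀ k < K, M.NoiseBound (n * H) (M.bonus 20 p (n * H) k)
      (H * √(d * Real.log (d + K) + 2 * (61 * d ^ 2 * Real.log X)) + 2 * (1 / X) * K)
      (fun l j => x l j ω) (fun l j => played x π l j ω) k)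
    (h2 : ∀ i, i + 1 < H → ∑ k ∈ range K,
      (∫ y, M.valueGap (n * H) (M.bonus 20 p (n * H)) x π k (i + 1) (ω, y)
          ∂(M.trans k i (x k i ω, played x π k i ω))
        - M.valueGap (n * H) (M.bonus 20 p (n * H)) x π k (i + 1) (ω, x k (i + 1) ω)) ≤ D) :
    M.dynReg x π ω ≤ 2 * ((((K / n + 1 : ℕ) : ℝ) * (20 * d * H * √(Real.log X))
      + (M.varθ 0 K + H * M.varμ 0 K) * √(d * n)) * (H * √(2 * n * (d * Real.log X))))
      + H * D := by
  have hX := h.two_le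
  have hWH : n * H / H = n := Nat.mul_div_cancel _ h.hH
  have hgood : ∀ k < K, M.GoodEstimates (n * H) (M.bonus 20 p (n * H)) (fun l j => x l j ω)
      (fun l j => played x π l j ω) k := fun k hk =>
    goodEstimates (e := min (epochStart (n * H / H) k + n * H / H) K) hk
      (lt_min (lt_epochStart_add k (by rw [hWH]; exact hn)) hk) (by positivity) (h1 k hk)
      (radius_le_bonus h)
  have hreg : ∀ k < K, M.optValue k 0 (x k 0 ω) - M.value k (fun i => π k i ω) 0 (x k 0 ω)
      ≤ 2 * (M.bonus 20 p (n * H) k * ∑ i ∈ range H,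
          √(quad (M.gram (n * H) (fun l j => x l j ω) (fun l j => played x π l j ω) k i)
            (M.φ (x k i ω) (played x π k i ω)).ofLp))
        + ∑ i ∈ range (H - 1),
          (∫ y, M.valueGap (n * H) (M.bonus 20 p (n * H)) x π k (i + 1) (ω, y)
              ∂(M.trans k i (x k i ω, played x π k i ω))
            - M.valueGap (n * H) (M.bonus 20 p (n * H)) x π k (i + 1) (ω, x k (i + 1) ω)) := by
    intro k hk
    have hg := hgood k hk
    have a1 := hg.optValue_le hk (x k 0 ω)
    have a2 := hg.estValue_sub_value_le hk (f := fun i => π k i ω)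
      (fun i hi => hI.measurable_act hk hi ω) (fun i hi s b => hL k hk i hi ω s b)
      (fun i => x k i ω) (H - 1) 0 (by have := h.hH; omega)
    have a3 : ∀ i ∈ range (H - 1), ∀ y,
        M.valueGap (n * H) (M.bonus 20 p (n * H)) x π k (i + 1) (ω, y)
          = M.estValue (n * H) (M.bonus 20 p (n * H)) (fun l j => x l j ω)
              (fun l j => played x π l j ω) k (i + 1) y
            - M.value k (fun i => π k i ω) (i + 1) y := by
      intro i hi y
      have hi' := Finset.mem_range.mp hi
      -- `valueGap` is clipped at `0` to be bounded on every outcome, as the Azuma bound requires;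
      -- on the good event the clipping is inactive.
      rw [valueGap, max_eq_right (hg.nonneg (i + 1) (by omega) y)]
    have a4 : ∑ i ∈ range (H - 1),
          (∫ y, M.valueGap (n * H) (M.bonus 20 p (n * H)) x π k (i + 1) (ω, y)
              ∂(M.trans k i (x k i ω, played x π k i ω))
            - M.valueGap (n * H) (M.bonus 20 p (n * H)) x π k (i + 1) (ω, x k (i + 1) ω))
        = ∑ i ∈ range (H - 1),
          (∫ y, (M.estValue (n * H) (M.bonus 20 p (n * H)) (fun l j => x l j ω)
              (fun l j => played x π l j ω) k (i + 1) y
              - M.value k (fun i => π k i ω) (i + 1) y)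
              ∂(M.trans k i (x k i ω, played x π k i ω))
            - (M.estValue (n * H) (M.bonus 20 p (n * H)) (fun l j => x l j ω)
              (fun l j => played x π l j ω) k (i + 1) (x k (i + 1) ω)
              - M.value k (fun i => π k i ω) (i + 1) (x k (i + 1) ω))) := by
      refine Finset.sum_congr rfl fun i hi => ?_
      simp only [a3 i hi]
    rw [a4, Finset.mul_sum, Finset.mul_sum]
    rw [← Finset.range_eq_Ico, ← Finset.range_eq_Ico] at a2
    refine le_trans ?_ a2
    exact sub_le_sub_right a1 _
  calc M.dynReg x π ω ≤ _ := Finset.sum_le_sum fun k hk => hreg k (Finset.mem_range.mp hk)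
    _ = 2 * ∑ k ∈ range K, (M.bonus 20 p (n * H) k * ∑ i ∈ range H,
          √(quad (M.gram (n * H) (fun l j => x l j ω) (fun l j => played x π l j ω) k i)
            (M.φ (x k i ω) (played x π k i ω)).ofLp))
        + ∑ i ∈ range (H - 1), ∑ k ∈ range K,
          (∫ y, M.valueGap (n * H) (M.bonus 20 p (n * H)) x π k (i + 1) (ω, y)
              ∂(M.trans k i (x k i ω, played x π k i ω))
            - M.valueGap (n * H) (M.bonus 20 p (n * H)) x π k (i + 1) (ω, x k (i + 1) ω)) := by
        -- The sums over steps and episodes are exchanged because the martingale bound holds for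
        -- each step, summed over the episodes.
        rw [Finset.sum_add_distrib, ← Finset.mul_sum, Finset.sum_comm (s := range K)]
    _ ≤ _ := by
        refine add_le_add ?_ ?_
        · exact mul_le_mul_of_nonneg_left
            (sum_bonuses_le h hn (fun l j => x l j ω) (fun l j => played x π l j ω)) (by norm_num)
        · calc _ ≤ ∑ _i ∈ range (H - 1), D := by
                refine Finset.sum_le_sum fun i hi => h2 i ?_
                have := Finset.mem_range.mp hi
                omega
            _ = (H - 1 : ℕ) * D := by simp
            _ ≤ H * D := by gcongr; omega

theorem prob_dynReg_le [IsProbabilityMeasure P] (hn : 0 < n) (hnK : n ≤ K)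
    (hI : M.IsInteraction P ℱ x π)
    (hL : M.IsLSVIUCBRestart (n * H) (M.bonus 20 p (n * H)) x π) :
    ENNReal.ofReal (1 - p) ≤ P {ω | M.dynReg x π ω ≤ 200 * Real.log X ^ 1 *
      (K * H ^ 2 * (d * √d) / √n + M.varθ 0 K * d * (n * H : ℕ)
        + M.varμ 0 K * d * H * (n * H : ℕ))} := by
  have hX := h.two_le
  have hX0 : 0 < X := by linarith
  have hl := h.half_le_log
  obtain ⟨E, hE, hgood⟩ := hI.exists_bad_event h.hK h.hH (n * H) (β := M.bonus 20 p (n * H))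
    (fun k _ => bonus_nonneg h (by norm_num)) (η := 1 / X ^ 26) (by positivity)
    (N := ⌈X ^ 27⌉₊ + 1) (grid_size h).1 (ε := 1 / X) (fun k hk => resolution_le h hk)
    (61 * d ^ 2 * Real.log X) (Real.log X)
  have hPE : P E ≤ ENNReal.ofReal p := by
    refine hE.trans (ENNReal.ofReal_le_ofReal ?_)
    have b1 := h.net_le (grid_size h).2
    have b2 := h.H_div_le
    linarith
  have hsub : Eᶜ ⊆ {ω | M.dynReg x π ω ≤ 200 * Real.log X ^ 1 *
      (K * H ^ 2 * (d * √d) / √n + M.varθ 0 K * d * (n * H : ℕ)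
        + M.varμ 0 K * d * H * (n * H : ℕ))} := by
    intro ω hω
    obtain ⟨g1, g2⟩ := hgood ω hω
    exact (dynReg_le h hn hI hL (by positivity) g1 g2).trans
      (total_le h hn hnK (M.varθ_nonneg 0 K) (M.varμ_nonneg 0 K))
  refine le_trans ?_ (measure_mono hsub)
  rw [ENNReal.ofReal_sub _ h.hp.le, ENNReal.ofReal_one, tsub_le_iff_right]
  -- Subadditivity suffices, so no measurability of `E` or of the regret is required.
  calc (1 : ENNReal) = P Set.univ := measure_univ.symm
    _ ≤ P Eᶜ + P E := by
        rw [← Set.compl_union_self E]; exact measure_union_le _ _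
    _ ≤ P Eᶜ + ENNReal.ofReal p := by gcongr

end Regret

end LinearMDP

end NonstatRL

end

theorem mainTheorem4 :
    ∃ (c C : ℝ) (q : ℕ), 0 < c ∧ 0 < C ∧
      ∀ (S A Ω : Type*) [MeasurableSpace S] [MeasurableSpace A] [MeasurableSingletonClass A]
        [Fintype A] [Nonempty A] [mΩ : MeasurableSpace Ω]
        (P : Measure Ω) [IsProbabilityMeasure P] (d H K W : ℕ) (p : ℝ)
        (M : NonstatRL.LinearMDP S A d H K) (ℱ : Filtration ℕ mΩ)
        (x : ℕ → ℕ → Ω → S) (π : ℕ → ℕ → Ω → S → A),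
        0 < p → p < 1 → 0 < W → W ≤ K * H → H ∣ W →
        M.IsInteraction P ℱ x π →
        M.IsLSVIUCBRestart W (M.bonus c p W) x π →
        ENNReal.ofReal (1 - p) ≤
          P {ω | M.dynReg x π ω ≤
            C * Real.log (2 * d * (K * H) / p) ^ q *
              ((H : ℝ) ^ (3 / 2 : ℝ) * (d : ℝ) ^ (3 / 2 : ℝ) * (K * H) * (W : ℝ) ^ (-(1 / 2) : ℝ)
                + M.varθ 0 K * d * W
                + M.varμ 0 K * d * H * W)} := by
  refine ⟨20, 200, 1, by norm_num, by norm_num, ?_⟩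
  intro S A Ω _ _ _ _ _ mΩ P _ d H K W p M ℱ x π hp hp1 hW hWT hHW hI hL
  obtain ⟨n, rfl⟩ := hHW
  rw [mul_comm H n] at *
  have hn : 0 < n := Nat.pos_of_mul_pos_right hW
  have hH : 0 < H := Nat.pos_of_mul_pos_left hW
  have hnK : n ≤ K := Nat.le_of_mul_le_mul_right hWT hH
  have hK : 0 < K := hn.trans_le hnK
  have hΩ : Nonempty Ω := P.nonempty_of_neZero
  -- A state is needed only to exclude `d = 0`; it comes from an outcome, which exists since `P` has
  -- mass one.
  have hS : Nonempty S := hΩ.map (x 0 0)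
  have hlog : NonstatRL.LinearMDP.LogArg d H K p (2 * d * (K * H) / p) :=
    ⟨M.dim_pos hK hH, hK, hH, hp, hp1, rfl⟩
  rw [NonstatRL.LinearMDP.rate_eq hH hn]
  exact NonstatRL.LinearMDP.prob_dynReg_le hlog hn hnK hI hL
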